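/- **Setting.** Consider a connected undirected graph with buses $1,\dots,n$ and oriented lines $1,\dots,m$, with incidence matrix $D\in\mathbb R^{m\times n}$, inertias $M_i\ge 0$ (at least one positive), dampings $E_i>0$, susceptances $b_k>0$, and $M=\operatorname{diag}(M_i)$, $E=\operatorname{diag}(E_i)$, $Y_b=\operatorname{diag}(b_k)$. The swing equations are $$\dot\lambda=D\omega,\qquad M\dot\omega=-E\omega-D^TY_b\sin\lambda+p(t)+u(t),$$ with $\sin$ taken component-wise; solutions on $[0,\infty)$ are understood in the Carathéodory sense, the equations with $M_i=0$ being algebraic and holding for all $t$. Let $\mathcal I^\omega\subseteq\mathcal I^u\subseteq\{1,\dots,n\}$ (frequency-constrained and controlled buses), with thresholds $\underline\omega_i^{thr}<0<\bar\omega_i^{thr}$ for $i\in\mathcal I^u$ and safe bounds $\underline\omega_i<\underline\omega_i^{thr}$, $\bar\omega_i^{thr}<\bar\omega_i$ for $i\in\mathcal I^\omega$; $\xi_i\in\{0,1\}$ ($1$ = soft, $0$ = hard input constraint), $u_i^{\min},u_i^{\max}\in\mathbb R$ with $u_i^{\min}\le 0\le u_i^{\max}$ if $\xi_i=0$; weights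 $c_i,d_i>0$ ($i\in\mathcal I^u$), $e_i>0$ and $0<\delta_i<\bar\omega_i-\underline\omega_i$, $\bar\gamma_i,\underline\gamma_i>0$ ($i\in\mathcal I^\omega$); a prediction window $\tilde t>0$; and forecasts $p^{fcst}_t:[t,t+\tilde t]\to\mathbb R^n$ with $p^{fcst}_t(t)=p(t)$ for all $t\ge 0$. **Controller.** Given $T>0$, put $N=\lceil\tilde t/T\rceil$. At time $t$ and state $(\lambda_0,\omega_0)$ let $\hat p(k)=p^{fcst}_t(t+kT)$, and $\kappa_i=0$ if $\xi_i=1$ and $\omega_{0,i}\in[\underline\omega_i,\bar\omega_i]$, $\kappa_i=1$ otherwise. Common constraints (C): $\hat\lambda(0)=\sin\lambda_0$, $\hat\omega(0)=\omega_0$, and for $0\le k<N$ $$\hat\lambda(k+1)=\hat\lambda(k)+TD\hat\omega(k),\quad M(\hat\omega(k+1)-\hat\omega(k))/T=-E\hat\omega(k)-D^TY_b\hat\lambda(k)+\hat p(k)+\hat u(k),$$ $\hat u_i(k)=0$ for $i\notin\mathcal I^u$, $u_i^{\min}-\xi_i\beta_i(k)\le\hat u_i(k)\le u_i^{\max}+\xi_i\beta_i(k)$,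 $\beta_i(k)\ge0$ for $i\in\mathcal I^u$; and for $1\le k\le N$, $i\in\mathcal I^\omega$: $\underline\omega_i-\kappa_i(\gamma_i(k)-\delta_i)\le\hat\omega_i(k)\le\bar\omega_i+\kappa_i(\gamma_i(k)-\delta_i)$, $\gamma_i(k)\ge0$. The reference trajectory is the trajectory of the prediction model with input $\hat u^{ref}_i(k)=0$ for $i\notin\mathcal I^\omega$ and, for $i\in\mathcal I^\omega$, $\hat u^{ref}_i(k)=\operatorname{sat}(\hat u^a_i(k))$, where with $v=-E\hat\omega^{ref}-D^TY_b\hat\lambda^{ref}+\hat p$ (at step $k$) $$\hat u_i^a=\begin{cases}\min\{0,\ \bar\gamma_i(\bar\omega_i-\hat\omega^{ref}_i)/(\hat\omega_i^{ref}-\bar\omega_i^{thr})-v_i\}&\hat\omega_i^{ref}>\bar\omega_i^{thr},\\ 0&\underline\omega_i^{thr}\le\hat\omega_i^{ref}\le\bar\omega_i^{thr},\\ \max\{0,\ \underline\gamma_i(\underline\omega_i-\hat\omega^{ref}_i)/(\underline\omega_i^{thr}-\hat\omega_i^{ref})-v_i\}&\hat\omega_i^{ref}<\underline\omega_i^{thr},\end{cases}$$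 and $\operatorname{sat}$ clips to $[u_i^{\min},u_i^{\max}]$ if $\xi_i=0$ and is the identity if $\xi_i=1$. It is required to satisfy (C) for some $\beta,\gamma$, and, for all $i\in\mathcal I^u$, $k<N$: $\hat\omega_i\hat u_i\le0$ if $\hat\omega_i\notin(\underline\omega_i^{thr},\bar\omega_i^{thr})$, and $\hat u_i=0$ otherwise. The problem $Q_{cvx}$ is to minimize $\sum_{i\in\mathcal I^u}\sum_{k=0}^{N-1}(c_i\hat u_i(k)^2+d_i\beta_i(k)^2)+\sum_{i\in\mathcal I^\omega}\sum_{k=1}^{N}e_i\gamma_i(k)^2$ subject to (C) and, for all $i\in\mathcal I^u$, $k<N$: $\hat\omega_i(k)\ge\bar\omega_i^{thr}$, $\hat u_i(k)\le0$ if $\hat\omega_i^{ref}(k)\ge\bar\omega_i^{thr}$; $\hat\omega_i(k)\le\underline\omega_i^{thr}$, $\hat u_i(k)\ge0$ if $\hat\omega_i^{ref}(k)\le\underline\omega_i^{thr}$; and $\hat u_i(k)=0$ if $\underline\omega_i^{thr}<\hat\omega_i^{ref}(k)<\bar\omega_i^{thr}$. The control law is the first step $\hat u^*(0)$ of an optimal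 solution. A *closed-loop solution* is a solution of the swing equations for which, at every $t\ge0$, $u(t)$ is this first step at the state $(\lambda(t),\omega(t))$. **Theorem.** (0) For every $R$ there is $\bar T>0$ such that for all $0<T\le\bar T$ and all $t\ge 0$ with $|p^{fcst}_{t,i}(\tau)|\le R$ for all $i$ and all $\tau\in[t,t+\tilde t]$, the control law at time $t$ exists and is unique at every state with $|\omega_i|\le R$ for all $i$ at which the algebraic equations $0=v_i(0)+\hat u_i^{ref}(0)$ of the reference trajectory hold for all $i$ with $M_i=0$. For every $T>0$ (in particular for every sufficiently small $T$), every closed-loop solution satisfies: (a) for $i\in\mathcal I^u$ and $t\ge0$, $u_i(t)=0$ whenever $\omega_i(t)\in(\underline\omega_i^{thr},\bar\omega_i^{thr})$; (b) for $i\in\mathcal I^\omega$ with $\xi_i=1$: if $\omega_i(s)\in[\underline\omega_i,\bar\omega_i]$ for some $s\ge0$ and, in case $M_i>0$, $\omega_i(s)$ is not an endpoint, then $\omega_i(t)\in[\underline\omega_i,\bar\omega_i]$ for all $t\ge s$. Moreover, the right-hand side of the $i$-th swing equation is $\le 0$ at every time at which $\omega_i=\bar\omega_i$ and $\ge0$ at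 every time at which $\omega_i=\underline\omega_i$. Suppose in addition that $p(t)=p^*$ for all $t\ge0$; that, with $\omega^\infty=\sum_ip_i^*/\sum_iE_i$, $\underline\omega_i^{thr}<\omega^\infty<\bar\omega_i^{thr}$ for $i\in\mathcal I^u$; and that $(\lambda^\infty,\omega^\infty\mathbf 1)$ is an equilibrium of the swing equations with $u=0$ such that $\lambda^\infty\in\operatorname{range}(D)$ and $|\lambda^\infty_j|<\pi/2$ for all $j$. Let $\Upsilon_{cl}=[-\pi/2,\pi/2]^m$, $$V(\lambda,\omega)=\tfrac12\sum_{M_i>0}M_i(\omega_i-\omega^\infty)^2+\sum_jb_j(\cos\lambda_j^\infty-\cos\lambda_j-\lambda_j\sin\lambda_j^\infty+\lambda_j^\infty\sin\lambda_j^\infty),$$ $\bar r=\min_{\partial\Upsilon_{cl}}V(\cdot,\omega^\infty\mathbf 1)$ ($+\infty$ if $m=0$) and $\Phi(r)=\{(\lambda,\omega):\lambda\in\Upsilon_{cl},\ V(\lambda,\omega)\le r\}$. Then, for every $T>0$, $(\lambda^\infty,\omega^\infty\mathbf 1)$ is locally asymptotically stable for the closed loop on the state space $\lambda(0)\in\operatorname{range}(D)$,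 and every closed-loop solution with $\lambda(0)\in\operatorname{range}(D)$ and $(\lambda(0),\omega(0))\in\Phi(r)$ for some $0\le r<\bar r$ satisfies: (c) $(\lambda(t),\omega(t))\in\Phi(r)$ for all $t\ge0$ and $(\lambda(t),\omega(t))\to(\lambda^\infty,\omega^\infty\mathbf 1)$ as $t\to\infty$; (d) there is $t_1\ge0$ with $u_i(t)=0$ for all $t\ge t_1$ and $i\in\mathcal I^u$; (e) for every $i\in\mathcal I^\omega$ there is $t_1\ge0$ with $\omega_i(t)\in[\underline\omega_i,\bar\omega_i]$ for all $t\ge t_1$ (in particular if $\omega_i(0)\notin[\underline\omega_i,\bar\omega_i]$). -/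

import Mathlib

open Set Filter Topology MeasureTheory

noncomputable section

/-- A power network with buses `Fin n` and transmission lines `Fin m`: a connected undirected
graph whose edges are enumerated by `line`, each with an orientation (`pos k` is the positive end
and `neg k` the negative end of line `k`), together with inertias `M`, dampings `E` and
susceptances `b`. Buses with zero inertia are allowed. -/
structure PowerNetwork (n m : ℕ) where
  graph : SimpleGraph (Fin n)
  connected : graph.Connected
  line : Fin m ≃ graph.edgeSet
  pos : Fin m → Fin n
  neg : Fin m → Fin n
  line_eq : ∀ k, (line k : Sym2 (Fin n)) = s(pos k, neg k)
  M : Fin n → ℝ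
  E : Fin n → ℝ
  b : Fin m → ℝ
  M_nonneg : ∀ i, 0 ≤ M i
  M_pos : ∃ i, 0 < M i
  E_pos : ∀ i, 0 < E i
  b_pos : ∀ k, 0 < b k

namespace PowerNetwork

variable {n m : ℕ} (G : PowerNetwork n m)

/-- The (line × bus) incidence matrix. -/
def D : Matrix (Fin m) (Fin n) ℝ :=
  Matrix.of fun k i => if i = G.pos k then 1 else if i = G.neg k then -1 else 0

/-- The diagonal matrix of susceptances. -/
def Yb : Matrix (Fin m) (Fin m) ℝ := Matrix.diagonal G.b

/-- The uncontrolled net power `-E ω - Dᵀ Y_b s + q` at the buses; the swing equations have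
`s = sin λ` (component-wise), the linearized prediction model has `s = λ̂`. -/
def netPower (s : Fin m → ℝ) (ω q : Fin n → ℝ) : Fin n → ℝ :=
  fun i => -(G.E i * ω i) - (G.D.transpose.mulVec (G.Yb.mulVec s)) i + q i

/-- The vectors of voltage angle differences, `λ = D θ` for some vector of bus angles `θ`. -/
def angleDifferences : Set (Fin m → ℝ) := Set.range G.D.mulVec

/-- The synchronous frequency `ω^∞ = (∑ pᵢ) / (∑ Eᵢ)`. -/
def ωsync (q : Fin n → ℝ) : ℝ := (∑ i, q i) / (∑ i, G.E i)

end PowerNetwork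

/-- Component-wise sine. -/
def sinVec {m : ℕ} (lam : Fin m → ℝ) : Fin m → ℝ := fun k => Real.sin (lam k)

/-- `Υ = {λ | |λ_j| < π/2 for all j}`. -/
def Upsilon (m : ℕ) : Set (Fin m → ℝ) := {lam | ∀ j, |lam j| < Real.pi / 2}

namespace PowerNetwork

variable {n m : ℕ} (G : PowerNetwork n m)

/-- `(lamInf, ω^∞ 1)` is an equilibrium of the uncontrolled swing equations with constant power
injection `q`, and `lamInf` is a vector of angle differences lying in `Υ`. -/
def IsSyncEquilibrium (q : Fin n → ℝ) (lamInf : Fin m → ℝ) : Prop :=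
  lamInf ∈ Upsilon m ∧ lamInf ∈ G.angleDifferences ∧
    G.netPower (sinVec lamInf) (fun _ => G.ωsync q) q = 0

/-- The energy function `V(λ, ω_g)`; it only depends on the frequencies of the buses with
positive inertia. -/
def V (q : Fin n → ℝ) (lamInf lam : Fin m → ℝ) (ω : Fin n → ℝ) : ℝ :=
  (1 / 2) * ∑ i with 0 < G.M i, G.M i * (ω i - G.ωsync q) ^ 2
    + ∑ j, G.b j * (Real.cos (lamInf j) - Real.cos (lam j) - lam j * Real.sin (lamInf j)
        + lamInf j * Real.sin (lamInf j))

/-- `r̄`, the minimum of `V(·, ω^∞ 1)` over the boundary of `Υ_cl` (it is `⊤` when there are no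
lines, since then this boundary is empty). -/
def rBar (q : Fin n → ℝ) (lamInf : Fin m → ℝ) : EReal :=
  ⨅ lam ∈ frontier (closure (Upsilon m)), ((G.V q lamInf lam (fun _ => G.ωsync q) : ℝ) : EReal)

/-- The sublevel set `Φ(r)`. -/
def Phi (q : Fin n → ℝ) (lamInf : Fin m → ℝ) (r : ℝ) : Set ((Fin m → ℝ) × (Fin n → ℝ)) :=
  {x | x.1 ∈ closure (Upsilon m) ∧ G.V q lamInf x.1 x.2 ≤ r}

end PowerNetwork

/-- The design data of the controller. `Iu` are the controlled buses, `Iω ⊆ Iu` the buses with a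
frequency constraint; `soft i = true` stands for `ξᵢ = 1` (soft input magnitude constraint) and
`soft i = false` for `ξᵢ = 0` (hard constraint); `horizon` is the length `t̃` of the prediction
window. -/
structure ControlSpec (n : ℕ) where
  Iu : Finset (Fin n)
  Iω : Finset (Fin n)
  subset : Iω ⊆ Iu
  ωlo : Fin n → ℝ
  ωhi : Fin n → ℝ
  thrlo : Fin n → ℝ
  thrhi : Fin n → ℝ
  umin : Fin n → ℝ
  umax : Fin n → ℝ
  soft : Fin n → Bool
  c : Fin n → ℝ
  d : Fin n → ℝ
  e : Fin n → ℝ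
  δ : Fin n → ℝ
  γlo : Fin n → ℝ
  γhi : Fin n → ℝ
  horizon : ℝ
  horizon_pos : 0 < horizon
  thrlo_neg : ∀ i ∈ Iu, thrlo i < 0
  thrhi_pos : ∀ i ∈ Iu, 0 < thrhi i
  ωlo_lt : ∀ i ∈ Iω, ωlo i < thrlo i
  lt_ωhi : ∀ i ∈ Iω, thrhi i < ωhi i
  umin_nonpos : ∀ i ∈ Iu, soft i = false → umin i ≤ 0
  umax_nonneg : ∀ i ∈ Iu, soft i = false → 0 ≤ umax i
  c_pos : ∀ i ∈ Iu, 0 < c i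
  d_pos : ∀ i ∈ Iu, 0 < d i
  e_pos : ∀ i ∈ Iω, 0 < e i
  δ_pos : ∀ i ∈ Iω, 0 < δ i
  δ_lt : ∀ i ∈ Iω, δ i < ωhi i - ωlo i
  γlo_pos : ∀ i ∈ Iω, 0 < γlo i
  γhi_pos : ∀ i ∈ Iω, 0 < γhi i

namespace ControlSpec

variable {n : ℕ} (S : ControlSpec n)

/-- `ξᵢ` as a real number. -/
def ξ (i : Fin n) : ℝ := if S.soft i = true then 1 else 0

/-- `κᵢ(ω₀, ξᵢ)`. -/
def κ (ω₀ : Fin n → ℝ) (i : Fin n) : ℝ :=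
  if (S.ωlo i ≤ ω₀ i ∧ ω₀ i ≤ S.ωhi i) ∧ S.soft i = true then 0 else 1

/-- The number `N = ⌈t̃ / T⌉` of prediction steps. -/
def steps (T : ℝ) : ℕ := ⌈S.horizon / T⌉₊

end ControlSpec

/-- The saturation function; it is the identity for `soft = true`. -/
def sat (a : ℝ) (soft : Bool) (amin amax : ℝ) : ℝ :=
  if soft = false ∧ a ≤ amin then amin else if soft = false ∧ amax ≤ a then amax else a

/-- Discrete trajectories `(Λ̂, Ω̂, Û)`: only `Λ̂(k), Ω̂(k)` for `k ≤ N` and `Û(k)` for `k < N` are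
relevant. -/
structure DiscreteTraj (n m : ℕ) where
  Λ : ℕ → Fin m → ℝ
  Ω : ℕ → Fin n → ℝ
  U : ℕ → Fin n → ℝ

/-- Discrete slack variables `(B̂, Γ̂)`: only `B i k` for controlled `i` and `k < N`, and `Γ i k`
for frequency-constrained `i` and `1 ≤ k ≤ N`, are relevant. -/
structure Slack (n : ℕ) where
  B : ℕ → Fin n → ℝ
  Γ : ℕ → Fin n → ℝ

section OptimalControl

variable {n m : ℕ} (G : PowerNetwork n m) (S : ControlSpec n)

/-- The discretized linear prediction model with `N` steps of length `T`, discretized forecast `P`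
and initial state `(sin lam₀, ω₀)`. -/
def SatisfiesPrediction (T : ℝ) (P : ℕ → Fin n → ℝ) (lam₀ : Fin m → ℝ) (ω₀ : Fin n → ℝ)
    (X : DiscreteTraj n m) : Prop :=
  X.Λ 0 = sinVec lam₀ ∧ X.Ω 0 = ω₀ ∧
  ∀ k < S.steps T,
    X.Λ (k + 1) = X.Λ k + T • G.D.mulVec (X.Ω k) ∧
    ∀ i, G.M i * (X.Ω (k + 1) i - X.Ω k i) / T
      = G.netPower (X.Λ k) (X.Ω k) (P k) i + X.U k i

/-- The constraints common to the two discrete optimization problems: prediction model, `û(k) ∈ 𝕌`,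
input magnitude constraints and safe frequency constraints. -/
def SatisfiesCommon (T : ℝ) (P : ℕ → Fin n → ℝ) (lam₀ : Fin m → ℝ) (ω₀ : Fin n → ℝ)
    (X : DiscreteTraj n m) (Z : Slack n) : Prop :=
  SatisfiesPrediction G S T P lam₀ ω₀ X ∧
  (∀ k < S.steps T, ∀ i, i ∉ S.Iu → X.U k i = 0) ∧
  (∀ k < S.steps T, ∀ i ∈ S.Iu,
    S.umin i - S.ξ i * Z.B k i ≤ X.U k i ∧ X.U k i ≤ S.umax i + S.ξ i * Z.B k i ∧
      0 ≤ Z.B k i) ∧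
  (∀ k, 1 ≤ k → k ≤ S.steps T → ∀ i ∈ S.Iω,
    S.ωlo i - S.κ ω₀ i * (Z.Γ k i - S.δ i) ≤ X.Ω k i ∧
      X.Ω k i ≤ S.ωhi i + S.κ ω₀ i * (Z.Γ k i - S.δ i) ∧ 0 ≤ Z.Γ k i)

/-- The non-convex stability constraint `(Ω̂, Û) ∈ Φ_disc`. -/
def InPhiDisc (T : ℝ) (X : DiscreteTraj n m) : Prop :=
  ∀ i ∈ S.Iu, ∀ k < S.steps T,
    (X.Ω k i ∉ Ioo (S.thrlo i) (S.thrhi i) → X.Ω k i * X.U k i ≤ 0) ∧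
    (X.Ω k i ∈ Ioo (S.thrlo i) (S.thrhi i) → X.U k i = 0)

/-- The convexified stability constraint `(Ω̂, Û) ∈ Φ_cvx` for the reference trajectory `Xref`. -/
def InPhiCvx (T : ℝ) (Xref X : DiscreteTraj n m) : Prop :=
  ∀ i ∈ S.Iu, ∀ k < S.steps T,
    (S.thrhi i ≤ Xref.Ω k i → S.thrhi i ≤ X.Ω k i ∧ X.U k i ≤ 0) ∧
    (Xref.Ω k i ≤ S.thrlo i → X.Ω k i ≤ S.thrlo i ∧ 0 ≤ X.U k i) ∧
    (S.thrlo i < Xref.Ω k i → Xref.Ω k i < S.thrhi i → X.U k i = 0)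

/-- The objective function `g(Û, B̂, Γ̂)`. -/
def cost (T : ℝ) (X : DiscreteTraj n m) (Z : Slack n) : ℝ :=
  ∑ i ∈ S.Iu, ∑ k ∈ Finset.range (S.steps T),
      (S.c i * X.U k i ^ 2 + S.d i * Z.B k i ^ 2)
    + ∑ i ∈ S.Iω, ∑ k ∈ Finset.Icc 1 (S.steps T), S.e i * Z.Γ k i ^ 2

/-- Reference trajectories: the trajectories that, with suitable slack variables, satisfy all the
constraints of the non-convex discrete problem. -/
def IsReferenceTraj (T : ℝ) (P : ℕ → Fin n → ℝ) (lam₀ : Fin m → ℝ) (ω₀ : Fin n → ℝ)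
    (X : DiscreteTraj n m) : Prop :=
  ∃ Z : Slack n, SatisfiesCommon G S T P lam₀ ω₀ X Z ∧ InPhiDisc S T X

/-- `(X, Z)` satisfies the constraints of `Q_cvx` for the reference trajectory `Xref`. -/
def FeasibleCvx (T : ℝ) (P : ℕ → Fin n → ℝ) (lam₀ : Fin m → ℝ) (ω₀ : Fin n → ℝ)
    (Xref X : DiscreteTraj n m) (Z : Slack n) : Prop :=
  SatisfiesCommon G S T P lam₀ ω₀ X Z ∧ InPhiCvx S T Xref X

/-- `(X, Z)` is an optimal solution of `Q_cvx` for the reference trajectory `Xref`. -/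
def OptimalCvx (T : ℝ) (P : ℕ → Fin n → ℝ) (lam₀ : Fin m → ℝ) (ω₀ : Fin n → ℝ)
    (Xref X : DiscreteTraj n m) (Z : Slack n) : Prop :=
  FeasibleCvx G S T P lam₀ ω₀ Xref X Z ∧
    ∀ X' Z', FeasibleCvx G S T P lam₀ ω₀ Xref X' Z' → cost S T X Z ≤ cost S T X' Z'

/-- The feedback that generates the reference trajectory, evaluated at the predicted state
`(s, ω)` with forecasted injection `q`. -/
def refInput (s : Fin m → ℝ) (ω q : Fin n → ℝ) : Fin n → ℝ := fun i =>
  if i ∈ S.Iω then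
    sat (if S.thrhi i < ω i then
          min 0 (S.γhi i * (S.ωhi i - ω i) / (ω i - S.thrhi i) - G.netPower s ω q i)
        else if ω i < S.thrlo i then
          max 0 (S.γlo i * (S.ωlo i - ω i) / (S.thrlo i - ω i) - G.netPower s ω q i)
        else 0)
      (S.soft i) (S.umin i) (S.umax i)
  else 0

/-- `X` is a trajectory of the prediction model driven by the reference feedback. -/
def IsGeneratedRef (T : ℝ) (P : ℕ → Fin n → ℝ) (lam₀ : Fin m → ℝ) (ω₀ : Fin n → ℝ)
    (X : DiscreteTraj n m) : Prop :=
  SatisfiesPrediction G S T P lam₀ ω₀ X ∧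
    ∀ k < S.steps T, X.U k = refInput G S (X.Λ k) (X.Ω k) (P k)

/-- The receding-horizon control law with sampling length `T`: `u` is the input at state `(lam, ω)`
and time `t` with forecast `pf : [t, t + t̃] → ℝⁿ`, i.e. the first step of an optimal solution of
`Q_cvx` for the generated reference trajectory. -/
def IsMPCInput (T t : ℝ) (pf : ℝ → Fin n → ℝ) (lam : Fin m → ℝ) (ω u : Fin n → ℝ) : Prop :=
  ∃ (Xref X : DiscreteTraj n m) (Z : Slack n),
    IsGeneratedRef G S T (fun k => pf (t + k * T)) lam ω Xref ∧
    IsReferenceTraj G S T (fun k => pf (t + k * T)) lam ω Xref ∧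
    OptimalCvx G S T (fun k => pf (t + k * T)) lam ω Xref X Z ∧
    u = X.U 0

/-- A state is consistent with injection `q` if at every zero-inertia bus the power balance of the
prediction model holds under the reference feedback (no condition if all inertias are positive). -/
def Consistent (q : Fin n → ℝ) (lam : Fin m → ℝ) (ω : Fin n → ℝ) : Prop :=
  ∀ i, G.M i = 0 →
    G.netPower (sinVec lam) ω q i + refInput G S (sinVec lam) ω q i = 0

/-- Solutions on `[0, ∞)` of the closed loop: the swing equations with power injection `p`, in the
sense of Carathéodory (algebraic equations at the zero-inertia buses), where `u t` is at every time
the receding-horizon input at the current state with forecast `pf t`. -/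
structure IsClosedLoop (T : ℝ) (p : ℝ → Fin n → ℝ) (pf : ℝ → ℝ → Fin n → ℝ)
    (lam : ℝ → Fin m → ℝ) (ω u : ℝ → Fin n → ℝ) : Prop where
  angle_integrable : ∀ t ≥ 0, ∀ k,
    IntervalIntegrable (fun s => G.D.mulVec (ω s) k) volume 0 t
  angle_eq : ∀ t ≥ 0, ∀ k, lam t k = lam 0 k + ∫ s in (0 : ℝ)..t, G.D.mulVec (ω s) k
  freq_integrable : ∀ t ≥ 0, ∀ i, 0 < G.M i →
    IntervalIntegrable (fun s => G.netPower (sinVec (lam s)) (ω s) (p s) i + u s i) volume 0 t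
  freq_eq : ∀ t ≥ 0, ∀ i, 0 < G.M i → G.M i * ω t i = G.M i * ω 0 i
    + ∫ s in (0 : ℝ)..t, (G.netPower (sinVec (lam s)) (ω s) (p s) i + u s i)
  freq_alg : ∀ t ≥ 0, ∀ i, G.M i = 0 →
    G.netPower (sinVec (lam t)) (ω t) (p t) i + u t i = 0
  input : ∀ t ≥ 0, IsMPCInput G S T t (pf t) (lam t) (ω t) (u t)

/-- Local asymptotic stability of `(lamInf, ωInf 1)` for the closed loop, on the state space of
angle differences and frequencies: Lyapunov stability and local attractivity. -/
def LocallyAsymptoticallyStable (T : ℝ) (p : ℝ → Fin n → ℝ) (pf : ℝ → ℝ → Fin n → ℝ)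
    (lamInf : Fin m → ℝ) (ωInf : ℝ) : Prop :=
  (∀ ε > 0, ∃ δ > 0, ∀ lam ω u, IsClosedLoop G S T p pf lam ω u →
    lam 0 ∈ G.angleDifferences → dist (lam 0, ω 0) (lamInf, fun _ => ωInf) < δ →
      ∀ t ≥ 0, dist (lam t, ω t) (lamInf, fun _ => ωInf) < ε) ∧
  (∃ δ > 0, ∀ lam ω u, IsClosedLoop G S T p pf lam ω u →
    lam 0 ∈ G.angleDifferences → dist (lam 0, ω 0) (lamInf, fun _ => ωInf) < δ →
      Tendsto (fun t => (lam t, ω t)) atTop (𝓝 (lamInf, fun _ => ωInf)))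

end OptimalControl

end

noncomputable section

/-! The control law is well defined because the reference feedback is itself feasible. At a bus with
inertia it is followed by Euler steps; at a bus without inertia the scalar power balance is solvable
(`exists_balance`) with unique frequency, as the balancing feedback is monotone
(`sub_mul_feedback_sub_nonpos`). A discrete Gronwall estimate bounds the net power uniformly in the
step length (`exists_netPower_bound`), so for small steps the soft buses stay in their safe
intervals (`exists_step_invariant`). The convexified problem then has a feasible point, hence an
optimum by coercivity and closedness (`FeasibleCvx.exists_optimal`), and its input is unique by
strict convexity of the cost in the input (`OptimalCvx.input_eq`).

Properties (a) and (b) use only the first prediction step, which starts at the true state. The sign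
constraints at step 0 become sign constraints on `u`. At a soft bus inside its safe interval the
first predicted frequency `w` must be safe, and the right-hand side of the swing equation equals `M
(w - ω) / T`. It is thus bounded by multiples of the distances to the endpoints, which gives
invariance by a Gronwall argument (`IsPrimitive.mem_Ioo`).

For constant injection the sign constraints yield `(ω - ω^∞) u ≤ 0`, so the energy `V` decreases at
least at rate `∑ E (ω - ω^∞)^2` (`V_sub_le`), and sublevel sets below `r̄` are invariant
(`mem_Phi`). The input need not be continuous, so no LaSalle argument is used. Instead, two Barbalat
variants show that the frequencies synchronize (`tendsto_freq`), hence that the input is eventually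
zero, and hence that the flow deviations vanish (`tendsto_flowDev`). Among angle differences in the
closed box, zero flow deviation characterizes the equilibrium (`eq_of_flowDev_eq_zero`), and
compactness gives convergence of the angles. -/

lemma mul_abs_le_abs {a x c : ℝ} (h : x * (a * x - c) ≤ 0) : a * |x| ≤ |c| := by
  have h1 : a * |x| * |x| ≤ |c| * |x| := by
    rw [mul_assoc, abs_mul_abs_self, ← abs_mul]
    refine le_trans ?_ (le_abs_self _)
    linarith
  rcases (abs_nonneg x).eq_or_lt with h0 | h0
  · rw [← h0, mul_zero]; exact abs_nonneg _
  · exact le_of_mul_le_mul_right h1 h0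

/-! ### The reference feedback at a single bus -/

namespace ControlSpec

variable {n : ℕ} (S : ControlSpec n)

/-- The reference feedback at bus `i` as a function of the frequency `w` and the net power `v`. -/
def feedback (i : Fin n) (w v : ℝ) : ℝ :=
  if i ∈ S.Iω then
    sat (if S.thrhi i < w then
          min 0 (S.γhi i * (S.ωhi i - w) / (w - S.thrhi i) - v)
        else if w < S.thrlo i then
          max 0 (S.γlo i * (S.ωlo i - w) / (S.thrlo i - w) - v)
        else 0)
      (S.soft i) (S.umin i) (S.umax i)
  else 0

variable {S} {i : Fin n} {w v : ℝ}

lemma feedback_of_notMem (hi : i ∉ S.Iω) : S.feedback i w v = 0 := by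
  simp [feedback, hi]

lemma umin_nonpos_of_mem (hi : i ∈ S.Iω) (h : S.soft i = false) : S.umin i ≤ 0 :=
  S.umin_nonpos i (S.subset hi) h

lemma umax_nonneg_of_mem (hi : i ∈ S.Iω) (h : S.soft i = false) : 0 ≤ S.umax i :=
  S.umax_nonneg i (S.subset hi) h

lemma thrlo_lt_thrhi (hi : i ∈ S.Iu) : S.thrlo i < S.thrhi i :=
  (S.thrlo_neg i hi).trans (S.thrhi_pos i hi)

/-- The feedback caps the net power at a barrier value that is positive below `ωhi` and negative
above it. The next lemmas are the lower and the saturated counterparts. -/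
lemma feedback_soft_of_thrhi_lt (hi : i ∈ S.Iω) (hs : S.soft i = true) (hw : S.thrhi i < w) :
    v + S.feedback i w v = min v (S.γhi i * (S.ωhi i - w) / (w - S.thrhi i)) := by
  simp only [feedback, hi, if_true, hw, sat, hs]
  simp only [Bool.true_eq_false, false_and, if_false]
  rcases le_total v (S.γhi i * (S.ωhi i - w) / (w - S.thrhi i)) with h | h
  · rw [min_eq_left (by linarith), min_eq_left h, add_zero]
  · rw [min_eq_right (by linarith), min_eq_right h]; ring

lemma feedback_soft_of_lt_thrlo (hi : i ∈ S.Iω) (hs : S.soft i = true) (hw : w < S.thrlo i) :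
    v + S.feedback i w v = max v (S.γlo i * (S.ωlo i - w) / (S.thrlo i - w)) := by
  have hw' : ¬ S.thrhi i < w := by linarith [thrlo_lt_thrhi (S.subset hi)]
  simp only [feedback, hi, if_true, hw, hw', sat, hs]
  simp only [Bool.true_eq_false, false_and, if_false]
  rcases le_total v (S.γlo i * (S.ωlo i - w) / (S.thrlo i - w)) with h | h
  · rw [max_eq_right (by linarith), max_eq_right h]; ring
  · rw [max_eq_left (by linarith), max_eq_left h, add_zero]

/-- Saturation adds the floor `v + umin` to the capped power; the upper limit is inactive because
the unsaturated feedback is nonpositive and `umax` is nonnegative. -/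
lemma feedback_hard_of_thrhi_lt (hi : i ∈ S.Iω) (hs : S.soft i = false) (hw : S.thrhi i < w) :
    v + S.feedback i w v =
      max (v + S.umin i) (min v (S.γhi i * (S.ωhi i - w) / (w - S.thrhi i))) := by
  have h1 := umin_nonpos_of_mem hi hs
  have h2 := umax_nonneg_of_mem hi hs
  simp only [feedback, hi, if_true, hw, sat, hs, true_and]
  grind

lemma feedback_hard_of_lt_thrlo (hi : i ∈ S.Iω) (hs : S.soft i = false) (hw : w < S.thrlo i) :
    v + S.feedback i w v =
      min (v + S.umax i) (max v (S.γlo i * (S.ωlo i - w) / (S.thrlo i - w))) := by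
  have h1 := umin_nonpos_of_mem hi hs
  have h2 := umax_nonneg_of_mem hi hs
  have hw' : ¬ S.thrhi i < w := by linarith [thrlo_lt_thrhi (S.subset hi)]
  simp only [feedback, hi, if_true, hw, hw', if_false, sat, hs, true_and]
  grind

lemma feedback_of_mem_Icc (hw : w ∈ Icc (S.thrlo i) (S.thrhi i)) : S.feedback i w v = 0 := by
  by_cases hi : i ∈ S.Iω
  · have h1 := umin_nonpos_of_mem hi
    have h2 := umax_nonneg_of_mem hi
    have := hw.1; have := hw.2
    simp only [feedback, sat]
    grind
  · exact feedback_of_notMem hi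

lemma feedback_nonpos (hw : S.thrhi i ≤ w) : S.feedback i w v ≤ 0 := by
  by_cases hi : i ∈ S.Iω
  · have h1 := umin_nonpos_of_mem hi
    have h2 := umax_nonneg_of_mem hi
    have := thrlo_lt_thrhi (S.subset hi)
    simp only [feedback, sat]
    grind
  · exact (feedback_of_notMem hi).le

lemma feedback_nonneg (hw : w ≤ S.thrlo i) : 0 ≤ S.feedback i w v := by
  by_cases hi : i ∈ S.Iω
  · have h1 := umin_nonpos_of_mem hi
    have h2 := umax_nonneg_of_mem hi
    have := thrlo_lt_thrhi (S.subset hi)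
    simp only [feedback, sat]
    grind
  · exact (feedback_of_notMem hi).ge

lemma mul_feedback_nonpos : w * S.feedback i w v ≤ 0 := by
  by_cases hi : i ∈ S.Iω
  · have h1 := S.thrlo_neg i (S.subset hi)
    have h2 := S.thrhi_pos i (S.subset hi)
    rcases le_or_gt (S.thrhi i) w with h | h
    · exact mul_nonpos_of_nonneg_of_nonpos (by linarith) (feedback_nonpos h)
    rcases le_or_gt w (S.thrlo i) with h' | h'
    · exact mul_nonpos_of_nonpos_of_nonneg (by linarith) (feedback_nonneg h')
    · simp [feedback_of_mem_Icc (v := v) ⟨h'.le, h.le⟩]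
  · simp [feedback_of_notMem hi]

lemma umin_le_feedback (hi : i ∈ S.Iu) (hs : S.soft i = false) : S.umin i ≤ S.feedback i w v := by
  have h1 := S.umin_nonpos i hi hs
  have h2 := S.umax_nonneg i hi hs
  simp only [feedback, sat]
  grind

lemma feedback_le_umax (hi : i ∈ S.Iu) (hs : S.soft i = false) : S.feedback i w v ≤ S.umax i := by
  have h1 := S.umin_nonpos i hi hs
  have h2 := S.umax_nonneg i hi hs
  simp only [feedback, sat]
  grind

lemma neg_γhi_le (hi : i ∈ S.Iω) (hw : S.thrhi i < w) :
    -S.γhi i ≤ S.γhi i * (S.ωhi i - w) / (w - S.thrhi i) := by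
  have := S.γhi_pos i hi
  have := S.lt_ωhi i hi
  rw [le_div_iff₀ (by linarith)]
  nlinarith

lemma le_γlo (hi : i ∈ S.Iω) (hw : w < S.thrlo i) :
    S.γlo i * (S.ωlo i - w) / (S.thrlo i - w) ≤ S.γlo i := by
  have := S.γlo_pos i hi
  have := S.ωlo_lt i hi
  rw [div_le_iff₀ (by linarith)]
  nlinarith

/-- The barrier quotient blows up at the threshold, but only in the direction in which it does not
bind; in the other direction it is bounded by `γhi` or `γlo`. This linear growth bound feeds the
Gronwall estimate. -/
lemma abs_add_feedback_le : |v + S.feedback i w v| ≤ |v| + (|S.γhi i| + |S.γlo i|) := by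
  have ha := abs_nonneg (S.γhi i)
  have hb := abs_nonneg (S.γlo i)
  by_cases hi : i ∈ S.Iω
  · rcases lt_or_ge (S.thrhi i) w with h | h
    · have h1 := neg_γhi_le hi h
      have h2 := le_abs_self (S.γhi i)
      have h3 := neg_abs_le v
      have h4 := le_abs_self v
      have h5 : S.feedback i w v ≤ 0 := feedback_nonpos h.le
      rw [abs_le]
      refine ⟨?_, by linarith⟩
      cases hs : S.soft i
      · rw [feedback_hard_of_thrhi_lt hi hs h]
        refine le_max_of_le_right (le_min ?_ ?_) <;> linarith [abs_nonneg v]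
      · rw [feedback_soft_of_thrhi_lt hi hs h]
        refine le_min ?_ ?_ <;> linarith [abs_nonneg v]
    rcases lt_or_ge w (S.thrlo i) with h' | h'
    · have h1 := le_γlo hi h'
      have h2 := le_abs_self (S.γlo i)
      have h3 := neg_abs_le v
      have h4 := le_abs_self v
      have h5 : 0 ≤ S.feedback i w v := feedback_nonneg h'.le
      rw [abs_le]
      refine ⟨by linarith, ?_⟩
      cases hs : S.soft i
      · rw [feedback_hard_of_lt_thrlo hi hs h']
        refine min_le_of_right_le (max_le ?_ ?_) <;> linarith [abs_nonneg v]
      · rw [feedback_soft_of_lt_thrlo hi hs h']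
        refine max_le ?_ ?_ <;> linarith [abs_nonneg v]
    · rw [feedback_of_mem_Icc ⟨h', h⟩, add_zero]; linarith
  · rw [feedback_of_notMem hi, add_zero]; linarith

/-- At a bus without inertia, where net power and feedback balance, the feedback can be nonzero
only on the boundary of the safe interval or, fully saturated, outside of it. -/
lemma feedback_of_balance (hi : i ∈ S.Iω) (h : v + S.feedback i w v = 0) :
    (S.soft i = true → w ∈ Icc (S.ωlo i) (S.ωhi i)) ∧
    (w < S.ωhi i → 0 ≤ S.feedback i w v) ∧ (S.ωlo i < w → S.feedback i w v ≤ 0) ∧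
    (S.ωhi i < w → S.feedback i w v = S.umin i) ∧ (w < S.ωlo i → S.feedback i w v = S.umax i) := by
  have h1 := S.lt_ωhi i hi
  have h2 := S.ωlo_lt i hi
  have h3 := thrlo_lt_thrhi (S.subset hi)
  have h4 := S.γhi_pos i hi
  have h5 := S.γlo_pos i hi
  have hu1 := umin_nonpos_of_mem hi
  have hu2 := umax_nonneg_of_mem hi
  rcases lt_or_ge (S.thrhi i) w with hw | hw
  · have hq1 : w < S.ωhi i → 0 < S.γhi i * (S.ωhi i - w) / (w - S.thrhi i) := fun h' =>
      div_pos (mul_pos h4 (by linarith)) (by linarith)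
    have hq2 : S.ωhi i < w → S.γhi i * (S.ωhi i - w) / (w - S.thrhi i) < 0 := fun h' =>
      div_neg_of_neg_of_pos (by nlinarith) (by linarith)
    have hf : S.feedback i w v ≤ 0 := feedback_nonpos hw.le
    have hv : v = -S.feedback i w v := by linarith
    cases hs : S.soft i
    · have e := feedback_hard_of_thrhi_lt (v := v) hi hs hw
      have := hu1 hs
      have := hu2 hs
      refine ⟨by simp, fun h' => ?_, fun _ => hf, fun h' => ?_, by intro; linarith⟩
      · have := hq1 h'; grind
      · have := hq2 h'; grind
    · have e := feedback_soft_of_thrhi_lt (v := v) hi hs hw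
      have hle : w ≤ S.ωhi i := by
        by_contra! h'
        have := hq2 h'; grind
      refine ⟨fun _ => ⟨by linarith, hle⟩, fun h' => ?_, fun _ => hf, by intro; linarith,
        by intro; linarith⟩
      have := hq1 h'; grind
  rcases lt_or_ge w (S.thrlo i) with hw' | hw'
  · have hq1 : S.ωlo i < w → S.γlo i * (S.ωlo i - w) / (S.thrlo i - w) < 0 := fun h' =>
      div_neg_of_neg_of_pos (by nlinarith) (by linarith)
    have hq2 : w < S.ωlo i → 0 < S.γlo i * (S.ωlo i - w) / (S.thrlo i - w) := fun h' =>
      div_pos (mul_pos h5 (by linarith)) (by linarith)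
    have hf : 0 ≤ S.feedback i w v := feedback_nonneg hw'.le
    have hv : v = -S.feedback i w v := by linarith
    cases hs : S.soft i
    · have e := feedback_hard_of_lt_thrlo (v := v) hi hs hw'
      have := hu1 hs
      have := hu2 hs
      refine ⟨by simp, fun _ => hf, fun h' => ?_, by intro; linarith, fun h' => ?_⟩
      · have := hq1 h'; grind
      · have := hq2 h'; grind
    · have e := feedback_soft_of_lt_thrlo (v := v) hi hs hw'
      have hle : S.ωlo i ≤ w := by
        by_contra! h'
        have := hq2 h'; grind
      refine ⟨fun _ => ⟨hle, by linarith⟩, fun _ => hf, fun h' => ?_, by intro; linarith,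
        by intro; linarith⟩
      have := hq1 h'; grind
  · have hf := feedback_of_mem_Icc (v := v) ⟨hw', hw⟩
    rw [hf]
    exact ⟨fun _ => ⟨by linarith, by linarith⟩, fun _ => le_rfl, fun _ => le_rfl,
      by intro; linarith, by intro; linarith⟩

/-- Monotonicity of the feedback along the solutions of the power balance. -/
lemma sub_mul_feedback_sub_nonpos {w' v' : ℝ} (h : v + S.feedback i w v = 0)
    (h' : v' + S.feedback i w' v' = 0) :
    (w - w') * (S.feedback i w v - S.feedback i w' v') ≤ 0 := by
  by_cases hi : i ∈ S.Iω
  · wlog hw : w' ≤ w generalizing w w' v v'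
    · have := this h' h (le_of_not_ge hw)
      linarith
    rcases hw.eq_or_lt with rfl | hw
    · simp
    refine mul_nonpos_of_nonneg_of_nonpos (by linarith) (sub_nonpos.2 ?_)
    obtain ⟨a1, a2, a3, a4, a5⟩ := feedback_of_balance hi h
    obtain ⟨b1, b2, b3, b4, b5⟩ := feedback_of_balance hi h'
    -- If both frequencies are safe, the larger one exceeds `ωlo` and has nonpositive feedback,
    -- while the smaller one is below `ωhi` and has nonnegative feedback. A frequency beyond a bound
    -- occurs only under a hard limit, with full saturation, and an extreme value compares with
    -- every other one.
    have hs : S.soft i = true ∨ S.soft i = false := by cases S.soft i <;> simp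
    rcases hs with hs | hs
    · exact (a3 (by linarith [(b1 hs).1])).trans (b2 (by linarith [(a1 hs).2]))
    · have c1 := umin_le_feedback (w := w') (v := v') (S.subset hi) hs
      have c2 := feedback_le_umax (w := w) (v := v) (S.subset hi) hs
      rcases lt_or_ge (S.ωhi i) w with h1 | h1
      · rw [a4 h1]; exact c1
      rcases lt_or_ge w' (S.ωlo i) with h2 | h2
      · rw [b5 h2]; exact c2
      exact (a3 (by linarith)).trans (b2 (by linarith))
  · simp [feedback_of_notMem hi]

/-- The balanced frequency at a bus without inertia depends Lipschitz continuously on the power. -/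
lemma abs_sub_le_of_balance {w' c c' e : ℝ}
    (h : (-(e * w) + c) + S.feedback i w (-(e * w) + c) = 0)
    (h' : (-(e * w') + c') + S.feedback i w' (-(e * w') + c') = 0) :
    e * |w - w'| ≤ |c - c'| := by
  -- Subtracting the balances, the difference of the feedbacks is `e * (w - w') - (c - c')`.
  refine mul_abs_le_abs (le_trans (le_of_eq ?_) (sub_mul_feedback_sub_nonpos h h'))
  congr 1
  linarith

lemma feedback_at_ωhi (hi : i ∈ S.Iω) (hv : 0 ≤ v) (hs : S.soft i = false → v + S.umin i ≤ 0) :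
    v + S.feedback i (S.ωhi i) v = 0 := by
  have h1 := S.lt_ωhi i hi
  cases h : S.soft i
  · rw [feedback_hard_of_thrhi_lt hi h h1, sub_self, mul_zero, zero_div, min_eq_right hv,
      max_eq_right (hs h)]
  · rw [feedback_soft_of_thrhi_lt hi h h1, sub_self, mul_zero, zero_div, min_eq_right hv]

lemma feedback_at_ωlo (hi : i ∈ S.Iω) (hv : v ≤ 0) (hs : S.soft i = false → 0 ≤ v + S.umax i) :
    v + S.feedback i (S.ωlo i) v = 0 := by
  have h1 := S.ωlo_lt i hi
  cases h : S.soft i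
  · rw [feedback_hard_of_lt_thrlo hi h h1, sub_self, mul_zero, zero_div, max_eq_right hv,
      min_eq_right (hs h)]
  · rw [feedback_soft_of_lt_thrlo hi h h1, sub_self, mul_zero, zero_div, max_eq_right hv]

/-- Solvability of the power balance at a bus without inertia. -/
lemma exists_balance (i : Fin n) {e : ℝ} (he : 0 < e) (c : ℝ) :
    ∃ w, (-(e * w) + c) + S.feedback i w (-(e * w) + c) = 0 := by
  have hdiv : ∀ x, -(e * (x / e)) + x = 0 := fun x => by field_simp; ring
  by_cases hi : i ∈ S.Iω
  · have h1 := S.lt_ωhi i hi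
    have h2 := S.ωlo_lt i hi
    have h3 := thrlo_lt_thrhi (S.subset hi)
    have h4 := S.γhi_pos i hi
    have h5 := S.γlo_pos i hi
    have hu1 := umin_nonpos_of_mem hi
    have hu2 := umax_nonneg_of_mem hi
    rcases le_or_gt (e * S.ωhi i) c with hc | hc
    -- Excess power is absorbed exactly at `ωhi`, where the barrier value is zero, if the limit
    -- `umin` allows it. Otherwise the input saturates and the frequency settles beyond `ωhi`, where
    -- damping absorbs the rest. Deficits at `ωlo` are symmetric.
    · by_cases hs : S.soft i = false → c + S.umin i ≤ e * S.ωhi i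
      · exact ⟨S.ωhi i, feedback_at_ωhi hi (by linarith) fun h => by linarith [hs h]⟩
      · push Not at hs
        obtain ⟨hs, hlt⟩ := hs
        have hw : S.ωhi i < (c + S.umin i) / e := by rw [lt_div_iff₀ he]; linarith
        refine ⟨(c + S.umin i) / e, ?_⟩
        have hv : -(e * ((c + S.umin i) / e)) + c = - S.umin i := by
          have := hdiv (c + S.umin i); linarith
        rw [hv, feedback_hard_of_thrhi_lt hi hs (by linarith), neg_add_cancel]
        refine max_eq_left (min_le_of_right_le (div_nonpos_of_nonpos_of_nonneg ?_ ?_))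
        · nlinarith
        · linarith
    rcases le_or_gt c (e * S.ωlo i) with hc' | hc'
    · by_cases hs : S.soft i = false → e * S.ωlo i ≤ c + S.umax i
      · exact ⟨S.ωlo i, feedback_at_ωlo hi (by linarith) fun h => by linarith [hs h]⟩
      · push Not at hs
        obtain ⟨hs, hlt⟩ := hs
        have hw : (c + S.umax i) / e < S.ωlo i := by rw [div_lt_iff₀ he]; linarith
        refine ⟨(c + S.umax i) / e, ?_⟩
        have hv : -(e * ((c + S.umax i) / e)) + c = - S.umax i := by
          have := hdiv (c + S.umax i); linarith
        rw [hv, feedback_hard_of_lt_thrlo hi hs (by linarith), neg_add_cancel]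
        refine min_eq_left (le_max_of_le_right (div_nonneg ?_ ?_))
        · nlinarith
        · linarith
    -- Here damping alone balances at a safe frequency: the net power is zero, and the barrier does
    -- not activate the feedback.
    · have hw1 : c / e < S.ωhi i := by rw [div_lt_iff₀ he]; linarith
      have hw2 : S.ωlo i < c / e := by rw [lt_div_iff₀ he]; linarith
      refine ⟨c / e, ?_⟩
      rw [hdiv]
      rcases lt_or_ge (S.thrhi i) (c / e) with hw | hw
      · have hq : 0 ≤ S.γhi i * (S.ωhi i - c / e) / (c / e - S.thrhi i) :=
          div_nonneg (mul_nonneg h4.le (by linarith)) (by linarith)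
        cases hs : S.soft i
        · rw [feedback_hard_of_thrhi_lt hi hs hw, min_eq_left hq, max_eq_right]
          linarith [hu1 hs]
        · rw [feedback_soft_of_thrhi_lt hi hs hw, min_eq_left hq]
      rcases lt_or_ge (c / e) (S.thrlo i) with hw' | hw'
      · have hq : S.γlo i * (S.ωlo i - c / e) / (S.thrlo i - c / e) ≤ 0 :=
          div_nonpos_of_nonpos_of_nonneg
            (mul_nonpos_of_nonneg_of_nonpos h5.le (by linarith)) (by linarith)
        cases hs : S.soft i
        · rw [feedback_hard_of_lt_thrlo hi hs hw', max_eq_left hq, min_eq_right]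
          linarith [hu2 hs]
        · rw [feedback_soft_of_lt_thrlo hi hs hw', max_eq_left hq]
      · rw [feedback_of_mem_Icc ⟨hw', hw⟩, add_zero]
  · exact ⟨c / e, by rw [feedback_of_notMem hi, add_zero, hdiv]⟩

/-- For small steps `h`, an explicit Euler step under the unsaturated reference feedback leaves
the safe interval invariant, provided that the net power is bounded. -/
lemma exists_step_invariant (hi : i ∈ S.Iω) (hs : S.soft i = true) (C : ℝ) :
    ∃ h₀ > 0, ∀ h, 0 ≤ h → h ≤ h₀ → ∀ w v, |v| ≤ C → w ∈ Icc (S.ωlo i) (S.ωhi i) →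
      w + h * (v + S.feedback i w v) ∈ Icc (S.ωlo i) (S.ωhi i) := by
  have h1 := S.lt_ωhi i hi
  have h2 := S.ωlo_lt i hi
  have h3 := thrlo_lt_thrhi (S.subset hi)
  have h4 := S.γhi_pos i hi
  have h5 := S.γlo_pos i hi
  obtain ⟨η, hη, hη1, hη2⟩ : ∃ η > 0, η ≤ (S.ωhi i - S.thrhi i) / 2 ∧
      η ≤ (S.thrlo i - S.ωlo i) / 2 :=
    ⟨min ((S.ωhi i - S.thrhi i) / 2) ((S.thrlo i - S.ωlo i) / 2),
      lt_min (by linarith) (by linarith), min_le_left _ _, min_le_right _ _⟩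
  -- With this choice a step moves by at most `η` under the bare net power, and `h * γhi`, `h * γlo`
  -- are at most `η`.
  refine ⟨min (η / (|C| + 1)) (min (η / S.γhi i) (η / S.γlo i)),
    lt_min (by positivity) (lt_min (by positivity) (by positivity)), ?_⟩
  intro h h0 hh w v hv hw
  have hC : h * |v| ≤ η := by
    have := hh.trans (min_le_left _ _)
    rw [le_div_iff₀ (by positivity)] at this
    have h' := le_abs_self C
    nlinarith [abs_nonneg v]
  have hg1 : h * S.γhi i ≤ η := by
    have := hh.trans ((min_le_right _ _).trans (min_le_left _ _))
    rwa [le_div_iff₀ (by positivity)] at this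
  have hg2 : h * S.γlo i ≤ η := by
    have := hh.trans ((min_le_right _ _).trans (min_le_right _ _))
    rwa [le_div_iff₀ (by positivity)] at this
  have hv1 : -η ≤ h * v := by nlinarith [neg_abs_le v]
  have hv2 : h * v ≤ η := by nlinarith [le_abs_self v]
  rcases lt_or_ge (S.thrhi i) w with hw1 | hw1
  · rw [feedback_soft_of_thrhi_lt hi hs hw1]
    set Q := S.γhi i * (S.ωhi i - w) / (w - S.thrhi i)
    have hQ : 0 ≤ Q := div_nonneg (mul_nonneg h4.le (by linarith [hw.2])) (by linarith)
    constructor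
    · rcases le_total v Q with h' | h'
      · rw [min_eq_left h']; linarith
      · rw [min_eq_right h']; nlinarith
    -- Within `η` of the threshold even the uncapped step reaches at most `thrhi + 2 * η ≤ ωhi`.
    -- Further out `h * γhi ≤ η < w - thrhi`, so the capped step covers at most the remaining
    -- distance `ωhi - w`.
    · rcases le_or_gt (w - S.thrhi i) η with h' | h'
      · have : h * min v Q ≤ h * v := mul_le_mul_of_nonneg_left (min_le_left _ _) h0
        linarith
      · have : h * min v Q ≤ h * Q := mul_le_mul_of_nonneg_left (min_le_right _ _) h0
        have hQ' : h * Q ≤ S.ωhi i - w := by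
          rw [mul_div, div_le_iff₀ (by linarith)]
          have : 0 ≤ S.ωhi i - w := by linarith [hw.2]
          nlinarith
        linarith
  rcases lt_or_ge w (S.thrlo i) with hw2 | hw2
  · rw [feedback_soft_of_lt_thrlo hi hs hw2]
    set Q := S.γlo i * (S.ωlo i - w) / (S.thrlo i - w)
    have hQ : Q ≤ 0 := div_nonpos_of_nonpos_of_nonneg
      (mul_nonpos_of_nonneg_of_nonpos h5.le (by linarith [hw.1])) (by linarith)
    constructor
    · rcases le_or_gt (S.thrlo i - w) η with h' | h'
      · have : h * v ≤ h * max v Q := mul_le_mul_of_nonneg_left (le_max_left _ _) h0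
        linarith
      · have : h * Q ≤ h * max v Q := mul_le_mul_of_nonneg_left (le_max_right _ _) h0
        have hQ' : S.ωlo i - w ≤ h * Q := by
          rw [mul_div, le_div_iff₀ (by linarith)]
          have : S.ωlo i - w ≤ 0 := by linarith [hw.1]
          nlinarith
        linarith
    · rcases le_total v Q with h' | h'
      · rw [max_eq_right h']; nlinarith
      · rw [max_eq_left h']; linarith
  · rw [feedback_of_mem_Icc ⟨hw2, hw1⟩, add_zero]
    constructor <;> linarith

end ControlSpec

section

variable {n m : ℕ} {G : PowerNetwork n m} {S : ControlSpec n}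

lemma refInput_apply (s : Fin m → ℝ) (ω q : Fin n → ℝ) (i : Fin n) :
    refInput G S s ω q i = S.feedback i (ω i) (G.netPower s ω q i) := rfl

lemma PowerNetwork.netPower_apply (s : Fin m → ℝ) (ω q : Fin n → ℝ) (i : Fin n) :
    G.netPower s ω q i =
      -(G.E i * ω i) + (q i - (G.D.transpose.mulVec (G.Yb.mulVec s)) i) := by
  simp only [PowerNetwork.netPower]; ring

lemma ControlSpec.steps_pos {T : ℝ} (hT : 0 < T) : 0 < S.steps T :=
  Nat.ceil_pos.2 (div_pos S.horizon_pos hT)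

end

lemma exists_mulVec_bound {ι κ : Type*} [Fintype ι] [Fintype κ] (A : Matrix ι κ ℝ) :
    ∃ K > 0, ∀ (s : κ → ℝ) (a : ℝ), 0 ≤ a → (∀ j, |s j| ≤ a) → ∀ i, |A.mulVec s i| ≤ K * a := by
  have hnn : ∀ i, 0 ≤ ∑ j, |A i j| := fun i => Finset.sum_nonneg fun j _ => abs_nonneg _
  refine ⟨1 + ∑ i, ∑ j, |A i j|, ?_, fun s a ha hs i => ?_⟩
  · have := Finset.sum_nonneg (s := Finset.univ) fun i _ => hnn i
    positivity
  · have h1 : |A.mulVec s i| ≤ ∑ j, |A i j| * |s j| := by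
      simp only [Matrix.mulVec, dotProduct, ← abs_mul]
      exact Finset.abs_sum_le_sum_abs _ _
    have h2 : ∑ j, |A i j| * |s j| ≤ (∑ j, |A i j|) * a := by
      rw [Finset.sum_mul]
      exact Finset.sum_le_sum fun j _ => mul_le_mul_of_nonneg_left (hs j) (abs_nonneg _)
    have h3 := Finset.single_le_sum (fun i _ => hnn i) (Finset.mem_univ i)
    exact (h1.trans h2).trans (mul_le_mul_of_nonneg_right (by linarith) ha)

lemma exists_forall_le {ι : Type*} [Fintype ι] (f : ι → ℝ) : ∃ C > 0, ∀ i, f i ≤ C := by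
  refine ⟨1 + ∑ i, |f i|, ?_, fun i => ?_⟩
  · have := Finset.sum_nonneg (s := Finset.univ) fun i _ => abs_nonneg (f i)
    positivity
  · have := Finset.single_le_sum (fun i _ => abs_nonneg (f i)) (Finset.mem_univ i)
    linarith [le_abs_self (f i)]

namespace ControlSpec

variable {n : ℕ} {S : ControlSpec n}

/-- The feedback opposes the frequency, so it can only shrink `e * |w|` relative to the undriven
value `|c|`. -/
lemma abs_le_of_balance {i : Fin n} {w c e : ℝ}
    (h : (-(e * w) + c) + S.feedback i w (-(e * w) + c) = 0) : e * |w| ≤ |c| := by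
  refine mul_abs_le_abs (le_trans (le_of_eq ?_)
    (mul_feedback_nonpos (S := S) (i := i) (w := w) (v := -(e * w) + c)))
  congr 1
  linarith

/-- A frequency balancing the power `c` at a bus without inertia under the reference feedback. -/
def balanceFreq (S : ControlSpec n) (i : Fin n) (e c : ℝ) : ℝ :=
  if he : 0 < e then (exists_balance (S := S) i he c).choose else 0

lemma balanceFreq_spec (i : Fin n) {e : ℝ} (he : 0 < e) (c : ℝ) :
    (-(e * S.balanceFreq i e c) + c) +
      S.feedback i (S.balanceFreq i e c) (-(e * S.balanceFreq i e c) + c) = 0 := by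
  have := (exists_balance (S := S) i he c).choose_spec
  simpa only [balanceFreq, dif_pos he] using this

end ControlSpec

/-! ### Reference trajectories: construction, uniqueness, bounds, feasibility -/

section

variable {n m : ℕ} (G : PowerNetwork n m) (S : ControlSpec n)

/-- The states of the prediction model under the reference feedback. -/
def refState (T : ℝ) (P : ℕ → Fin n → ℝ) (lam : Fin m → ℝ) (ω : Fin n → ℝ) :
    ℕ → (Fin m → ℝ) × (Fin n → ℝ)
  | 0 => (sinVec lam, ω)
  | k + 1 =>
    let x := refState T P lam ω k
    let s := x.1 + T • G.D.mulVec x.2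
    -- The balance of step `k + 1` is solved when that state is created; the balance of step 0 must
    -- come from consistency of the initial state.
    (s, fun i => if G.M i = 0 then
        S.balanceFreq i (G.E i) (P (k + 1) i - (G.D.transpose.mulVec (G.Yb.mulVec s)) i)
      else x.2 i + T / G.M i * (G.netPower x.1 x.2 (P k) i + refInput G S x.1 x.2 (P k) i))

/-- The trajectory of the prediction model under the reference feedback. -/
def refTraj (T : ℝ) (P : ℕ → Fin n → ℝ) (lam : Fin m → ℝ) (ω : Fin n → ℝ) :
    DiscreteTraj n m where
  Λ k := (refState G S T P lam ω k).1
  Ω k := (refState G S T P lam ω k).2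
  U k := refInput G S (refState G S T P lam ω k).1 (refState G S T P lam ω k).2 (P k)

variable {G S} {T : ℝ} {P : ℕ → Fin n → ℝ} {lam : Fin m → ℝ} {ω : Fin n → ℝ}

/-- The power balance at a bus in terms of its frequency alone. -/
lemma balance_iff {X : DiscreteTraj n m} {k : ℕ} {i : Fin n} :
    G.netPower (X.Λ k) (X.Ω k) (P k) i + refInput G S (X.Λ k) (X.Ω k) (P k) i = 0 ↔
      (-(G.E i * X.Ω k i) + (P k i - (G.D.transpose.mulVec (G.Yb.mulVec (X.Λ k))) i)) +
        S.feedback i (X.Ω k i) (-(G.E i * X.Ω k i) +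
          (P k i - (G.D.transpose.mulVec (G.Yb.mulVec (X.Λ k))) i)) = 0 := by
  rw [refInput_apply, G.netPower_apply]

lemma isGeneratedRef_refTraj (hT : 0 < T) (hc : Consistent G S (P 0) lam ω) :
    IsGeneratedRef G S T P lam ω (refTraj G S T P lam ω) := by
  refine ⟨⟨rfl, rfl, fun k hk => ⟨rfl, fun i => ?_⟩⟩, fun k hk => rfl⟩
  by_cases hM : G.M i = 0
  · rw [hM, zero_mul, zero_div]
    cases k with
    | zero => exact (hc i hM).symm
    | succ k =>
      refine (balance_iff (G := G) (S := S) (X := refTraj G S T P lam ω) |>.2 ?_).symm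
      have : (refTraj G S T P lam ω).Ω (k + 1) i = S.balanceFreq i (G.E i) (P (k + 1) i -
        (G.D.transpose.mulVec (G.Yb.mulVec ((refTraj G S T P lam ω).Λ (k + 1)))) i) := by
        simp only [refTraj, refState, hM, if_true]
      rw [this]
      exact ControlSpec.balanceFreq_spec i (G.E_pos i) _
  · simp only [refTraj, refState, hM, if_false]
    field_simp
    ring

lemma IsGeneratedRef.balance {X : DiscreteTraj n m} (hX : IsGeneratedRef G S T P lam ω X) {k : ℕ}
    (hk : k < S.steps T) {i : Fin n} (hM : G.M i = 0) :
    G.netPower (X.Λ k) (X.Ω k) (P k) i + refInput G S (X.Λ k) (X.Ω k) (P k) i = 0 := by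
  have := (hX.1.2.2 k hk).2 i
  rw [hM, zero_mul, zero_div, hX.2 k hk] at this
  exact this.symm

lemma IsGeneratedRef.freq_succ {X : DiscreteTraj n m} (hX : IsGeneratedRef G S T P lam ω X)
    (hT : 0 < T) {k : ℕ} (hk : k < S.steps T) {i : Fin n} (hM : 0 < G.M i) :
    X.Ω (k + 1) i = X.Ω k i + T / G.M i * (G.netPower (X.Λ k) (X.Ω k) (P k) i +
      S.feedback i (X.Ω k i) (G.netPower (X.Λ k) (X.Ω k) (P k) i)) := by
  have := (hX.1.2.2 k hk).2 i
  rw [hX.2 k hk, refInput_apply] at this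
  rw [← this]
  field_simp
  ring

/-- Inertial frequencies follow by recursion, the others from the Lipschitz estimate with equal
powers. The index `N` is excluded: the prediction model imposes no balance there, so frequencies
without inertia are not determined. -/
lemma IsGeneratedRef.state_eq {X X' : DiscreteTraj n m} (hT : 0 < T)
    (hX : IsGeneratedRef G S T P lam ω X) (hX' : IsGeneratedRef G S T P lam ω X') :
    ∀ k < S.steps T, X.Λ k = X'.Λ k ∧ X.Ω k = X'.Ω k := by
  intro k
  induction k with
  | zero => exact fun _ => ⟨hX.1.1.trans hX'.1.1.symm, hX.1.2.1.trans hX'.1.2.1.symm⟩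
  | succ k ih =>
    intro hk
    obtain ⟨h1, h2⟩ := ih (by omega)
    have hΛ : X.Λ (k + 1) = X'.Λ (k + 1) := by
      rw [(hX.1.2.2 k (by omega)).1, (hX'.1.2.2 k (by omega)).1, h1, h2]
    refine ⟨hΛ, ?_⟩
    ext i
    rcases (G.M_nonneg i).eq_or_lt with hM | hM
    · have b := balance_iff.1 (hX.balance hk hM.symm)
      have b' := balance_iff.1 (hX'.balance hk hM.symm)
      rw [← hΛ] at b'
      have := ControlSpec.abs_sub_le_of_balance b b'
      rw [sub_self, abs_zero] at this
      have h0 : |X.Ω (k + 1) i - X'.Ω (k + 1) i| ≤ 0 :=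
        le_of_mul_le_mul_left (by simpa using this) (G.E_pos i)
      exact sub_eq_zero.1 (abs_nonpos_iff.1 h0)
    · rw [hX.freq_succ hT (by omega) hM, hX'.freq_succ hT (by omega) hM, h1, h2]

lemma ControlSpec.mul_lt_horizon (hT : 0 < T) {k : ℕ} (hk : k < S.steps T) :
    k * T < S.horizon := by
  rw [← lt_div_iff₀ hT]
  exact Nat.lt_ceil.1 hk

/-- An a priori bound for the net power along generated reference trajectories, uniform in the
step length. -/
lemma exists_netPower_bound (G : PowerNetwork n m) (S : ControlSpec n) (R : ℝ) :
    ∃ C, ∀ T, 0 < T → ∀ (P : ℕ → Fin n → ℝ) (lam : Fin m → ℝ) (ω : Fin n → ℝ)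
      (X : DiscreteTraj n m), (∀ k < S.steps T, ∀ i, |P k i| ≤ R) → (∀ i, |ω i| ≤ R) →
      IsGeneratedRef G S T P lam ω X →
      ∀ k < S.steps T, ∀ i, |G.netPower (X.Λ k) (X.Ω k) (P k) i| ≤ C := by
  obtain ⟨K1, hK1, hD⟩ := exists_mulVec_bound G.D
  obtain ⟨K2, hK2, hDY⟩ := exists_mulVec_bound (G.D.transpose * G.Yb)
  obtain ⟨K3, hK3, hE'⟩ := exists_forall_le fun i => (G.E i)⁻¹
  obtain ⟨K4, hK4, hE⟩ := exists_forall_le G.E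
  obtain ⟨K5, hK5, hM⟩ := exists_forall_le fun i => (G.M i)⁻¹
  obtain ⟨g, hg, hγ⟩ := exists_forall_le fun i => |S.γhi i| + |S.γlo i|
  -- If `a ≥ 1` bounds the injections, the angle states and the inertial frequencies, then `K6 * a`
  -- bounds all frequencies and `K7 * a` the net powers, and one step of length `T` enlarges `a` by
  -- the factor `1 + T * K` at most.
  set K6 := 1 + K3 * (K2 + 1) with hK6
  set K7 := K4 * K6 + K2 + 1 with hK7
  set K := K1 * K6 + K5 * (K7 + g) with hK
  have hK6p : 0 < K6 := by positivity
  have hK7p : 0 < K7 := by positivity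
  have hKp : 0 < K := by positivity
  -- The 1 accounts for the initial angle state, which is a vector of sines.
  set R0 := max R 1
  have hR0 : R ≤ R0 := le_max_left _ _
  have hR1 : 1 ≤ R0 := le_max_right _ _
  refine ⟨K7 * (Real.exp (K * S.horizon) * R0), ?_⟩
  intro T hT P lam ω X hP hω hX
  -- bounds at step `k` in terms of the bounds for the dynamic states
  have key : ∀ k < S.steps T, ∀ a, R0 ≤ a → (∀ j, |X.Λ k j| ≤ a) →
      (∀ i, 0 < G.M i → |X.Ω k i| ≤ a) →
      (∀ i, |X.Ω k i| ≤ K6 * a) ∧ ∀ i, |G.netPower (X.Λ k) (X.Ω k) (P k) i| ≤ K7 * a := by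
    intro k hk a ha hΛ hΩ
    have hc : ∀ i, |P k i - (G.D.transpose.mulVec (G.Yb.mulVec (X.Λ k))) i| ≤ (K2 + 1) * a := by
      intro i
      have h1 := hDY (X.Λ k) a (by linarith) hΛ i
      rw [← Matrix.mulVec_mulVec] at h1
      have h2 := abs_sub (P k i) ((G.D.transpose.mulVec (G.Yb.mulVec (X.Λ k))) i)
      linarith [hP k hk i]
    have hΩ' : ∀ i, |X.Ω k i| ≤ K6 * a := by
      intro i
      rcases (G.M_nonneg i).eq_or_lt with h0 | h0
      · have h1 := ControlSpec.abs_le_of_balance (balance_iff.1 (hX.balance hk h0.symm))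
        have h2 : |X.Ω k i| ≤ (G.E i)⁻¹ * ((K2 + 1) * a) := by
          rw [inv_mul_eq_div, le_div_iff₀' (G.E_pos i)]
          exact h1.trans (hc i)
        have h3 : (G.E i)⁻¹ * ((K2 + 1) * a) ≤ K3 * ((K2 + 1) * a) :=
          mul_le_mul_of_nonneg_right (hE' i) (by nlinarith)
        rw [hK6]
        nlinarith
      · have := hΩ i h0
        have : 0 ≤ K3 * (K2 + 1) * a := mul_nonneg (by positivity) (by linarith)
        rw [hK6]; linarith
    refine ⟨hΩ', fun i => ?_⟩
    rw [G.netPower_apply]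
    have h1 := abs_add_le (-(G.E i * X.Ω k i))
      (P k i - (G.D.transpose.mulVec (G.Yb.mulVec (X.Λ k))) i)
    rw [abs_neg, abs_mul, abs_of_pos (G.E_pos i)] at h1
    have h2 : G.E i * |X.Ω k i| ≤ K4 * (K6 * a) :=
      mul_le_mul (hE i) (hΩ' i) (abs_nonneg _) hK4.le
    have := hc i
    rw [hK7]; linarith
  have main : ∀ k ≤ S.steps T, (∀ j, |X.Λ k j| ≤ (1 + T * K) ^ k * R0) ∧
      (∀ i, 0 < G.M i → |X.Ω k i| ≤ (1 + T * K) ^ k * R0) := by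
    intro k
    induction k with
    | zero =>
      intro _
      rw [hX.1.1, hX.1.2.1, pow_zero, one_mul]
      exact ⟨fun j => (Real.abs_sin_le_one _).trans hR1, fun i _ => (hω i).trans hR0⟩
    | succ k ih =>
      intro hk
      obtain ⟨h1, h2⟩ := ih (by omega)
      have hk' : k < S.steps T := by omega
      set a := (1 + T * K) ^ k * R0 with ha
      have haR : R0 ≤ a := by
        have : 1 ≤ (1 + T * K) ^ k := one_le_pow₀ (by nlinarith)
        rw [ha]; nlinarith
      obtain ⟨h3, h4⟩ := key k hk' a haR h1 h2
      have hstep : (1 + T * K) ^ (k + 1) * R0 = a + T * (K1 * (K6 * a)) +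
          T * K5 * (K7 * a + g * a) := by
        rw [ha, pow_succ, hK]; ring
      have ha1 : 1 ≤ a := hR1.trans haR
      have hp1 : 0 ≤ T * (K1 * (K6 * a)) := by positivity
      have hp2 : 0 ≤ T * K5 * (K7 * a + g * a) := by positivity
      rw [hstep]
      constructor
      · intro j
        rw [(hX.1.2.2 k hk').1]
        have h5 := hD (X.Ω k) (K6 * a) (by positivity) h3 j
        have h6 := abs_add_le (X.Λ k j) (T * G.D.mulVec (X.Ω k) j)
        rw [abs_mul, abs_of_pos hT] at h6
        have h7 := mul_le_mul_of_nonneg_left h5 hT.le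
        simp only [Pi.add_apply, Pi.smul_apply, smul_eq_mul]
        linarith [h1 j]
      · intro i hi
        rw [hX.freq_succ hT hk' hi]
        set v := G.netPower (X.Λ k) (X.Ω k) (P k) i
        have h5 : |v + S.feedback i (X.Ω k i) v| ≤ K7 * a + g * a := by
          have := ControlSpec.abs_add_feedback_le (S := S) (i := i) (w := X.Ω k i) (v := v)
          have := h4 i
          have := hγ i
          nlinarith
        have h6 := abs_add_le (X.Ω k i) (T / G.M i * (v + S.feedback i (X.Ω k i) v))
        rw [abs_mul, abs_of_pos (div_pos hT hi)] at h6
        have h7 : T / G.M i * |v + S.feedback i (X.Ω k i) v| ≤ T * K5 * (K7 * a + g * a) := by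
          refine mul_le_mul ?_ h5 (abs_nonneg _) (by positivity)
          rw [div_eq_mul_inv]
          exact mul_le_mul_of_nonneg_left (hM i) hT.le
        linarith [h2 i hi]
  intro k hk i
  obtain ⟨h1, h2⟩ := main k hk.le
  have hle : R0 ≤ (1 + T * K) ^ k * R0 := by
    have : 1 ≤ (1 + T * K) ^ k := one_le_pow₀ (by nlinarith)
    nlinarith
  refine ((key k hk _ hle h1 h2).2 i).trans (mul_le_mul_of_nonneg_left ?_ hK7p.le)
  refine mul_le_mul_of_nonneg_right ?_ (by linarith)
  -- Discrete Gronwall: `k * T` stays below the horizon, so the bound does not depend on `T`.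
  calc (1 + T * K) ^ k ≤ Real.exp (T * K) ^ k := by
        refine pow_le_pow_left₀ (by positivity) ?_ k
        linarith [Real.add_one_le_exp (T * K)]
    _ = Real.exp (K * (k * T)) := by rw [← Real.exp_nat_mul]; congr 1; ring
    _ ≤ Real.exp (K * S.horizon) := by
        rw [Real.exp_le_exp]
        exact mul_le_mul_of_nonneg_left (ControlSpec.mul_lt_horizon hT hk).le hKp.le

lemma ControlSpec.κ_eq_zero_or_one (ω₀ : Fin n → ℝ) (i : Fin n) :
    S.κ ω₀ i = 0 ∧ S.soft i = true ∧ ω₀ i ∈ Icc (S.ωlo i) (S.ωhi i) ∨ S.κ ω₀ i = 1 := by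
  unfold ControlSpec.κ
  split_ifs with h
  · exact Or.inl ⟨rfl, h.2, h.1⟩
  · exact Or.inr rfl

/-- For small step lengths, the generated trajectory is a reference trajectory: at the buses with
soft constraints it does not leave the safe interval. -/
lemma exists_isReferenceTraj (G : PowerNetwork n m) (S : ControlSpec n) (R : ℝ) :
    ∃ Tbar > 0, ∀ T, 0 < T → T ≤ Tbar → ∀ (P : ℕ → Fin n → ℝ) (lam : Fin m → ℝ) (ω : Fin n → ℝ),
      (∀ k < S.steps T, ∀ i, |P k i| ≤ R) → (∀ i, |ω i| ≤ R) → Consistent G S (P 0) lam ω →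
      IsGeneratedRef G S T P lam ω (refTraj G S T P lam ω) ∧
      IsReferenceTraj G S T P lam ω (refTraj G S T P lam ω) := by
  obtain ⟨C, hC⟩ := exists_netPower_bound G S R
  have hstep : ∀ i, ∃ h₀ > 0, i ∈ S.Iω → S.soft i = true → ∀ h, 0 ≤ h → h ≤ h₀ → ∀ w v, |v| ≤ C →
      w ∈ Icc (S.ωlo i) (S.ωhi i) →
        w + h * (v + S.feedback i w v) ∈ Icc (S.ωlo i) (S.ωhi i) := by
    intro i
    by_cases h : i ∈ S.Iω ∧ S.soft i = true
    · obtain ⟨h₀, hh, H⟩ := ControlSpec.exists_step_invariant h.1 h.2 C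
      exact ⟨h₀, hh, fun _ _ => H⟩
    · exact ⟨1, one_pos, fun h1 h2 => absurd ⟨h1, h2⟩ h⟩
  choose h₀ hh₀ hinv using hstep
  -- `T ≤ K⁻¹` makes the Euler factor `T / M i` at most `h₀ i` at every inertial bus.
  obtain ⟨K, hK, hKM⟩ := exists_forall_le fun i => (G.M i)⁻¹ * (h₀ i)⁻¹
  refine ⟨K⁻¹, inv_pos.2 hK, fun T hT hTK P lam ω hP hω hc => ?_⟩
  have hgen := isGeneratedRef_refTraj hT hc
  set X := refTraj G S T P lam ω
  -- Soft constraints are met by oversized slacks; the hard input limits and the frequency bounds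
  -- with `κ = 0` need an argument.
  refine ⟨hgen, ⟨⟨fun k i => |X.U k i| + |S.umin i| + |S.umax i|,
    fun k i => |X.Ω k i| + |S.ωlo i| + |S.ωhi i| + |S.δ i|⟩, ⟨hgen.1, ?_, ?_, ?_⟩, ?_⟩⟩
  · intro k hk i hi
    rw [hgen.2 k hk, refInput_apply,
      ControlSpec.feedback_of_notMem fun h => hi (S.subset h)]
  · intro k hk i hi
    have a1 := abs_nonneg (X.U k i); have a2 := abs_nonneg (S.umin i)
    have a3 := abs_nonneg (S.umax i)
    refine ⟨?_, ?_, by positivity⟩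
    all_goals
      cases hs : S.soft i
      · simp only [ControlSpec.ξ, hs, Bool.false_eq_true, if_false, zero_mul, sub_zero, add_zero]
        rw [hgen.2 k hk, refInput_apply]
        first
        | exact ControlSpec.umin_le_feedback hi hs
        | exact ControlSpec.feedback_le_umax hi hs
      · simp only [ControlSpec.ξ, hs, if_true, one_mul]
        linarith [neg_abs_le (X.U k i), le_abs_self (X.U k i), neg_abs_le (S.umax i),
          le_abs_self (S.umin i)]
  · intro k hk1 hk i hi
    have a1 := abs_nonneg (X.Ω k i); have a2 := abs_nonneg (S.ωlo i)
    have a3 := abs_nonneg (S.ωhi i); have a4 := abs_nonneg (S.δ i)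
    rcases ControlSpec.κ_eq_zero_or_one (S := S) ω i with ⟨hκ, hs, hm⟩ | hκ
    · rw [hκ, zero_mul, sub_zero, add_zero]
      suffices h : ∀ k ≤ S.steps T, X.Ω k i ∈ Icc (S.ωlo i) (S.ωhi i) from
        ⟨(h k hk).1, (h k hk).2, by positivity⟩
      intro k
      induction k with
      | zero => intro _; rw [hgen.1.2.1]; exact hm
      | succ k ih =>
        intro hk
        rcases (G.M_nonneg i).eq_or_lt with hM | hM
        -- A balanced frequency at a soft bus is safe whatever the power is. This covers the last
        -- index too, where the value of `P` is beyond control.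
        · have : X.Ω (k + 1) i = S.balanceFreq i (G.E i) (P (k + 1) i -
              (G.D.transpose.mulVec (G.Yb.mulVec (X.Λ (k + 1)))) i) := by
            simp only [X, refTraj, refState, ← hM, if_true]
          rw [this]
          exact (ControlSpec.feedback_of_balance hi
            (ControlSpec.balanceFreq_spec i (G.E_pos i) _)).1 hs
        · rw [hgen.freq_succ hT (by omega) hM]
          refine hinv i hi hs _ (div_nonneg hT.le hM.le) ?_ _ _
            (hC T hT P lam ω X hP hω hgen k (by omega) i) (ih (by omega))
          have h1 := hKM i
          have h2 : T * K ≤ 1 := by rwa [← le_div_iff₀ hK, one_div]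
          have h3 : T * ((G.M i)⁻¹ * (h₀ i)⁻¹) ≤ 1 :=
            (mul_le_mul_of_nonneg_left h1 hT.le).trans h2
          rw [← mul_assoc, ← div_eq_mul_inv, ← div_eq_mul_inv, div_le_one (hh₀ i)] at h3
          exact h3
    · rw [hκ]
      refine ⟨?_, ?_, by positivity⟩
      · linarith [neg_abs_le (X.Ω k i), le_abs_self (S.ωlo i), le_abs_self (S.δ i)]
      · linarith [le_abs_self (X.Ω k i), neg_abs_le (S.ωhi i), le_abs_self (S.δ i)]
  · intro i hi k hk
    rw [hgen.2 k hk, refInput_apply]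
    exact ⟨fun _ => ControlSpec.mul_feedback_nonpos,
      fun h => ControlSpec.feedback_of_mem_Icc ⟨h.1.le, h.2.le⟩⟩

end

/-! ### The convex problem: existence of an optimum and uniqueness of its input -/

section

lemma isClosed_setOf_forall {α : Type*} [TopologicalSpace α] {ι : Sort*} {p : ι → α → Prop}
    (h : ∀ i, IsClosed {x | p i x}) : IsClosed {x | ∀ i, p i x} := by
  rw [ofPred_forall]; exact isClosed_iInter h

variable {n m : ℕ} (G : PowerNetwork n m) (S : ControlSpec n)

/-- The states of the prediction model as functions of the input; at the buses without inertia the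
frequency solves the power balance, and in the last step it is the middle of the safe interval. -/
def simState (T : ℝ) (P : ℕ → Fin n → ℝ) (lam : Fin m → ℝ) (ω : Fin n → ℝ)
    (U : ℕ → Fin n → ℝ) : ℕ → (Fin m → ℝ) × (Fin n → ℝ)
  | 0 => (sinVec lam, ω)
  | k + 1 =>
    let x := simState T P lam ω U k
    let s := x.1 + T • G.D.mulVec x.2
    (s, fun i => if G.M i = 0 then
        if k + 1 < S.steps T then
          (P (k + 1) i - (G.D.transpose.mulVec (G.Yb.mulVec s)) i + U (k + 1) i) / G.E i
        -- No equation determines this last frequency. The midpoint satisfies the frequency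
        -- constraint whenever some value does.
        else (S.ωlo i + S.ωhi i) / 2
      else x.2 i + T / G.M i * (G.netPower x.1 x.2 (P k) i + U k i))

/-- The trajectory of the prediction model with input `U`. -/
def simTraj (T : ℝ) (P : ℕ → Fin n → ℝ) (lam : Fin m → ℝ) (ω : Fin n → ℝ)
    (U : ℕ → Fin n → ℝ) : DiscreteTraj n m where
  Λ k := (simState G S T P lam ω U k).1
  Ω k := (simState G S T P lam ω U k).2
  U := U

variable {G S} {T : ℝ} {P : ℕ → Fin n → ℝ} {lam : Fin m → ℝ} {ω : Fin n → ℝ}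

lemma continuous_mulVec {ι κ : Type*} [Fintype ι] [Fintype κ] (A : Matrix ι κ ℝ) :
    Continuous A.mulVec := Continuous.matrix_mulVec continuous_const continuous_id

lemma continuous_netPower :
    Continuous fun x : (Fin m → ℝ) × (Fin n → ℝ) × (Fin n → ℝ) =>
      G.netPower x.1 x.2.1 x.2.2 := by
  have := continuous_mulVec G.D.transpose
  have := continuous_mulVec G.Yb
  unfold PowerNetwork.netPower
  fun_prop

lemma continuous_simState (k : ℕ) : Continuous fun U => simState G S T P lam ω U k := by
  induction k with
  | zero => simp only [simState]; fun_prop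
  | succ k ih =>
    simp only [simState]
    have hD := continuous_mulVec G.D
    have h1 := continuous_mulVec G.D.transpose
    have h2 := continuous_mulVec G.Yb
    have h3 : Continuous fun U => G.netPower (simState G S T P lam ω U k).1
        (simState G S T P lam ω U k).2 (P k) :=
      continuous_netPower.comp (ih.fst.prodMk (ih.snd.prodMk continuous_const))
    refine Continuous.prodMk (by fun_prop) (continuous_pi fun i => ?_)
    split_ifs <;> fun_prop

/-- A trajectory of the prediction model agrees with the simulated one. -/
lemma SatisfiesPrediction.simState_eq {X : DiscreteTraj n m} {U : ℕ → Fin n → ℝ} (hT : 0 < T)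
    (hX : SatisfiesPrediction G S T P lam ω X) (hU : ∀ k < S.steps T, U k = X.U k) :
    ∀ k ≤ S.steps T, (simState G S T P lam ω U k).1 = X.Λ k ∧
      ∀ i, (simState G S T P lam ω U k).2 i =
        if G.M i = 0 ∧ k = S.steps T then (S.ωlo i + S.ωhi i) / 2 else X.Ω k i := by
  intro k
  induction k with
  | zero =>
    intro _
    have := ControlSpec.steps_pos (S := S) hT
    refine ⟨hX.1.symm, fun i => ?_⟩
    rw [if_neg (by omega), hX.2.1]; rfl
  | succ k ih =>
    intro hk
    obtain ⟨h1, h2⟩ := ih (by omega)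
    have h2' : (simState G S T P lam ω U k).2 = X.Ω k := by
      ext i; rw [h2, if_neg (by omega)]
    have hΛ : (simState G S T P lam ω U (k + 1)).1 = X.Λ (k + 1) := by
      rw [(hX.2.2 k (by omega)).1, ← h1, ← h2']; rfl
    refine ⟨hΛ, fun i => ?_⟩
    by_cases hM : G.M i = 0
    · by_cases hk' : k + 1 = S.steps T
      · simp [simState, hM, hk']
      · rw [if_neg (by tauto)]
        have hlt : k + 1 < S.steps T := by omega
        have e : (simState G S T P lam ω U (k + 1)).2 i = (P (k + 1) i -
            (G.D.transpose.mulVec (G.Yb.mulVec (simState G S T P lam ω U (k + 1)).1)) i +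
            U (k + 1) i) / G.E i := by
          simp only [simState, hM, if_true, hlt]
        have := (hX.2.2 (k + 1) hlt).2 i
        rw [hM, zero_mul, zero_div, G.netPower_apply] at this
        rw [e, hΛ, hU _ hlt, div_eq_iff (G.E_pos i).ne']
        linarith
    · rw [if_neg (by tauto)]
      have := (hX.2.2 k (by omega)).2 i
      simp only [simState, hM, if_false]
      rw [h1, h2', hU k (by omega), ← this]
      field_simp
      ring

/-- The relevant entries of an input or slack sequence. -/
def restrictSeq (p : ℕ → Fin n → Prop) [∀ k i, Decidable (p k i)] (f : ℕ → Fin n → ℝ) :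
    ℕ → Fin n → ℝ := fun k i => if p k i then f k i else 0

open Classical in
/-- Every feasible point can be replaced by a simulated one of the same cost whose irrelevant
entries vanish. -/
lemma FeasibleCvx.normalize {Xref X : DiscreteTraj n m} {Z : Slack n} (hT : 0 < T)
    (h : FeasibleCvx G S T P lam ω Xref X Z) :
    let U := restrictSeq (fun k i => k < S.steps T ∧ i ∈ S.Iu) X.U
    let Z' : Slack n := ⟨restrictSeq (fun k i => k < S.steps T ∧ i ∈ S.Iu) Z.B,
      restrictSeq (fun k i => (1 ≤ k ∧ k ≤ S.steps T) ∧ i ∈ S.Iω) Z.Γ⟩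
    FeasibleCvx G S T P lam ω Xref (simTraj G S T P lam ω U) Z' ∧
      cost S T (simTraj G S T P lam ω U) Z' = cost S T X Z := by
  intro U Z'
  obtain ⟨⟨hpred, hU0, hU, hΩ⟩, hcvx⟩ := h
  have hUU : ∀ k < S.steps T, U k = X.U k := by
    intro k hk
    ext i
    by_cases hi : i ∈ S.Iu
    · simp [U, restrictSeq, hk, hi]
    · simp [U, restrictSeq, hi, hU0 k hk i hi]
  have hB : ∀ k < S.steps T, ∀ i ∈ S.Iu, Z'.B k i = Z.B k i := by
    intro k hk i hi
    simp [Z', restrictSeq, hk, hi]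
  have hΓ : ∀ k, 1 ≤ k → k ≤ S.steps T → ∀ i ∈ S.Iω, Z'.Γ k i = Z.Γ k i := by
    intro k hk1 hk i hi
    simp [Z', restrictSeq, hk, hi, hk1]
  have hsim := hpred.simState_eq hT hUU
  set X' := simTraj G S T P lam ω U with hX'
  have hΛ' : ∀ k ≤ S.steps T, X'.Λ k = X.Λ k := fun k hk => (hsim k hk).1
  have hΩ' : ∀ k < S.steps T, X'.Ω k = X.Ω k := by
    intro k hk
    ext i
    exact ((hsim k hk.le).2 i).trans (if_neg (by omega))
  have hXU : X'.U = U := rfl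
  refine ⟨⟨⟨⟨rfl, rfl, fun k hk => ⟨rfl, fun i => ?_⟩⟩, ?_, ?_, ?_⟩, ?_⟩, ?_⟩
  · have := (hpred.2.2 k hk).2 i
    rw [hΛ' k hk.le, hΩ' k hk, hXU, hUU k hk, ← this]
    by_cases hM : G.M i = 0
    · rw [hM]; simp
    · have e : X'.Ω (k + 1) i = X.Ω (k + 1) i :=
        ((hsim (k + 1) hk).2 i).trans (if_neg (by tauto))
      rw [e]
  · intro k hk i hi
    rw [hXU, hUU k hk, hU0 k hk i hi]
  · intro k hk i hi
    rw [hXU, hUU k hk, hB k hk i hi]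
    exact hU k hk i hi
  · intro k hk1 hk i hi
    have e : X'.Ω k i = _ := (hsim k hk).2 i
    rw [hΓ k hk1 hk i hi, e]
    obtain ⟨h1, h2, h3⟩ := hΩ k hk1 hk i hi
    -- In the midpoint case, `lo - x ≤ hi + x` already puts `(lo + hi) / 2` between the two.
    refine ⟨?_, ?_, h3⟩ <;> split_ifs <;> linarith
  · intro i hi k hk
    rw [hXU, hUU k hk, hΩ' k hk]
    exact hcvx i hi k hk
  · unfold cost
    congr 1
    · refine Finset.sum_congr rfl fun i hi => Finset.sum_congr rfl fun k hk => ?_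
      have hk := Finset.mem_range.1 hk
      rw [hXU, hUU k hk, hB k hk i hi]
    · refine Finset.sum_congr rfl fun i hi => Finset.sum_congr rfl fun k hk => ?_
      have hk := Finset.mem_Icc.1 hk
      rw [hΓ k hk.1 hk.2 i hi]

/-- Along simulated trajectories the state is a continuous function of the input in the product
topology, and all constraints are equalities or weak inequalities; the conditions on the reference
are fixed propositions. -/
lemma isClosed_feasibleCvx (Xref : DiscreteTraj n m) :
    IsClosed {x : (ℕ → Fin n → ℝ) × (ℕ → Fin n → ℝ) × (ℕ → Fin n → ℝ) |
      FeasibleCvx G S T P lam ω Xref (simTraj G S T P lam ω x.1) ⟨x.2.1, x.2.2⟩} := by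
  have hs : ∀ k, Continuous fun x : (ℕ → Fin n → ℝ) × (ℕ → Fin n → ℝ) × (ℕ → Fin n → ℝ) =>
      simState G S T P lam ω x.1 k := fun k => (continuous_simState k).comp continuous_fst
  have hD := continuous_mulVec G.D
  have hN : ∀ k, Continuous fun x : (ℕ → Fin n → ℝ) × (ℕ → Fin n → ℝ) × (ℕ → Fin n → ℝ) =>
      G.netPower (simState G S T P lam ω x.1 k).1 (simState G S T P lam ω x.1 k).2 (P k) :=
    fun k => continuous_netPower.comp ((hs k).fst.prodMk ((hs k).snd.prodMk continuous_const))
  unfold FeasibleCvx SatisfiesCommon SatisfiesPrediction InPhiCvx simTraj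
  dsimp only
  refine ((IsClosed.and (isClosed_eq (by fun_prop) (by fun_prop)) (IsClosed.and
    (isClosed_eq (by fun_prop) (by fun_prop)) ?_)).and (IsClosed.and ?_ (IsClosed.and ?_ ?_))).and ?_
  · refine isClosed_setOf_forall fun k => isClosed_setOf_forall fun _ => IsClosed.and
      (isClosed_eq (by fun_prop) (by fun_prop)) (isClosed_setOf_forall fun i =>
        isClosed_eq (by fun_prop) (by fun_prop))
  · refine isClosed_setOf_forall fun k => isClosed_setOf_forall fun _ =>
      isClosed_setOf_forall fun i => isClosed_setOf_forall fun _ =>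
        isClosed_eq (by fun_prop) (by fun_prop)
  · refine isClosed_setOf_forall fun k => isClosed_setOf_forall fun _ =>
      isClosed_setOf_forall fun i => isClosed_setOf_forall fun _ => IsClosed.and
        (isClosed_le (by fun_prop) (by fun_prop)) (IsClosed.and
        (isClosed_le (by fun_prop) (by fun_prop)) (isClosed_le (by fun_prop) (by fun_prop)))
  · refine isClosed_setOf_forall fun k => isClosed_setOf_forall fun _ =>
      isClosed_setOf_forall fun _ => isClosed_setOf_forall fun i => isClosed_setOf_forall fun _ =>
        IsClosed.and (isClosed_le (by fun_prop) (by fun_prop)) (IsClosed.and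
        (isClosed_le (by fun_prop) (by fun_prop)) (isClosed_le (by fun_prop) (by fun_prop)))
  · refine isClosed_setOf_forall fun i => isClosed_setOf_forall fun _ =>
      isClosed_setOf_forall fun k => isClosed_setOf_forall fun _ => IsClosed.and
        (isClosed_setOf_forall fun _ => IsClosed.and (isClosed_le (by fun_prop) (by fun_prop))
          (isClosed_le (by fun_prop) (by fun_prop))) (IsClosed.and
        (isClosed_setOf_forall fun _ => IsClosed.and (isClosed_le (by fun_prop) (by fun_prop))
          (isClosed_le (by fun_prop) (by fun_prop)))
        (isClosed_setOf_forall fun _ => isClosed_setOf_forall fun _ =>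
          isClosed_eq (by fun_prop) (by fun_prop)))

lemma ControlSpec.inputCost_nonneg (i : Fin n) (hi : i ∈ S.Iu) (x y : ℝ) :
    0 ≤ S.c i * x ^ 2 + S.d i * y ^ 2 := by
  have := S.c_pos i hi
  have := S.d_pos i hi
  positivity

lemma ControlSpec.freqCost_nonneg (i : Fin n) (hi : i ∈ S.Iω) (x : ℝ) : 0 ≤ S.e i * x ^ 2 := by
  have := S.e_pos i hi
  positivity

lemma le_cost_input (X : DiscreteTraj n m) (Z : Slack n) {i : Fin n} (hi : i ∈ S.Iu) {k : ℕ}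
    (hk : k < S.steps T) : S.c i * X.U k i ^ 2 + S.d i * Z.B k i ^ 2 ≤ cost S T X Z := by
  have h1 := Finset.single_le_sum (f := fun k => S.c i * X.U k i ^ 2 + S.d i * Z.B k i ^ 2)
    (fun k _ => ControlSpec.inputCost_nonneg i hi _ _) (Finset.mem_range.2 hk)
  have h2 := Finset.single_le_sum (f := fun i => ∑ k ∈ Finset.range (S.steps T),
    (S.c i * X.U k i ^ 2 + S.d i * Z.B k i ^ 2))
    (fun i hi => Finset.sum_nonneg fun k _ => ControlSpec.inputCost_nonneg i hi _ _) hi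
  have h3 : 0 ≤ ∑ i ∈ S.Iω, ∑ k ∈ Finset.Icc 1 (S.steps T), S.e i * Z.Γ k i ^ 2 :=
    Finset.sum_nonneg fun i hi => Finset.sum_nonneg fun k _ => ControlSpec.freqCost_nonneg i hi _
  unfold cost
  linarith

lemma le_cost_freq (X : DiscreteTraj n m) (Z : Slack n) {i : Fin n} (hi : i ∈ S.Iω) {k : ℕ}
    (hk : 1 ≤ k ∧ k ≤ S.steps T) : S.e i * Z.Γ k i ^ 2 ≤ cost S T X Z := by
  have h1 := Finset.single_le_sum (f := fun k => S.e i * Z.Γ k i ^ 2)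
    (fun k _ => ControlSpec.freqCost_nonneg i hi _) (Finset.mem_Icc.2 hk)
  have h2 := Finset.single_le_sum (f := fun i => ∑ k ∈ Finset.Icc 1 (S.steps T),
    S.e i * Z.Γ k i ^ 2)
    (fun i hi => Finset.sum_nonneg fun k _ => ControlSpec.freqCost_nonneg i hi _) hi
  have h3 : 0 ≤ ∑ i ∈ S.Iu, ∑ k ∈ Finset.range (S.steps T),
      (S.c i * X.U k i ^ 2 + S.d i * Z.B k i ^ 2) :=
    Finset.sum_nonneg fun i hi => Finset.sum_nonneg fun k _ => ControlSpec.inputCost_nonneg i hi _ _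
  unfold cost
  linarith

lemma abs_le_of_mul_sq_le {a x C : ℝ} (ha : 0 < a) (h : a * x ^ 2 ≤ C) : |x| ≤ 1 + C / a := by
  have h1 : x ^ 2 ≤ C / a := by rwa [le_div_iff₀' ha]
  have := sq_abs x
  nlinarith [sq_nonneg (|x| - 1), abs_nonneg x]

lemma continuous_cost_simTraj :
    Continuous fun x : (ℕ → Fin n → ℝ) × (ℕ → Fin n → ℝ) × (ℕ → Fin n → ℝ) =>
      cost S T (simTraj G S T P lam ω x.1) ⟨x.2.1, x.2.2⟩ := by
  unfold cost simTraj
  dsimp only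
  fun_prop

open Classical in
/-- `Q_cvx` has an optimal solution if it is feasible. -/
lemma FeasibleCvx.exists_optimal {Xref X₀ : DiscreteTraj n m} {Z₀ : Slack n} (hT : 0 < T)
    (h₀ : FeasibleCvx G S T P lam ω Xref X₀ Z₀) :
    ∃ X Z, OptimalCvx G S T P lam ω Xref X Z := by
  set C := cost S T X₀ Z₀
  let F : Set ((ℕ → Fin n → ℝ) × (ℕ → Fin n → ℝ) × (ℕ → Fin n → ℝ)) :=
    {x | FeasibleCvx G S T P lam ω Xref (simTraj G S T P lam ω x.1) ⟨x.2.1, x.2.2⟩}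
  let box (r : ℕ → Fin n → ℝ) : Set (ℕ → Fin n → ℝ) :=
    univ.pi fun k => univ.pi fun i => Icc (-r k i) (r k i)
  let pu : ℕ → Fin n → Prop := fun k i => k < S.steps T ∧ i ∈ S.Iu
  let pω : ℕ → Fin n → Prop := fun k i => (1 ≤ k ∧ k ≤ S.steps T) ∧ i ∈ S.Iω
  -- Points no costlier than the given one have their relevant entries in these intervals;
  -- normalization makes all other entries zero, so the infinite product is compact.
  let K := box (restrictSeq pu fun _ i => 1 + C / S.c i) ×ˢ
    (box (restrictSeq pu fun _ i => 1 + C / S.d i) ×ˢ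
      box (restrictSeq pω fun _ i => 1 + C / S.e i))
  have hbox : ∀ r, IsCompact (box r) := fun r =>
    isCompact_univ_pi fun k => isCompact_univ_pi fun i => isCompact_Icc
  have hK : IsCompact (F ∩ K) :=
    ((hbox _).prod ((hbox _).prod (hbox _))).inter_left (isClosed_feasibleCvx Xref)
  let norm (X : DiscreteTraj n m) (Z : Slack n) :
      (ℕ → Fin n → ℝ) × (ℕ → Fin n → ℝ) × (ℕ → Fin n → ℝ) :=
    (restrictSeq pu X.U, restrictSeq pu Z.B, restrictSeq pω Z.Γ)
  have hmem : ∀ X Z, FeasibleCvx G S T P lam ω Xref X Z → cost S T X Z ≤ C →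
      norm X Z ∈ F ∩ K := by
    intro X Z hX hC
    refine ⟨(hX.normalize hT).1, ?_, ?_, ?_⟩
    · refine fun k _ i _ => abs_le.1 ?_
      by_cases hp : pu k i
      · have := le_cost_input X Z hp.2 hp.1
        have h1 := S.c_pos i hp.2
        have h2 := S.d_pos i hp.2
        simp only [norm, restrictSeq, hp, if_true]
        exact abs_le_of_mul_sq_le h1 (by nlinarith [sq_nonneg (Z.B k i)])
      · simp [norm, restrictSeq, hp]
    · refine fun k _ i _ => abs_le.1 ?_
      by_cases hp : pu k i
      · have := le_cost_input X Z hp.2 hp.1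
        have h1 := S.c_pos i hp.2
        have h2 := S.d_pos i hp.2
        simp only [norm, restrictSeq, hp, if_true]
        exact abs_le_of_mul_sq_le h2 (by nlinarith [sq_nonneg (X.U k i)])
      · simp [norm, restrictSeq, hp]
    · refine fun k _ i _ => abs_le.1 ?_
      by_cases hp : pω k i
      · have := le_cost_freq X Z hp.2 hp.1
        simp only [norm, restrictSeq, hp, if_true]
        exact abs_le_of_mul_sq_le (S.e_pos i hp.2) (by linarith)
      · simp [norm, restrictSeq, hp]
  obtain ⟨x, hxm, hx⟩ := hK.exists_isMinOn ⟨_, hmem X₀ Z₀ h₀ le_rfl⟩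
    (continuous_cost_simTraj (lam := lam) (ω := ω)).continuousOn
  have hx' : ∀ X' Z', FeasibleCvx G S T P lam ω Xref X' Z' → cost S T X' Z' ≤ C →
      cost S T (simTraj G S T P lam ω x.1) ⟨x.2.1, x.2.2⟩ ≤ cost S T X' Z' := by
    intro X' Z' h' hc
    have h1 := isMinOn_iff.1 hx _ (hmem X' Z' h' hc)
    have h2 := (h'.normalize hT).2
    exact h1.trans h2.le
  refine ⟨_, _, hxm.1, fun X' Z' h' => ?_⟩
  rcases le_total (cost S T X' Z') C with hc | hc
  · exact hx' X' Z' h' hc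
  · exact (hx' X₀ Z₀ h₀ le_rfl).trans hc

/-- The midpoint of two trajectories. -/
def DiscreteTraj.mid (X Y : DiscreteTraj n m) : DiscreteTraj n m where
  Λ k := (1 / 2 : ℝ) • (X.Λ k + Y.Λ k)
  Ω k := (1 / 2 : ℝ) • (X.Ω k + Y.Ω k)
  U k := (1 / 2 : ℝ) • (X.U k + Y.U k)

/-- The midpoint of two slack sequences. -/
def Slack.mid (Z W : Slack n) : Slack n where
  B k := (1 / 2 : ℝ) • (Z.B k + W.B k)
  Γ k := (1 / 2 : ℝ) • (Z.Γ k + W.Γ k)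

lemma netPower_mid (s s' : Fin m → ℝ) (ω ω' q : Fin n → ℝ) (i : Fin n) :
    G.netPower ((1 / 2 : ℝ) • (s + s')) ((1 / 2 : ℝ) • (ω + ω')) q i =
      1 / 2 * (G.netPower s ω q i + G.netPower s' ω' q i) := by
  simp only [PowerNetwork.netPower, Matrix.mulVec_smul, Matrix.mulVec_add, Pi.smul_apply,
    Pi.add_apply, smul_eq_mul]
  ring

/-- Once the reference has selected the threshold region of each bus and step, every constraint is
convex. This fails for `InPhiDisc`, where the region depends on the trajectory itself. -/
lemma FeasibleCvx.mid {Xref X Y : DiscreteTraj n m} {Z W : Slack n}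
    (hX : FeasibleCvx G S T P lam ω Xref X Z) (hY : FeasibleCvx G S T P lam ω Xref Y W) :
    FeasibleCvx G S T P lam ω Xref (X.mid Y) (Z.mid W) := by
  obtain ⟨⟨⟨a1, a2, a3⟩, a4, a5, a6⟩, a7⟩ := hX
  obtain ⟨⟨⟨b1, b2, b3⟩, b4, b5, b6⟩, b7⟩ := hY
  have hhalf : ∀ {ι : Type} (f : ι → ℝ), (1 / 2 : ℝ) • (f + f) = f := by
    intro ι f; ext i; simp only [Pi.smul_apply, Pi.add_apply, smul_eq_mul]; ring
  refine ⟨⟨⟨?_, ?_, fun k hk => ⟨?_, fun i => ?_⟩⟩, ?_, ?_, ?_⟩, ?_⟩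
  · simp only [DiscreteTraj.mid, a1, b1, hhalf]
  · simp only [DiscreteTraj.mid, a2, b2, hhalf]
  · simp only [DiscreteTraj.mid, (a3 k hk).1, (b3 k hk).1, Matrix.mulVec_smul, Matrix.mulVec_add]
    module
  · have h1 := (a3 k hk).2 i
    have h2 := (b3 k hk).2 i
    simp only [DiscreteTraj.mid, netPower_mid, Pi.smul_apply, Pi.add_apply, smul_eq_mul]
    have : 1 / 2 * (G.netPower (X.Λ k) (X.Ω k) (P k) i + G.netPower (Y.Λ k) (Y.Ω k) (P k) i) +
        1 / 2 * (X.U k i + Y.U k i) =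
        1 / 2 * ((G.netPower (X.Λ k) (X.Ω k) (P k) i + X.U k i) +
          (G.netPower (Y.Λ k) (Y.Ω k) (P k) i + Y.U k i)) := by ring
    rw [this, ← h1, ← h2]
    ring
  · intro k hk i hi
    simp [DiscreteTraj.mid, a4 k hk i hi, b4 k hk i hi]
  · intro k hk i hi
    have h1 := a5 k hk i hi
    have h2 := b5 k hk i hi
    simp only [DiscreteTraj.mid, Slack.mid, Pi.smul_apply, Pi.add_apply, smul_eq_mul]
    refine ⟨?_, ?_, ?_⟩ <;> linarith
  · intro k hk1 hk i hi
    have h1 := a6 k hk1 hk i hi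
    have h2 := b6 k hk1 hk i hi
    simp only [DiscreteTraj.mid, Slack.mid, Pi.smul_apply, Pi.add_apply, smul_eq_mul]
    refine ⟨?_, ?_, ?_⟩ <;> linarith
  · intro i hi k hk
    have h1 := a7 i hi k hk
    have h2 := b7 i hi k hk
    simp only [DiscreteTraj.mid, Pi.smul_apply, Pi.add_apply, smul_eq_mul]
    refine ⟨fun h => ?_, fun h => ?_, fun h h' => ?_⟩
    · constructor <;> linarith [h1.1 h, h2.1 h]
    · constructor <;> linarith [h1.2.1 h, h2.2.1 h]
    · rw [h1.2.2 h h', h2.2.2 h h']; norm_num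

/-- The parallelogram identity of the cost. -/
lemma cost_mid (X Y : DiscreteTraj n m) (Z W : Slack n) :
    cost S T (X.mid Y) (Z.mid W) = (cost S T X Z + cost S T Y W) / 2 -
      1 / 4 * cost S T ⟨X.Λ, X.Ω, fun k => X.U k - Y.U k⟩
        ⟨fun k => Z.B k - W.B k, fun k => Z.Γ k - W.Γ k⟩ := by
  simp only [cost, DiscreteTraj.mid, Slack.mid, Pi.smul_apply, Pi.add_apply, Pi.sub_apply,
    smul_eq_mul]
  have : ∀ a b c d e f : ℝ, (a + b + (c + d)) / 2 - 1 / 4 * (e + f) =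
      ((a + c) / 2 - 1 / 4 * e) + ((b + d) / 2 - 1 / 4 * f) := by intros; ring
  rw [this]
  congr 1
  · rw [← Finset.sum_add_distrib, Finset.sum_div, Finset.mul_sum, ← Finset.sum_sub_distrib]
    refine Finset.sum_congr rfl fun i _ => ?_
    rw [← Finset.sum_add_distrib, Finset.sum_div, Finset.mul_sum, ← Finset.sum_sub_distrib]
    exact Finset.sum_congr rfl fun k _ => by ring
  · rw [← Finset.sum_add_distrib, Finset.sum_div, Finset.mul_sum, ← Finset.sum_sub_distrib]
    refine Finset.sum_congr rfl fun i _ => ?_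
    rw [← Finset.sum_add_distrib, Finset.sum_div, Finset.mul_sum, ← Finset.sum_sub_distrib]
    exact Finset.sum_congr rfl fun k _ => by ring

/-- The optimal input is unique. -/
lemma OptimalCvx.input_eq {Xref X Y : DiscreteTraj n m} {Z W : Slack n}
    (hX : OptimalCvx G S T P lam ω Xref X Z) (hY : OptimalCvx G S T P lam ω Xref Y W) :
    ∀ k < S.steps T, X.U k = Y.U k := by
  intro k hk
  ext i
  by_cases hi : i ∈ S.Iu
  -- The midpoint is no cheaper than either optimum, so in the parallelogram identity the cost of
  -- the difference is at most zero, and it dominates the squared input difference.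
  · have h1 := hX.2 _ _ (hX.1.mid hY.1)
    have h2 := hY.2 _ _ (hX.1.mid hY.1)
    rw [cost_mid] at h1 h2
    have h3 := le_cost_input (S := S) (T := T) ⟨X.Λ, X.Ω, fun k => X.U k - Y.U k⟩
      ⟨fun k => Z.B k - W.B k, fun k => Z.Γ k - W.Γ k⟩ hi hk
    simp only [Pi.sub_apply] at h3
    have hc := S.c_pos i hi
    have hd := S.d_pos i hi
    have h4 : S.c i * (X.U k i - Y.U k i) ^ 2 ≤ 0 := by
      nlinarith [sq_nonneg (Z.B k i - W.B k i)]
    have h5 : (X.U k i - Y.U k i) ^ 2 = 0 :=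
      le_antisymm (by nlinarith) (sq_nonneg _)
    exact sub_eq_zero.1 (pow_eq_zero_iff two_ne_zero |>.1 h5)
  · rw [hX.1.1.2.1 k hk i hi, hY.1.1.2.1 k hk i hi]

/-- Makes a reference trajectory a feasible point of the convex problem that it defines: outside the
threshold band the sign of `Ω` is known, so the product condition fixes the sign of `U`. -/
lemma InPhiDisc.inPhiCvx {X : DiscreteTraj n m} (h : InPhiDisc S T X) : InPhiCvx S T X X := by
  intro i hi k hk
  obtain ⟨h1, h2⟩ := h i hi k hk
  have hlo := S.thrlo_neg i hi
  have hhi := S.thrhi_pos i hi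
  refine ⟨fun h => ⟨h, ?_⟩, fun h => ⟨h, ?_⟩, fun h h' => h2 ⟨h, h'⟩⟩
  · have := h1 fun h' => absurd h'.2 (not_lt.2 h)
    nlinarith
  · have := h1 fun h' => absurd h'.1 (not_lt.2 h)
    nlinarith

lemma InPhiCvx.congr {Xref Xref' X : DiscreteTraj n m}
    (h : InPhiCvx S T Xref X) (he : ∀ k < S.steps T, Xref.Ω k = Xref'.Ω k) :
    InPhiCvx S T Xref' X := by
  intro i hi k hk
  rw [← he k hk]
  exact h i hi k hk

/-- The convex problem sees the reference only through its frequencies at steps below `N`, and these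
are determined by the state and the forecast. -/
lemma IsMPCInput.unique {t : ℝ} {pf : ℝ → Fin n → ℝ} {u u' : Fin n → ℝ} (hT : 0 < T)
    (h : IsMPCInput G S T t pf lam ω u) (h' : IsMPCInput G S T t pf lam ω u') : u = u' := by
  obtain ⟨Xr, X, Z, hg, -, ho, rfl⟩ := h
  obtain ⟨Yr, Y, W, hg', -, ho', rfl⟩ := h'
  have he : ∀ k < S.steps T, Xr.Ω k = Yr.Ω k := fun k hk => (hg.state_eq hT hg' k hk).2
  have ho'' : OptimalCvx G S T (fun k => pf (t + k * T)) lam ω Xr Y W :=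
    ⟨⟨ho'.1.1, ho'.1.2.congr fun k hk => (he k hk).symm⟩,
      fun X' Z' hf => ho'.2 X' Z' ⟨hf.1, hf.2.congr he⟩⟩
  exact ho.input_eq ho'' 0 (ControlSpec.steps_pos hT)

/-- For small step lengths the control law is well defined at all consistent states. -/
theorem exists_existsUnique_isMPCInput (G : PowerNetwork n m) (S : ControlSpec n)
    {p : ℝ → Fin n → ℝ} {pf : ℝ → ℝ → Fin n → ℝ} (hpf : ∀ t ≥ 0, pf t t = p t) (R : ℝ) :
    ∃ Tbar > 0, ∀ T, 0 < T → T ≤ Tbar → ∀ t ≥ 0,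
      (∀ τ ∈ Set.Icc t (t + S.horizon), ∀ i, |pf t τ i| ≤ R) →
      ∀ (lam : Fin m → ℝ) (ω : Fin n → ℝ), (∀ i, |ω i| ≤ R) → Consistent G S (p t) lam ω →
        ∃! u, IsMPCInput G S T t (pf t) lam ω u := by
  obtain ⟨Tbar, hTbar, H⟩ := exists_isReferenceTraj G S R
  refine ⟨Tbar, hTbar, fun T hT hTT t ht hR lam ω hω hc => ?_⟩
  have hP : ∀ k < S.steps T, ∀ i, |pf t (t + k * T) i| ≤ R := by
    intro k hk i
    refine hR _ ⟨?_, ?_⟩ i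
    · have : 0 ≤ (k : ℝ) * T := by positivity
      linarith
    · linarith [ControlSpec.mul_lt_horizon hT hk]
  obtain ⟨hg, hr⟩ := H T hT hTT (fun k => pf t (t + k * T)) lam ω hP hω (by
    simpa [hpf t ht] using hc)
  obtain ⟨Z₀, hc₀, hd₀⟩ := id hr
  obtain ⟨X, Z, ho⟩ := FeasibleCvx.exists_optimal hT ⟨hc₀, hd₀.inPhiCvx⟩
  exact ⟨X.U 0, ⟨_, X, Z, hg, hr, ho, rfl⟩, fun u hu =>
    hu.unique hT ⟨_, X, Z, hg, hr, ho, rfl⟩⟩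

end

/-! ### Primitives of integrable functions and invariance of intervals -/

/-- `y` is a primitive of the locally integrable function `g` on `[0, ∞)`. -/
def IsPrimitive (y g : ℝ → ℝ) : Prop :=
  ∀ t ≥ 0, IntervalIntegrable g volume 0 t ∧ y t = y 0 + ∫ s in (0 : ℝ)..t, g s

namespace IsPrimitive

variable {y g : ℝ → ℝ} (h : IsPrimitive y g)
include h

lemma intervalIntegrable {s t : ℝ} (hs : 0 ≤ s) (ht : 0 ≤ t) : IntervalIntegrable g volume s t :=
  (h s hs).1.symm.trans (h t ht).1

lemma sub_eq {s t : ℝ} (hs : 0 ≤ s) (ht : 0 ≤ t) : y t - y s = ∫ x in s..t, g x := by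
  rw [(h t ht).2, (h s hs).2, add_sub_add_left_eq_sub,
    intervalIntegral.integral_interval_sub_left (h t ht).1 (h s hs).1]

lemma continuousOn : ContinuousOn y (Ici 0) := by
  intro x hx
  have hx : 0 ≤ x := hx
  have h1 : ContinuousOn (fun t => y 0 + ∫ s in (0 : ℝ)..t, g s) (uIcc 0 (x + 1)) :=
    continuousOn_const.add (intervalIntegral.continuousOn_primitive_interval'
      (h (x + 1) (by linarith)).1 (by simp))
  rw [uIcc_of_le (by linarith)] at h1
  have h2 : ContinuousOn y (Icc 0 (x + 1)) := h1.congr fun t ht => (h t ht.1).2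
  refine (h2 x ⟨hx, by linarith⟩).mono_of_mem_nhdsWithin ?_
  rw [← Ici_inter_Iic, inter_comm]
  exact inter_mem (mem_nhdsWithin_of_mem_nhds (Iic_mem_nhds (by linarith))) self_mem_nhdsWithin

/-- For frequencies `g` contains the input and is only integrable, so the product rule is taken for
absolutely continuous functions. -/
lemma sq_sub_sq {s t : ℝ} (hs : 0 ≤ s) (hst : s ≤ t) :
    y t ^ 2 - y s ^ 2 = ∫ x in s..t, 2 * (y x * g x) := by
  have hg := h.intervalIntegrable hs (hs.trans hst)
  set Y : ℝ → ℝ := fun x => y s + ∫ r in s..x, g r with hY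
  have hYac : AbsolutelyContinuousOnInterval Y s t :=
    (contDiffOn_const.absolutelyContinuousOnInterval).add
      (hg.absolutelyContinuousOnInterval_intervalIntegral (c := s) (by simp))
  have hYy : ∀ x ∈ uIcc s t, Y x = y x := by
    intro x hx
    rw [uIcc_of_le hst] at hx
    simp only [hY]
    rw [← h.sub_eq hs (hs.trans hx.1)]
    ring
  have h1 := hYac.integral_deriv_mul_eq_sub hYac
  rw [hYy t (by simp), hYy s (by simp)] at h1
  rw [pow_two, pow_two, ← h1]
  refine intervalIntegral.integral_congr_ae ?_
  filter_upwards [hg.ae_hasDerivAt_integral] with x hx hxm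
  have hx' := uIoc_subset_uIcc hxm
  have hd : HasDerivAt Y (g x) x := (hx hx' s (by simp)).const_add (y s)
  rw [hd.deriv, hYy x hx']
  ring

/-- Meant for the angles, whose derivative is continuous, so the classical chain rule applies. -/
lemma comp_sub_comp {F F' : ℝ → ℝ} (hF : ∀ x, HasDerivAt F (F' x) x) (hF' : Continuous F')
    (hg : ContinuousOn g (Ici 0)) {s t : ℝ} (hs : 0 ≤ s) (hst : s ≤ t) :
    F (y t) - F (y s) = ∫ x in s..t, F' (y x) * g x := by
  have hy := h.continuousOn
  have hsub : Icc s t ⊆ Ici 0 := fun x hx => hs.trans hx.1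
  symm
  refine intervalIntegral.integral_eq_sub_of_hasDerivAt_of_le hst (f := fun x => F (y x))
    ?_ ?_ ?_
  · exact (continuous_iff_continuousAt.2 fun x => (hF x).continuousAt).comp_continuousOn
      (hy.mono hsub)
  · intro x hx
    have hx0 : 0 < x := hs.trans_lt hx.1
    have hd : HasDerivAt (fun t => y 0 + ∫ s in (0 : ℝ)..t, g s) (g x) x := by
      refine HasDerivAt.const_add _ (intervalIntegral.integral_hasDerivAt_right (h x hx0.le).1 ?_
        (hg.continuousAt (Ici_mem_nhds hx0)))
      exact ContinuousAt.stronglyMeasurableAtFilter isOpen_Ioi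
        (fun z hz => hg.continuousAt (Ici_mem_nhds hz)) x hx0
    have hd' : HasDerivAt y (g x) x := by
      refine hd.congr_of_eventuallyEq ?_
      filter_upwards [Ici_mem_nhds hx0] with z hz
      exact (h z hz).2
    exact (hF (y x)).comp x hd'
  · refine ContinuousOn.intervalIntegrable ?_
    rw [uIcc_of_le hst]
    exact (hF'.comp_continuousOn (hy.mono hsub)).mul (hg.mono hsub)

end IsPrimitive


/-- A nonnegative continuous function that decays at most exponentially stays positive. -/
lemma pos_of_sub_ge_neg_integral {y : ℝ → ℝ} {a τ K : ℝ} (hK : 0 < K) (ha : a < τ)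
    (hc : ContinuousOn y (Icc a τ)) (hpos : ∀ x ∈ Ico a τ, 0 < y x)
    (hy : ∀ b ∈ Icc a τ, -K * (∫ x in b..τ, y x) ≤ y τ - y b) : 0 < y τ := by
  -- On a final interval of length at most `1 / (2 * K)`, `K` times the integral from the maximum
  -- point `b` is at most `y b / 2`; hence at least `y b / 2` is left at `τ`.
  set a' := max a (τ - 1 / (2 * K)) with ha'
  have h1 : a' < τ := max_lt ha (by have : 0 < 1 / (2 * K) := by positivity
                                    linarith)
  have h2 : a ≤ a' := le_max_left _ _
  have h3 : K * (τ - a') ≤ 1 / 2 := by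
    have : τ - 1 / (2 * K) ≤ a' := le_max_right _ _
    have h4 : K * (τ - a') ≤ K * (1 / (2 * K)) :=
      mul_le_mul_of_nonneg_left (by linarith) hK.le
    refine h4.trans (le_of_eq ?_)
    field_simp
  obtain ⟨b, hb, hmax⟩ := isCompact_Icc.exists_isMaxOn (nonempty_Icc.2 h1.le)
    (hc.mono (Icc_subset_Icc_left h2))
  rw [isMaxOn_iff] at hmax
  have hb0 : 0 < y b := (hpos a' ⟨h2, h1⟩).trans_le (hmax a' ⟨le_rfl, h1.le⟩)
  have hint : ∫ x in b..τ, y x ≤ ∫ x in b..τ, y b := by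
    refine intervalIntegral.integral_mono_on hb.2 ?_ intervalIntegrable_const ?_
    · refine ContinuousOn.intervalIntegrable ?_
      rw [uIcc_of_le hb.2]
      exact hc.mono (Icc_subset_Icc_left (h2.trans hb.1))
    · exact fun x hx => hmax x ⟨hb.1.trans hx.1, hx.2⟩
  rw [intervalIntegral.integral_const, smul_eq_mul] at hint
  have h5 := hy b ⟨h2.trans hb.1, hb.2⟩
  have h6 : K * (∫ x in b..τ, y x) ≤ K * (τ - a') * y b := by
    rw [mul_assoc]
    refine mul_le_mul_of_nonneg_left (hint.trans ?_) hK.le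
    exact mul_le_mul_of_nonneg_right (by linarith [hb.1]) hb0.le
  nlinarith

/-- Forward invariance of an interval for a primitive whose derivative is bounded from both sides
proportionally to the distance to the endpoints. -/
lemma IsPrimitive.mem_Ioo {y g : ℝ → ℝ} (h : IsPrimitive y g) {lo hi K : ℝ} (hK : 0 < K)
    (hg : ∀ t ≥ 0, y t ∈ Icc lo hi → -K * (y t - lo) ≤ g t ∧ g t ≤ K * (hi - y t))
    {s : ℝ} (hs : 0 ≤ s) (hys : y s ∈ Ioo lo hi) : ∀ t ≥ s, y t ∈ Ioo lo hi := by
  by_contra! hcon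
  obtain ⟨t, hst, hyt⟩ := hcon
  have hcont := h.continuousOn
  -- The least element `τ` of `B` is the first exit time. By continuity `y τ` is in the closed
  -- interval, and both distances to the endpoints turn out to be still positive at `τ`.
  set B := {x | x ∈ Icc s t ∧ y x ∉ Ioo lo hi}
  have hB : IsCompact B := by
    have h1 : IsClosed (Icc s t ∩ y ⁻¹' (Ioo lo hi)ᶜ) :=
      (hcont.mono fun x hx => hs.trans hx.1).preimage_isClosed_of_isClosed isClosed_Icc
        isOpen_Ioo.isClosed_compl
    exact isCompact_Icc.of_isClosed_subset h1 inter_subset_left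
  obtain ⟨τ, hτ, hmin⟩ := hB.exists_isLeast ⟨t, ⟨hst, le_rfl⟩, hyt⟩
  have hsτ : s < τ := hτ.1.1.lt_of_ne (by rintro rfl; exact hτ.2 hys)
  have hin : ∀ x ∈ Ico s τ, y x ∈ Ioo lo hi := by
    intro x hx
    by_contra hx'
    exact absurd (hmin ⟨⟨hx.1, hx.2.le.trans hτ.1.2⟩, hx'⟩) (not_le.2 hx.2)
  have hc : ContinuousOn y (Icc s τ) := hcont.mono fun x hx => hs.trans hx.1
  have hτm : y τ ∈ Icc lo hi := by
    have h1 : Tendsto y (𝓝[<] τ) (𝓝 (y τ)) :=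
      ((hcont.continuousAt (Ici_mem_nhds (hs.trans_lt hsτ))).tendsto).mono_left
        nhdsWithin_le_nhds
    refine isClosed_Icc.mem_of_tendsto h1 ?_
    filter_upwards [Ico_mem_nhdsLT hsτ] with x hx
    exact Ioo_subset_Icc_self (hin x hx)
  have hin' : ∀ x ∈ Icc s τ, y x ∈ Icc lo hi := by
    intro x hx
    rcases hx.2.eq_or_lt with rfl | hlt
    · exact hτm
    · exact Ioo_subset_Icc_self (hin x ⟨hx.1, hlt⟩)
  have hyi : ∀ b ∈ Icc s τ, IntervalIntegrable y volume b τ := by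
    intro b hb
    refine ContinuousOn.intervalIntegrable ?_
    rw [uIcc_of_le hb.2]
    exact hc.mono (Icc_subset_Icc_left hb.1)
  refine hτ.2 ⟨?_, ?_⟩
  · refine sub_pos.1 (pos_of_sub_ge_neg_integral (y := fun x => y x - lo) hK hsτ
      (hc.sub continuousOn_const) (fun x hx => sub_pos.2 (hin x hx).1) fun b hb => ?_)
    have hb0 := hs.trans hb.1
    rw [sub_sub_sub_cancel_right, h.sub_eq hb0 (hb0.trans hb.2),
      ← intervalIntegral.integral_const_mul]
    exact intervalIntegral.integral_mono_on hb.2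
      (((hyi b hb).sub intervalIntegrable_const).const_mul _)
      (h.intervalIntegrable hb0 (hb0.trans hb.2))
      fun x hx => (hg x (hb0.trans hx.1) (hin' x ⟨hb.1.trans hx.1, hx.2⟩)).1
  · refine sub_pos.1 (pos_of_sub_ge_neg_integral (y := fun x => hi - y x) hK hsτ
      (continuousOn_const.sub hc) (fun x hx => sub_pos.2 (hin x hx).2) fun b hb => ?_)
    have hb0 := hs.trans hb.1
    have e : hi - y τ - (hi - y b) = -(y τ - y b) := by ring
    rw [e, h.sub_eq hb0 (hb0.trans hb.2), neg_mul, neg_le_neg_iff,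
      ← intervalIntegral.integral_const_mul]
    exact intervalIntegral.integral_mono_on hb.2
      (h.intervalIntegrable hb0 (hb0.trans hb.2))
      ((intervalIntegrable_const.sub (hyi b hb)).const_mul _)
      fun x hx => (hg x (hb0.trans hx.1) (hin' x ⟨hb.1.trans hx.1, hx.2⟩)).2

/-! ### Consequences of the first prediction step; safety of the frequencies -/

section

variable {n m : ℕ} {G : PowerNetwork n m} {S : ControlSpec n} {T t : ℝ} {pf : ℝ → Fin n → ℝ}
  {lam : Fin m → ℝ} {ω u : Fin n → ℝ}

namespace IsMPCInput

variable (h : IsMPCInput G S T t pf lam ω u) (hT : 0 < T)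
include h hT

lemma eq_zero_of_notMem {i : Fin n} (hi : i ∉ S.Iu) : u i = 0 := by
  obtain ⟨Xr, X, Z, -, -, ho, rfl⟩ := h
  exact ho.1.1.2.1 0 (ControlSpec.steps_pos hT) i hi

lemma stability {i : Fin n} (hi : i ∈ S.Iu) :
    (S.thrhi i ≤ ω i → u i ≤ 0) ∧ (ω i ≤ S.thrlo i → 0 ≤ u i) ∧
      (S.thrlo i < ω i → ω i < S.thrhi i → u i = 0) := by
  obtain ⟨Xr, X, Z, hg, -, ho, rfl⟩ := h
  have := ho.1.2 i hi 0 (ControlSpec.steps_pos hT)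
  rw [hg.1.2.1] at this
  exact ⟨fun h => (this.1 h).2, fun h => (this.2.1 h).2, this.2.2⟩

/-- The control input acts towards the threshold band. -/
lemma sub_mul_nonpos {w : ℝ} (hw : ∀ i ∈ S.Iu, S.thrlo i < w ∧ w < S.thrhi i) (i : Fin n) :
    (ω i - w) * u i ≤ 0 := by
  by_cases hi : i ∈ S.Iu
  · obtain ⟨h1, h2, h3⟩ := h.stability hT hi
    obtain ⟨w1, w2⟩ := hw i hi
    rcases le_or_gt (S.thrhi i) (ω i) with h4 | h4
    · exact mul_nonpos_of_nonneg_of_nonpos (by linarith) (h1 h4)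
    rcases le_or_gt (ω i) (S.thrlo i) with h5 | h5
    · exact mul_nonpos_of_nonpos_of_nonneg (by linarith) (h2 h5)
    · rw [h3 h5 h4, mul_zero]
  · rw [h.eq_zero_of_notMem hT hi, mul_zero]

/-- Inside the safe interval `κ = 0`, so the slack drops out and the first predicted frequency is
safe. The angle state of the linear model starts at the true sines, so its step 0 contains the exact
right-hand side of the swing equation. -/
lemma exists_next {i : Fin n} (hi : i ∈ S.Iω) (hs : S.soft i = true)
    (hω : ω i ∈ Icc (S.ωlo i) (S.ωhi i)) :
    ∃ w ∈ Icc (S.ωlo i) (S.ωhi i),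
      G.M i * (w - ω i) / T = G.netPower (sinVec lam) ω (pf t) i + u i := by
  obtain ⟨Xr, X, Z, -, -, ho, rfl⟩ := h
  have hN := ControlSpec.steps_pos (S := S) hT
  have h1 := ho.1.1.2.2.2 1 le_rfl hN i hi
  have hκ : S.κ ω i = 0 := by simp [ControlSpec.κ, hω.1, hω.2, hs]
  rw [hκ, zero_mul, sub_zero, add_zero] at h1
  have h2 := (ho.1.1.1.2.2 0 hN).2 i
  rw [ho.1.1.1.1, ho.1.1.1.2.1] at h2
  refine ⟨X.Ω 1 i, ⟨h1.1, h1.2.1⟩, ?_⟩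
  simpa using h2

/-- At buses without inertia, the power balances under the reference feedback. -/
lemma balance {i : Fin n} (hM : G.M i = 0) :
    (-(G.E i * ω i) + (pf t i - (G.D.transpose.mulVec (G.Yb.mulVec (sinVec lam))) i)) +
        S.feedback i (ω i) (-(G.E i * ω i) +
          (pf t i - (G.D.transpose.mulVec (G.Yb.mulVec (sinVec lam))) i)) = 0 := by
  obtain ⟨Xr, X, Z, hg, -, ho, rfl⟩ := h
  have h0 := hg.balance (ControlSpec.steps_pos hT) hM
  have h1 := (balance_iff (P := fun k => pf (t + k * T))).1 h0
  rw [hg.1.1, hg.1.2.1] at h1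
  simpa using h1

end IsMPCInput

end

namespace IsClosedLoop

variable {n m : ℕ} {G : PowerNetwork n m} {S : ControlSpec n} {T : ℝ} {p : ℝ → Fin n → ℝ}
  {pf : ℝ → ℝ → Fin n → ℝ} {lam : ℝ → Fin m → ℝ} {ω u : ℝ → Fin n → ℝ}
  (h : IsClosedLoop G S T p pf lam ω u)
include h

lemma isPrimitive_angle (k : Fin m) :
    IsPrimitive (fun t => lam t k) (fun t => G.D.mulVec (ω t) k) :=
  fun t ht => ⟨h.angle_integrable t ht k, h.angle_eq t ht k⟩

lemma isPrimitive_freq {i : Fin n} (hM : 0 < G.M i) :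
    IsPrimitive (fun t => ω t i)
      (fun t => (G.M i)⁻¹ * (G.netPower (sinVec (lam t)) (ω t) (p t) i + u t i)) := by
  refine fun t ht => ⟨(h.freq_integrable t ht i hM).const_mul _, ?_⟩
  have := h.freq_eq t ht i hM
  rw [intervalIntegral.integral_const_mul]
  field_simp
  linarith

lemma rhs_mem_Icc (hT : 0 < T) (hpf : ∀ t ≥ 0, pf t t = p t) {i : Fin n} (hi : i ∈ S.Iω)
    (hs : S.soft i = true) {t : ℝ} (ht : 0 ≤ t) (hω : ω t i ∈ Icc (S.ωlo i) (S.ωhi i)) :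
    G.M i * (S.ωlo i - ω t i) / T ≤ G.netPower (sinVec (lam t)) (ω t) (p t) i + u t i ∧
      G.netPower (sinVec (lam t)) (ω t) (p t) i + u t i ≤ G.M i * (S.ωhi i - ω t i) / T := by
  obtain ⟨w, hw, e⟩ := (h.input t ht).exists_next hT hi hs hω
  rw [hpf t ht] at e
  have hM := G.M_nonneg i
  rw [← e]
  constructor
  · gcongr
    exact hw.1
  · gcongr
    exact hw.2

/-- Forward invariance of the safe interval. -/
lemma mem_Icc_of_mem (hT : 0 < T) (hpf : ∀ t ≥ 0, pf t t = p t) {i : Fin n} (hi : i ∈ S.Iω)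
    (hs : S.soft i = true) {s : ℝ} (hs0 : 0 ≤ s)
    (hω : 0 < G.M i → ω s i ∈ Ioo (S.ωlo i) (S.ωhi i)) {t : ℝ} (hst : s ≤ t) :
    ω t i ∈ Icc (S.ωlo i) (S.ωhi i) := by
  rcases (G.M_nonneg i).eq_or_lt with hM | hM
  -- Without inertia the reference balance holds at every time, and balanced soft frequencies are
  -- safe.
  · exact (ControlSpec.feedback_of_balance hi
      ((h.input t (hs0.trans hst)).balance hT hM.symm)).1 hs
  · refine Ioo_subset_Icc_self ((h.isPrimitive_freq hM).mem_Ioo (inv_pos.2 hT) ?_ hs0 (hω hM) t hst)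
    intro x hx hm
    obtain ⟨h1, h2⟩ := h.rhs_mem_Icc hT hpf hi hs hx hm
    constructor
    · rw [inv_mul_eq_div, le_div_iff₀ hM]
      refine le_trans (le_of_eq ?_) h1
      field_simp
      ring
    · rw [inv_mul_eq_div, div_le_iff₀ hM]
      refine h2.trans (le_of_eq ?_)
      field_simp

end IsClosedLoop

/-! ### The energy function -/

/-- The potential energy of a line with equilibrium angle `a`. -/
def lineEnergy (a x : ℝ) : ℝ := Real.cos a - Real.cos x - x * Real.sin a + a * Real.sin a

lemma hasDerivAt_lineEnergy (a x : ℝ) :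
    HasDerivAt (lineEnergy a) (Real.sin x - Real.sin a) x := by
  have := (((hasDerivAt_const x (Real.cos a)).sub (Real.hasDerivAt_cos x)).sub
    ((hasDerivAt_id x).mul_const (Real.sin a))).add_const (a * Real.sin a)
  convert! this using 1
  simp

lemma lineEnergy_self (a : ℝ) : lineEnergy a a = 0 := by unfold lineEnergy; ring

lemma sin_sub_sin_mul_pos {a x : ℝ} (ha : |a| ≤ Real.pi / 2) (hx : |x| ≤ Real.pi / 2)
    (hne : x ≠ a) : 0 < (Real.sin x - Real.sin a) * (x - a) := by
  have hm := Real.strictMonoOn_sin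
  rw [abs_le] at ha hx
  rcases hne.lt_or_gt with h | h
  · have := hm ⟨hx.1, hx.2⟩ ⟨ha.1, ha.2⟩ h
    exact mul_pos_of_neg_of_neg (by linarith) (by linarith)
  · have := hm ⟨ha.1, ha.2⟩ ⟨hx.1, hx.2⟩ h
    exact mul_pos (by linarith) (by linarith)

/-- By the mean value theorem, `lineEnergy a x = (sin c - sin a) * (x - a)` with `c` between `a` and
`x`, and the sine is strictly increasing there. -/
lemma lineEnergy_pos {a x : ℝ} (ha : |a| ≤ Real.pi / 2) (hx : |x| ≤ Real.pi / 2)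
    (hne : x ≠ a) : 0 < lineEnergy a x := by
  have hd := hasDerivAt_lineEnergy a
  have hcont : Continuous (lineEnergy a) := continuous_iff_continuousAt.2 fun x => (hd x).continuousAt
  rw [abs_le] at ha hx
  rcases hne.lt_or_gt with h | h
  · obtain ⟨c, hc, e⟩ := exists_hasDerivAt_eq_slope (lineEnergy a) _ h hcont.continuousOn
      fun x _ => hd x
    have h1 : Real.sin c < Real.sin a :=
      Real.strictMonoOn_sin ⟨by linarith [hc.1], by linarith [hc.2]⟩ ⟨ha.1, ha.2⟩ hc.2
    rw [eq_div_iff (by linarith), lineEnergy_self] at e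
    nlinarith
  · obtain ⟨c, hc, e⟩ := exists_hasDerivAt_eq_slope (lineEnergy a) _ h hcont.continuousOn
      fun x _ => hd x
    have h1 : Real.sin a < Real.sin c :=
      Real.strictMonoOn_sin ⟨ha.1, ha.2⟩ ⟨by linarith [hc.1], by linarith [hc.2]⟩ hc.1
    rw [eq_div_iff (by linarith), lineEnergy_self] at e
    nlinarith

lemma lineEnergy_nonneg {a x : ℝ} (ha : |a| ≤ Real.pi / 2) (hx : |x| ≤ Real.pi / 2) :
    0 ≤ lineEnergy a x := by
  by_cases h : x = a
  · rw [h, lineEnergy_self]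
  · exact (lineEnergy_pos ha hx h).le

section Upsilon

variable {m : ℕ}

lemma isOpen_Upsilon : IsOpen (Upsilon m) := by
  unfold Upsilon
  rw [ofPred_forall]
  exact isOpen_iInter_of_finite fun j => isOpen_lt (by fun_prop) continuous_const

lemma abs_le_of_mem_closure_Upsilon {lam : Fin m → ℝ} (h : lam ∈ closure (Upsilon m)) (j : Fin m) :
    |lam j| ≤ Real.pi / 2 := by
  have hc : IsClosed {lam : Fin m → ℝ | |lam j| ≤ Real.pi / 2} :=
    isClosed_le (by fun_prop) continuous_const
  exact closure_minimal (fun x hx => (hx j).le) hc h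

lemma isCompact_closure_Upsilon : IsCompact (closure (Upsilon m)) := by
  refine (isCompact_univ_pi fun _ : Fin m => isCompact_Icc (a := -(Real.pi / 2))
    (b := Real.pi / 2)).of_isClosed_subset isClosed_closure fun x hx j _ => ?_
  exact abs_le.1 (abs_le_of_mem_closure_Upsilon hx j)

lemma notMem_frontier_of_mem_Upsilon {lam : Fin m → ℝ} (h : lam ∈ Upsilon m) :
    lam ∉ frontier (closure (Upsilon m)) := fun hf =>
  hf.2 (interior_maximal subset_closure isOpen_Upsilon h)

end Upsilon

namespace PowerNetwork

variable {n m : ℕ} (G : PowerNetwork n m)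

/-- The deviation `Dᵀ Y_b (sin λ - sin λ^∞)` of the net line flows from their equilibrium value. -/
def flowDev (lamInf lam : Fin m → ℝ) : Fin n → ℝ :=
  G.D.transpose.mulVec (G.Yb.mulVec (sinVec lam - sinVec lamInf))

/-- The potential energy of the network. -/
def potential (lamInf lam : Fin m → ℝ) : ℝ := ∑ j, G.b j * lineEnergy (lamInf j) (lam j)

variable {G} {q : Fin n → ℝ} {lamInf lam : Fin m → ℝ} {ω : Fin n → ℝ}

lemma V_eq : G.V q lamInf lam ω =
    (1 / 2) * ∑ i with 0 < G.M i, G.M i * (ω i - G.ωsync q) ^ 2 + G.potential lamInf lam := rfl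

lemma sum_D_row (k : Fin m) : ∑ i, G.D k i = 0 := by
  have hne : G.pos k ≠ G.neg k := by
    have h1 := (G.line k).2
    rw [G.line_eq k, SimpleGraph.mem_edgeSet] at h1
    exact h1.ne
  have : ∀ i, G.D k i = (if i = G.pos k then 1 else 0) + (if i = G.neg k then -1 else 0) := by
    intro i
    simp only [D, Matrix.of_apply]
    split_ifs with h1 h2
    · exact absurd (h1.symm.trans h2) hne
    all_goals simp
  simp [this, Finset.sum_add_distrib]

lemma D_mulVec_sub_const (ω : Fin n → ℝ) (w : ℝ) :
    G.D.mulVec (fun i => ω i - w) = G.D.mulVec ω := by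
  ext k
  simp only [Matrix.mulVec, dotProduct, mul_sub, Finset.sum_sub_distrib, ← Finset.sum_mul,
    sum_D_row, zero_mul, sub_zero]

/-- `Dᵀ` is moved to the other factor. With frequency deviations for `θ` this is the exchange
between kinetic and potential energy; with angle differences it gives uniqueness of the equilibrium.
-/
lemma sum_mul_flowDev (θ : Fin n → ℝ) :
    ∑ i, θ i * G.flowDev lamInf lam i =
      ∑ j, G.b j * ((Real.sin (lam j) - Real.sin (lamInf j)) * G.D.mulVec θ j) := by
  have h1 : ∑ i, θ i * G.flowDev lamInf lam i = θ ⬝ᵥ G.flowDev lamInf lam := rfl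
  rw [h1, flowDev, Matrix.dotProduct_mulVec, Matrix.vecMul_transpose]
  refine Finset.sum_congr rfl fun j _ => ?_
  simp only [Yb, Matrix.mulVec_diagonal, sinVec, Pi.sub_apply]
  ring

lemma netPower_eq_of_isSyncEquilibrium (h : G.IsSyncEquilibrium q lamInf) (i : Fin n) :
    G.netPower (sinVec lam) ω q i = -(G.E i * (ω i - G.ωsync q)) - G.flowDev lamInf lam i := by
  have h1 := congrFun h.2.2 i
  simp only [netPower, flowDev, Matrix.mulVec_sub, Pi.sub_apply, Pi.zero_apply] at h1 ⊢
  linarith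

lemma continuous_flowDev : Continuous (G.flowDev lamInf) := by
  have := continuous_mulVec G.D.transpose
  have := continuous_mulVec G.Yb
  have h3 : Continuous (sinVec : (Fin m → ℝ) → _) := by unfold sinVec; fun_prop
  unfold flowDev
  fun_prop

lemma flowDev_self : G.flowDev lamInf lamInf = 0 := by
  simp [flowDev]

/-- The flow deviation is bounded and Lipschitz continuous. -/
lemma exists_flowDev_bound (G : PowerNetwork n m) : ∃ K > 0, ∀ lamInf : Fin m → ℝ,
    (∀ lam i, |G.flowDev lamInf lam i| ≤ K) ∧
    ∀ lam lam' a, 0 ≤ a → (∀ j, |lam j - lam' j| ≤ a) →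
      ∀ i, |G.flowDev lamInf lam i - G.flowDev lamInf lam' i| ≤ K * a := by
  obtain ⟨K, hK, h⟩ := exists_mulVec_bound (G.D.transpose * G.Yb)
  refine ⟨K * 2, by positivity, fun lamInf => ⟨fun lam i => ?_, fun lam lam' a ha hl i => ?_⟩⟩
  · rw [flowDev, Matrix.mulVec_mulVec]
    refine h _ 2 (by norm_num) (fun j => ?_) i
    have h1 := Real.abs_sin_le_one (lam j)
    have h2 := Real.abs_sin_le_one (lamInf j)
    have h3 := abs_sub (Real.sin (lam j)) (Real.sin (lamInf j))
    simp only [Pi.sub_apply, sinVec]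
    linarith
  · have e : G.flowDev lamInf lam i - G.flowDev lamInf lam' i =
        (G.D.transpose * G.Yb).mulVec (sinVec lam - sinVec lam') i := by
      simp only [flowDev, Matrix.mulVec_mulVec, Matrix.mulVec_sub, Pi.sub_apply]
      ring
    rw [e]
    refine (h _ a ha (fun j => ?_) i).trans (by nlinarith)
    refine le_trans ?_ (hl j)
    have := Real.abs_sin_sub_sin_le (lam j) (lam' j)
    simpa [sinVec] using this

section Equilibrium

variable (hinf : lamInf ∈ Upsilon m)
include hinf

lemma potential_nonneg (h : lam ∈ closure (Upsilon m)) : 0 ≤ G.potential lamInf lam :=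
  Finset.sum_nonneg fun j _ => mul_nonneg (G.b_pos j).le
    (lineEnergy_nonneg (hinf j).le (abs_le_of_mem_closure_Upsilon h j))

lemma potential_pos (h : lam ∈ closure (Upsilon m)) (hne : lam ≠ lamInf) :
    0 < G.potential lamInf lam := by
  obtain ⟨j, hj⟩ := Function.ne_iff.1 hne
  refine Finset.sum_pos' (fun j _ => mul_nonneg (G.b_pos j).le
    (lineEnergy_nonneg (hinf j).le (abs_le_of_mem_closure_Upsilon h j))) ⟨j, Finset.mem_univ _, ?_⟩
  exact mul_pos (G.b_pos j)
    (lineEnergy_pos (hinf j).le (abs_le_of_mem_closure_Upsilon h j) hj)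

omit hinf in
lemma continuous_potential : Continuous (G.potential lamInf) := by
  unfold potential lineEnergy
  fun_prop

omit hinf in
lemma continuous_V : Continuous fun x : (Fin m → ℝ) × (Fin n → ℝ) => G.V q lamInf x.1 x.2 := by
  unfold V
  fun_prop

omit hinf in
lemma V_equilibrium : G.V q lamInf lamInf (fun _ => G.ωsync q) = 0 := by
  simp [V]

omit hinf in
lemma potential_le_V : G.potential lamInf lam ≤ G.V q lamInf lam ω := by
  rw [V_eq]
  have : 0 ≤ ∑ i with 0 < G.M i, G.M i * (ω i - G.ωsync q) ^ 2 :=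
    Finset.sum_nonneg fun i _ => mul_nonneg (G.M_nonneg i) (sq_nonneg _)
  linarith

lemma kinetic_le_V (h : lam ∈ closure (Upsilon m)) {i : Fin n} (hM : 0 < G.M i) :
    1 / 2 * (G.M i * (ω i - G.ωsync q) ^ 2) ≤ G.V q lamInf lam ω := by
  have h1 := potential_nonneg (G := G) hinf h
  have h2 := Finset.single_le_sum (s := {i | 0 < G.M i})
    (f := fun i => G.M i * (ω i - G.ωsync q) ^ 2)
    (fun i _ => mul_nonneg (G.M_nonneg i) (sq_nonneg _)) (by simpa using hM)
  rw [V_eq]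
  linarith

/-- Small energy forces the state to be close to the equilibrium. -/
lemma exists_V_lt (q : Fin n → ℝ) {ε : ℝ} (hε : 0 < ε) : ∃ ρ > 0,
    ∀ lam ∈ closure (Upsilon m), ∀ ω, G.V q lamInf lam ω < ρ →
      dist lam lamInf < ε ∧ ∀ i, 0 < G.M i → |ω i - G.ωsync q| < ε := by
  -- Away from the equilibrium angles the potential is positive on a compact set, hence bounded
  -- below there.
  obtain ⟨ρ₁, hρ₁, h₁⟩ : ∃ ρ > 0, ∀ lam ∈ closure (Upsilon m), ε ≤ dist lam lamInf →
      ρ ≤ G.potential lamInf lam := by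
    have hK : IsCompact (closure (Upsilon m) ∩ {lam | ε ≤ dist lam lamInf}) :=
      isCompact_closure_Upsilon.inter_right
        (isClosed_le continuous_const (continuous_id.dist continuous_const))
    rcases (closure (Upsilon m) ∩ {lam | ε ≤ dist lam lamInf}).eq_empty_or_nonempty with he | hne
    · refine ⟨1, one_pos, fun lam h h' => ?_⟩
      exact absurd (show lam ∈ closure (Upsilon m) ∩ {lam | ε ≤ dist lam lamInf} from ⟨h, h'⟩)
        (by rw [he]; exact notMem_empty _)
    · obtain ⟨x, hx, hmin⟩ := hK.exists_isMinOn hne (continuous_potential (G := G)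
        (lamInf := lamInf)).continuousOn
      refine ⟨G.potential lamInf x, potential_pos hinf hx.1 ?_, fun lam h h' =>
        isMinOn_iff.1 hmin lam ⟨h, h'⟩⟩
      rintro rfl
      have h2 := hx.2
      simp only [mem_ofPred_eq, dist_self] at h2
      linarith
  obtain ⟨K, hK, hKM⟩ := exists_forall_le fun i => (G.M i)⁻¹
  refine ⟨min ρ₁ (ε ^ 2 / (2 * K)), lt_min hρ₁ (by positivity), fun lam hl ω hV => ⟨?_, ?_⟩⟩
  · by_contra! h
    exact absurd (h₁ lam hl h) (not_le.2 ((potential_le_V (q := q) (ω := ω)).trans_lt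
      (hV.trans_le (min_le_left _ _))))
  · intro i hM
    have h1 := (kinetic_le_V (q := q) (ω := ω) hinf hl hM).trans_lt
      (hV.trans_le (min_le_right _ _))
    have h2 : 1 ≤ K * G.M i := by
      have := hKM i
      rwa [inv_le_iff_one_le_mul₀ hM] at this
    rw [lt_div_iff₀ (by positivity)] at h1
    have h3 : (ω i - G.ωsync q) ^ 2 < ε ^ 2 := by
      nlinarith [sq_nonneg (ω i - G.ωsync q)]
    exact abs_lt_of_sq_lt_sq h3 hε.le

/-- The boundary of the box keeps a positive distance from the interior point `lamInf`, so its
energy is at least some `ρ > 0`; half of it gives strictness. -/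
lemma exists_lt_rBar (q : Fin n → ℝ) : ∃ ρ : ℝ, 0 < ρ ∧ (ρ : EReal) < G.rBar q lamInf := by
  obtain ⟨ε, hε, hball⟩ := Metric.isOpen_iff.1 isOpen_Upsilon lamInf hinf
  obtain ⟨ρ, hρ, h⟩ := exists_V_lt (G := G) hinf q hε
  refine ⟨ρ / 2, by positivity, lt_of_lt_of_le (EReal.coe_lt_coe_iff.2 (half_lt_self hρ)) ?_⟩
  refine le_iInf₂ fun lam hl => EReal.coe_le_coe_iff.2 ?_
  by_contra! hV
  have h1 := (h lam (isClosed_closure.frontier_subset hl) _ hV).1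
  exact notMem_frontier_of_mem_Upsilon (hball h1) hl

end Equilibrium

end PowerNetwork

/-! ### Two variants of Barbalat's lemma -/

/-- A variant of Barbalat's lemma: an integrable nonnegative function whose growth rate is bounded
from above tends to zero. -/
lemma tendsto_zero_of_integral_le {y : ℝ → ℝ} {B C : ℝ} (hy : ContinuousOn y (Ici 0))
    (h0 : ∀ t ≥ 0, 0 ≤ y t) (hB : ∀ t ≥ 0, ∫ x in (0 : ℝ)..t, y x ≤ B)
    (hC : ∀ s ≥ 0, ∀ t ≥ s, y t - y s ≤ C * (t - s)) : Tendsto y atTop (𝓝 0) := by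
  have hint : ∀ s ≥ 0, ∀ t ≥ s, IntervalIntegrable y volume s t := by
    intro s hs t hst
    refine ContinuousOn.intervalIntegrable ?_
    rw [uIcc_of_le hst]
    exact hy.mono fun x hx => hs.trans hx.1
  have hsub : ∀ s ≥ 0, ∀ t ≥ s,
      (∫ x in (0 : ℝ)..t, y x) - (∫ x in (0 : ℝ)..s, y x) = ∫ x in s..t, y x := fun s hs t hst =>
    intervalIntegral.integral_interval_sub_left (hint 0 le_rfl t (hs.trans hst)) (hint 0 le_rfl s hs)
  have hmono : Monotone fun t => ∫ x in (0 : ℝ)..(max t 0), y x := by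
    intro s t hst
    have h1 : max s 0 ≤ max t 0 := max_le_max_right 0 hst
    have h2 : 0 ≤ ∫ x in (max s 0)..(max t 0), y x :=
      intervalIntegral.integral_nonneg h1 fun x hx => h0 x ((le_max_right _ _).trans hx.1)
    rw [← hsub _ (le_max_right _ _) _ h1] at h2
    exact sub_nonneg.1 h2
  have hlim := tendsto_atTop_ciSup hmono ⟨B, by
    rintro _ ⟨t, rfl⟩
    exact hB _ (le_max_right _ _)⟩
  set L := ⨆ t, ∫ x in (0 : ℝ)..(max t 0), y x
  rw [Metric.tendsto_atTop]
  intro ε hε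
  set C' := |C| + 1
  have hC' : 0 < C' := by positivity
  -- If `y t ≥ ε`, the growth bound forces `y ≥ ε / 2` on `[t - r, t]`, an area of `r * (ε / 2)`;
  -- this contradicts convergence of the integral for large `t`.
  set r := ε / (2 * C')
  have hr : 0 < r := by positivity
  have hlim' := hlim.comp (tendsto_atTop_add_const_right atTop (-r) tendsto_id)
  have hd := hlim.sub hlim'
  rw [sub_self] at hd
  have hev := hd.eventually (gt_mem_nhds (show (0 : ℝ) < r * (ε / 2) by positivity))
  obtain ⟨t₁, ht₁⟩ := eventually_atTop.1 hev
  refine ⟨max t₁ r, fun t ht => ?_⟩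
  have htr : r ≤ t := (le_max_right _ _).trans ht
  have h1 := ht₁ t ((le_max_left _ _).trans ht)
  simp only [Function.comp_apply, id_eq] at h1
  rw [max_eq_left (by linarith), max_eq_left (by linarith),
    hsub _ (by linarith) _ (by linarith)] at h1
  rw [Real.dist_eq, sub_zero, abs_of_nonneg (h0 t (by linarith))]
  by_contra! hcon
  have h2 : ∫ x in (t + -r)..t, ε / 2 ≤ ∫ x in (t + -r)..t, y x := by
    refine intervalIntegral.integral_mono_on (by linarith) intervalIntegrable_const
      (hint _ (by linarith) _ (by linarith)) fun x hx => ?_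
    have h3 := hC x (by linarith [hx.1]) t hx.2
    have h4 : C * (t - x) ≤ C' * r :=
      mul_le_mul (by simp only [C']; linarith [le_abs_self C]) (by linarith [hx.1])
        (by linarith [hx.2]) hC'.le
    have h5 : C' * r = ε / 2 := by simp only [r]; field_simp
    linarith
  rw [intervalIntegral.integral_const, smul_eq_mul] at h2
  have : (t - (t + -r)) * (ε / 2) = r * (ε / 2) := by ring
  linarith

/-- A variant of Barbalat's lemma: if a primitive converges and its derivative is, up to a
vanishing term, Lipschitz continuous, then the derivative vanishes at infinity. -/
lemma IsPrimitive.tendsto_zero {y f φ : ℝ → ℝ} (h : IsPrimitive y f) {c L : ℝ}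
    (hy : Tendsto y atTop (𝓝 c)) (hf : Tendsto (fun t => f t + φ t) atTop (𝓝 0))
    (hφ : ∀ s ≥ 0, ∀ t ≥ s, |φ t - φ s| ≤ L * (t - s)) : Tendsto φ atTop (𝓝 0) := by
  rw [Metric.tendsto_atTop]
  intro ε hε
  set L' := |L| + 1
  have hL' : 0 < L' := by positivity
  set r := ε / (4 * L')
  have hr : 0 < r := by positivity
  have hy' := (hy.comp (tendsto_atTop_add_const_right atTop r tendsto_id)).sub hy
  rw [sub_self] at hy'
  obtain ⟨t₁, ht₁⟩ := Metric.tendsto_atTop.1 hy' (ε / 4 * r) (by positivity)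
  obtain ⟨t₂, ht₂⟩ := Metric.tendsto_atTop.1 hf (ε / 4) (by positivity)
  refine ⟨max 0 (max t₁ t₂), fun t ht => ?_⟩
  have ht0 : 0 ≤ t := (le_max_left _ _).trans ht
  have h1 := ht₁ t (((le_max_left _ _).trans (le_max_right _ _)).trans ht)
  have htt : t₂ ≤ t := ((le_max_right _ _).trans (le_max_right _ _)).trans ht
  simp only [Function.comp_apply, id_eq, Real.dist_eq, sub_zero] at h1 ⊢
  -- On a window of length `r` the derivative stays within `ε / 2` of `-φ t`, so the increment of
  -- `y` is close to `-r * φ t`; convergence of `y` makes that increment small.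
  have h2 : ‖∫ x in t..(t + r), (f x + φ t)‖ ≤ ε / 2 * |t + r - t| := by
    refine intervalIntegral.norm_integral_le_of_norm_le_const fun x hx => ?_
    rw [uIoc_of_le (by linarith)] at hx
    have h3 := ht₂ x (htt.trans hx.1.le)
    rw [Real.dist_eq, sub_zero] at h3
    have h4 := hφ t ht0 x hx.1.le
    have h5 : L * (x - t) ≤ L' * r :=
      mul_le_mul (by simp only [L']; linarith [le_abs_self L]) (by linarith [hx.2])
        (by linarith [hx.1]) hL'.le
    have h6 : L' * r = ε / 4 := by simp only [r]; field_simp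
    have e : f x + φ t = (f x + φ x) - (φ x - φ t) := by ring
    rw [Real.norm_eq_abs, e]
    have h7 := abs_sub (f x + φ x) (φ x - φ t)
    linarith
  rw [intervalIntegral.integral_add (h.intervalIntegrable ht0 (by linarith))
    intervalIntegrable_const, ← h.sub_eq ht0 (by linarith), intervalIntegral.integral_const,
    smul_eq_mul, add_sub_cancel_left, abs_of_pos hr, Real.norm_eq_abs] at h2
  have h8 : r * |φ t| ≤ |y (t + r) - y t + r * φ t| + |y (t + r) - y t| := by
    have h9 := abs_sub (y (t + r) - y t + r * φ t) (y (t + r) - y t)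
    rwa [add_sub_cancel_left, abs_mul, abs_of_pos hr] at h9
  have h10 : r * |φ t| < r * ε := by nlinarith
  exact lt_of_mul_lt_mul_left h10 hr.le

lemma intervalIntegrable_sum {ι : Type*} [Fintype ι] {f : ι → ℝ → ℝ} {a b : ℝ}
    (h : ∀ i, IntervalIntegrable (f i) volume a b) :
    IntervalIntegrable (fun x => ∑ i, f i x) volume a b := by
  have := IntervalIntegrable.sum Finset.univ fun i _ => h i
  rwa [show ∑ i, f i = fun x => ∑ i, f i x from by ext x; simp] at this

/-! ### Energy dissipation and convergence of the closed loop -/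

namespace IsClosedLoop

variable {n m : ℕ} {G : PowerNetwork n m} {S : ControlSpec n} {T : ℝ} {p : ℝ → Fin n → ℝ}
  {pf : ℝ → ℝ → Fin n → ℝ} {lam : ℝ → Fin m → ℝ} {ω u : ℝ → Fin n → ℝ}
  {q : Fin n → ℝ} {lamInf : Fin m → ℝ}
  (h : IsClosedLoop G S T p pf lam ω u)
include h

lemma continuousOn_angle : ContinuousOn lam (Ici 0) :=
  continuousOn_pi.2 fun k => (h.isPrimitive_angle k).continuousOn

section

variable (hT : 0 < T) (hpf : ∀ t ≥ 0, pf t t = p t) (hp : ∀ t ≥ 0, p t = q)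
include hT hpf hp

lemma mul_abs_sub_le_flowDev (lamInf : Fin m → ℝ) {i : Fin n} (hM : G.M i = 0) {s t : ℝ}
    (hs : 0 ≤ s) (ht : 0 ≤ t) :
    G.E i * |ω t i - ω s i| ≤ |G.flowDev lamInf (lam t) i - G.flowDev lamInf (lam s) i| := by
  have h1 := ControlSpec.abs_sub_le_of_balance ((h.input t ht).balance hT hM)
    ((h.input s hs).balance hT hM)
  rw [hpf t ht, hpf s hs, hp t ht, hp s hs] at h1
  rw [abs_sub_comm (G.flowDev lamInf (lam t) i)]
  refine h1.trans (le_of_eq ?_)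
  congr 1
  simp only [PowerNetwork.flowDev, Matrix.mulVec_sub, Pi.sub_apply]
  ring

/-- A frequency without inertia is not given as a primitive; its continuity comes from its Lipschitz
dependence on the line flows. -/
lemma continuousOn_freq (i : Fin n) : ContinuousOn (fun t => ω t i) (Ici 0) := by
  rcases (G.M_nonneg i).eq_or_lt with hM | hM
  · intro s hs
    have hc : ContinuousOn (fun t => G.flowDev 0 (lam t) i) (Ici 0) :=
      ((continuous_apply i).comp G.continuous_flowDev).comp_continuousOn h.continuousOn_angle
    have h1 : Tendsto (fun t => (G.E i)⁻¹ * |G.flowDev 0 (lam t) i - G.flowDev 0 (lam s) i|)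
        (𝓝[Ici 0] s) (𝓝 0) := by
      have h2 := ((hc s hs).tendsto.sub_const (G.flowDev 0 (lam s) i)).abs.const_mul (G.E i)⁻¹
      simpa using h2
    refine tendsto_iff_dist_tendsto_zero.2 (squeeze_zero' (Eventually.of_forall fun _ =>
      dist_nonneg) ?_ h1)
    filter_upwards [self_mem_nhdsWithin] with t ht
    rw [Real.dist_eq, inv_mul_eq_div, le_div_iff₀' (G.E_pos i)]
    exact h.mul_abs_sub_le_flowDev hT hpf hp 0 hM.symm hs ht
  · exact (h.isPrimitive_freq hM).continuousOn

lemma mem_angleDifferences {t : ℝ} (ht : 0 ≤ t) (h0 : lam 0 ∈ G.angleDifferences) :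
    lam t ∈ G.angleDifferences := by
  obtain ⟨θ, hθ⟩ := h0
  refine ⟨θ + fun i => ∫ s in (0 : ℝ)..t, ω s i, ?_⟩
  rw [Matrix.mulVec_add, hθ]
  ext k
  rw [h.angle_eq t ht k, Pi.add_apply]
  congr 1
  have hint : ∀ i, IntervalIntegrable (fun s => ω s i) volume 0 t := by
    intro i
    refine ContinuousOn.intervalIntegrable ?_
    rw [uIcc_of_le ht]
    exact (h.continuousOn_freq hT hpf hp i).mono fun x hx => hx.1
  simp only [Matrix.mulVec, dotProduct]
  rw [intervalIntegral.integral_finsetSum fun i _ => (hint i).const_mul _]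
  simp only [intervalIntegral.integral_const_mul]

lemma continuousOn_D_mulVec (k : Fin m) : ContinuousOn (fun t => G.D.mulVec (ω t) k) (Ici 0) := by
  have := continuousOn_pi.2 (h.continuousOn_freq hT hpf hp)
  exact ((continuous_apply k).comp (continuous_mulVec G.D)).comp_continuousOn this

variable (hthr : ∀ i ∈ S.Iu, S.thrlo i < G.ωsync q ∧ G.ωsync q < S.thrhi i)
  (hEq : G.IsSyncEquilibrium q lamInf)
include hthr hEq

/-- The energy dissipation inequality. -/
lemma V_sub_le {s t : ℝ} (hs : 0 ≤ s) (hst : s ≤ t) :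
    G.V q lamInf (lam t) (ω t) - G.V q lamInf (lam s) (ω s) ≤
      -∫ x in s..t, ∑ i, G.E i * (ω x i - G.ωsync q) ^ 2 := by
  set w := G.ωsync q
  have ht := hs.trans hst
  have hsub : Icc s t ⊆ Ici 0 := fun x hx => hs.trans hx.1
  have hωc : ∀ i, ContinuousOn (fun x => ω x i - w) (uIcc s t) := by
    intro i
    rw [uIcc_of_le hst]
    exact ((h.continuousOn_freq hT hpf hp i).mono hsub).sub continuousOn_const
  let f : Fin n → ℝ → ℝ := fun i x =>
    G.netPower (sinVec (lam x)) (ω x) (p x) i + u x i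
  have hfi : ∀ i, 0 < G.M i → IntervalIntegrable (f i) volume s t := fun i hM =>
    (h.freq_integrable s hs i hM).symm.trans (h.freq_integrable t ht i hM)
  have hfi' : ∀ i, IntervalIntegrable (fun x => (ω x i - w) * f i x) volume s t := by
    intro i
    rcases (G.M_nonneg i).eq_or_lt with hM | hM
    · have hz : IntervalIntegrable (fun _ : ℝ => (0 : ℝ)) volume s t := intervalIntegrable_const
      refine hz.congr fun x hx => ?_
      rw [uIoc_of_le hst] at hx
      simp only [f, h.freq_alg x (hs.trans hx.1.le) i hM.symm, mul_zero]
    · exact (hfi i hM).continuousOn_mul (hωc i)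
  have hkin : ∀ i, 0 < G.M i →
      1 / 2 * (G.M i * (ω t i - w) ^ 2) - 1 / 2 * (G.M i * (ω s i - w) ^ 2) =
        ∫ x in s..t, (ω x i - w) * f i x := by
    intro i hM
    have hprim : IsPrimitive (fun t => ω t i - w) (fun t => (G.M i)⁻¹ * f i t) := by
      intro t ht
      obtain ⟨h1, h2⟩ := h.isPrimitive_freq hM t ht
      refine ⟨h1, ?_⟩
      dsimp only [f] at h2 ⊢
      linarith
    have h1 := hprim.sq_sub_sq hs hst
    have h2 : ∀ x, 2 * ((ω x i - w) * ((G.M i)⁻¹ * f i x)) =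
        2 * (G.M i)⁻¹ * ((ω x i - w) * f i x) := fun x => by ring
    simp only [h2, intervalIntegral.integral_const_mul] at h1
    have h3 : ∫ x in s..t, (ω x i - w) * f i x =
        G.M i / 2 * (2 * (G.M i)⁻¹ * ∫ x in s..t, (ω x i - w) * f i x) := by
      field_simp
    rw [h3, ← h1]
    ring
  -- Buses without inertia may be added to the right side, because their algebraic equation makes
  -- the integrand vanish.
  have hkin' : 1 / 2 * ∑ i with 0 < G.M i, G.M i * (ω t i - w) ^ 2 -
      1 / 2 * ∑ i with 0 < G.M i, G.M i * (ω s i - w) ^ 2 =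
        ∑ i, ∫ x in s..t, (ω x i - w) * f i x := by
    rw [Finset.mul_sum, Finset.mul_sum, ← Finset.sum_sub_distrib, Finset.sum_filter]
    refine Finset.sum_congr rfl fun i _ => ?_
    split_ifs with hM
    · exact hkin i hM
    · have hM' : G.M i = 0 := le_antisymm (not_lt.1 hM) (G.M_nonneg i)
      symm
      refine intervalIntegral.integral_zero_ae (Eventually.of_forall fun x hx => ?_)
      rw [uIoc_of_le hst] at hx
      simp only [f, h.freq_alg x (hs.trans hx.1.le) i hM', mul_zero]
  let g : Fin m → ℝ → ℝ := fun j x =>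
    (Real.sin (lam x j) - Real.sin (lamInf j)) * G.D.mulVec (ω x) j
  have hgi : ∀ j, IntervalIntegrable (g j) volume s t := by
    intro j
    refine ContinuousOn.intervalIntegrable ?_
    rw [uIcc_of_le hst]
    have h1 : ContinuousOn (fun x => lam x j) (Icc s t) :=
      (h.isPrimitive_angle j).continuousOn.mono hsub
    exact ((Real.continuous_sin.comp_continuousOn h1).sub continuousOn_const).mul
      ((h.continuousOn_D_mulVec hT hpf hp j).mono hsub)
  have hpot : G.potential lamInf (lam t) - G.potential lamInf (lam s) =
      ∑ j, ∫ x in s..t, G.b j * g j x := by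
    rw [PowerNetwork.potential, PowerNetwork.potential, ← Finset.sum_sub_distrib]
    refine Finset.sum_congr rfl fun j _ => ?_
    rw [← mul_sub, intervalIntegral.integral_const_mul]
    congr 1
    exact (h.isPrimitive_angle j).comp_sub_comp (hasDerivAt_lineEnergy (lamInf j))
      (Real.continuous_sin.sub continuous_const) (h.continuousOn_D_mulVec hT hpf hp j) hs hst
  have htot : G.V q lamInf (lam t) (ω t) - G.V q lamInf (lam s) (ω s) =
      ∫ x in s..t, (∑ i, (ω x i - w) * f i x + ∑ j, G.b j * g j x) := by
    have hsum1 : IntervalIntegrable (fun x => ∑ i, (ω x i - w) * f i x) volume s t :=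
      intervalIntegrable_sum hfi'
    have hsum2 : IntervalIntegrable (fun x => ∑ j, G.b j * g j x) volume s t :=
      intervalIntegrable_sum fun j => (hgi j).const_mul (G.b j)
    rw [intervalIntegral.integral_add hsum1 hsum2,
      intervalIntegral.integral_finsetSum fun i _ => hfi' i,
      intervalIntegral.integral_finsetSum fun j _ => (hgi j).const_mul (G.b j),
      ← hkin', ← hpot, PowerNetwork.V_eq, PowerNetwork.V_eq]
    ring
  rw [htot, ← intervalIntegral.integral_neg]
  refine intervalIntegral.integral_mono_on hst ?_ ?_ ?_
  · exact (intervalIntegrable_sum hfi').add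
      (intervalIntegrable_sum fun j => (hgi j).const_mul (G.b j))
  · refine ContinuousOn.intervalIntegrable (ContinuousOn.neg ?_)
    exact continuousOn_finsetSum _ fun i _ => continuousOn_const.mul ((hωc i).pow 2)
  · intro x hx
    have hx0 := hs.trans hx.1
    -- The potential energy gained by the lines cancels the flow terms of the buses; what remains is
    -- damping plus the nonpositive `(ω - w) * u`.
    have h1 := PowerNetwork.sum_mul_flowDev (G := G) (lamInf := lamInf) (lam := lam x)
      (fun i => ω x i - w)
    rw [PowerNetwork.D_mulVec_sub_const] at h1
    rw [← h1, ← Finset.sum_add_distrib, ← Finset.sum_neg_distrib]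
    refine Finset.sum_le_sum fun i _ => ?_
    have h2 := (h.input x hx0).sub_mul_nonpos hT hthr i
    simp only [f]
    rw [hp x hx0, PowerNetwork.netPower_eq_of_isSyncEquilibrium hEq]
    nlinarith

lemma V_antitone {s t : ℝ} (hs : 0 ≤ s) (hst : s ≤ t) :
    G.V q lamInf (lam t) (ω t) ≤ G.V q lamInf (lam s) (ω s) := by
  have h1 := h.V_sub_le hT hpf hp hthr hEq hs hst
  have h2 : 0 ≤ ∫ x in s..t, ∑ i, G.E i * (ω x i - G.ωsync q) ^ 2 :=
    intervalIntegral.integral_nonneg hst fun x _ => Finset.sum_nonneg fun i _ =>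
      mul_nonneg (G.E_pos i).le (sq_nonneg _)
  linarith

/-- Sublevel sets of the energy below `r̄` are forward invariant. -/
lemma mem_Phi {r : ℝ} (hr : (r : EReal) < G.rBar q lamInf)
    (h0 : (lam 0, ω 0) ∈ G.Phi q lamInf r) : ∀ t ≥ 0, (lam t, ω t) ∈ G.Phi q lamInf r := by
  have hV : ∀ t ≥ 0, G.V q lamInf (lam t) (ω t) ≤ r := fun t ht =>
    (h.V_antitone hT hpf hp hthr hEq le_rfl ht).trans h0.2
  -- On the boundary the potential is at least `r̄ > r`, yet it never exceeds `V ≤ r`. A connected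
  -- path that misses the boundary stays in the interior.
  have hfr : ∀ t ≥ 0, lam t ∉ frontier (closure (Upsilon m)) := by
    intro t ht hf
    have h1 : G.rBar q lamInf ≤ _ := iInf₂_le (lam t) hf
    have h2 := EReal.coe_lt_coe_iff.1 (hr.trans_le h1)
    have h3 : G.V q lamInf (lam t) (fun _ => G.ωsync q) = G.potential lamInf (lam t) := by
      simp [PowerNetwork.V_eq]
    rw [h3] at h2
    exact absurd ((PowerNetwork.potential_le_V (q := q) (ω := ω t)).trans (hV t ht)) (not_le.2 h2)
  have hpre : IsPreconnected (lam '' Ici 0) := isPreconnected_Ici.image _ h.continuousOn_angle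
  have hsub : lam '' Ici 0 ⊆ interior (closure (Upsilon m)) := by
    refine hpre.subset_left_of_subset_union (v := (closure (Upsilon m))ᶜ) isOpen_interior
      isClosed_closure.isOpen_compl ?_ ?_ ?_
    · exact disjoint_compl_right.mono_left interior_subset
    · rintro _ ⟨t, ht, rfl⟩
      by_cases hc : lam t ∈ closure (Upsilon m)
      · by_contra hn
        refine hfr t ht ⟨subset_closure hc, fun hi => hn (Or.inl hi)⟩
      · exact Or.inr hc
    · refine ⟨lam 0, ⟨0, self_mem_Ici, rfl⟩, ?_⟩
      by_contra hn
      exact hfr 0 le_rfl ⟨subset_closure h0.1, hn⟩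
  exact fun t ht => ⟨interior_subset (hsub ⟨t, ht, rfl⟩), hV t ht⟩

end

end IsClosedLoop

namespace PowerNetwork

variable {n m : ℕ} {G : PowerNetwork n m} {lamInf lam : Fin m → ℝ}

lemma isClosed_angleDifferences (G : PowerNetwork n m) : IsClosed G.angleDifferences :=
  (LinearMap.range G.D.mulVecLin).closed_of_finiteDimensional

/-- Pairing with the difference of the bus angles gives a vanishing sum of terms `b (sin x - sin a)
(x - a)`, which are nonnegative on the box and zero only for `x = a`. Membership in the range of `D`
is what supplies the bus angles. -/
lemma eq_of_flowDev_eq_zero (hinf : lamInf ∈ Upsilon m) (hinf' : lamInf ∈ G.angleDifferences)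
    (hl : lam ∈ closure (Upsilon m)) (hl' : lam ∈ G.angleDifferences)
    (h : G.flowDev lamInf lam = 0) : lam = lamInf := by
  obtain ⟨θ, rfl⟩ := hl'
  obtain ⟨θ', rfl⟩ := hinf'
  have h1 := sum_mul_flowDev (G := G) (lamInf := G.D.mulVec θ') (lam := G.D.mulVec θ) (θ - θ')
  rw [h] at h1
  simp only [Pi.zero_apply, mul_zero, Finset.sum_const_zero, Matrix.mulVec_sub,
    Pi.sub_apply] at h1
  have hnn : ∀ j, 0 ≤ G.b j * ((Real.sin (G.D.mulVec θ j) - Real.sin (G.D.mulVec θ' j)) *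
      (G.D.mulVec θ j - G.D.mulVec θ' j)) := by
    intro j
    refine mul_nonneg (G.b_pos j).le ?_
    by_cases he : G.D.mulVec θ j = G.D.mulVec θ' j
    · rw [he, sub_self, sub_self, mul_zero]
    · exact (sin_sub_sin_mul_pos (hinf j).le (abs_le_of_mem_closure_Upsilon hl j) he).le
  ext j
  by_contra he
  have h2 := (Finset.sum_eq_zero_iff_of_nonneg fun j _ => hnn j).1 h1.symm j (Finset.mem_univ j)
  have h3 := sin_sub_sin_mul_pos (hinf j).le (abs_le_of_mem_closure_Upsilon hl j) he
  exact absurd h2 (mul_pos (G.b_pos j) h3).ne'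

end PowerNetwork

namespace IsClosedLoop

variable {n m : ℕ} {G : PowerNetwork n m} {S : ControlSpec n} {T : ℝ} {p : ℝ → Fin n → ℝ}
  {pf : ℝ → ℝ → Fin n → ℝ} {lam : ℝ → Fin m → ℝ} {ω u : ℝ → Fin n → ℝ}
  {q : Fin n → ℝ} {lamInf : Fin m → ℝ}
  (h : IsClosedLoop G S T p pf lam ω u)
  (hT : 0 < T) (hpf : ∀ t ≥ 0, pf t t = p t) (hp : ∀ t ≥ 0, p t = q)
  (hthr : ∀ i ∈ S.Iu, S.thrlo i < G.ωsync q ∧ G.ωsync q < S.thrhi i)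
  (hEq : G.IsSyncEquilibrium q lamInf)
include h hT hp hthr hEq

/-- The energy does not see frequencies without inertia. They are controlled by the flows instead,
since the input works against the deviation. -/
lemma mul_abs_sub_ωsync_le {i : Fin n} (hM : G.M i = 0) {t : ℝ} (ht : 0 ≤ t) :
    G.E i * |ω t i - G.ωsync q| ≤ |G.flowDev lamInf (lam t) i| := by
  have h1 := h.freq_alg t ht i hM
  rw [hp t ht, PowerNetwork.netPower_eq_of_isSyncEquilibrium hEq] at h1
  have h2 := (h.input t ht).sub_mul_nonpos hT hthr i
  set x := ω t i - G.ωsync q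
  set g := G.flowDev lamInf (lam t) i
  rw [← abs_neg g]
  refine mul_abs_le_abs (le_trans (le_of_eq ?_) h2)
  congr 1
  linarith

section Phi

variable {r : ℝ} (hΦ : ∀ t ≥ 0, (lam t, ω t) ∈ G.Phi q lamInf r)
include hΦ

lemma exists_freq_bound : ∃ B > 0, ∀ t ≥ 0, ∀ i, |ω t i - G.ωsync q| ≤ B := by
  obtain ⟨K, hK, hg⟩ := G.exists_flowDev_bound
  have hi : ∀ i, ∃ B, ∀ t ≥ 0, |ω t i - G.ωsync q| ≤ B := by
    intro i
    rcases (G.M_nonneg i).eq_or_lt with hM | hM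
    · refine ⟨K / G.E i, fun t ht => ?_⟩
      rw [le_div_iff₀' (G.E_pos i)]
      exact (h.mul_abs_sub_ωsync_le hT hp hthr hEq hM.symm ht).trans ((hg lamInf).1 _ i)
    · refine ⟨1 + 2 * r / G.M i, fun t ht => abs_le_of_mul_sq_le hM ?_⟩
      have h1 := PowerNetwork.kinetic_le_V (q := q) (ω := ω t) hEq.1 (hΦ t ht).1 hM
      have h2 : G.V q lamInf (lam t) (ω t) ≤ r := (hΦ t ht).2
      linarith
  choose B hB using hi
  obtain ⟨B', hB', hle⟩ := exists_forall_le B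
  exact ⟨B', hB', fun t ht i => (hB i t ht).trans (hle i)⟩

lemma exists_flowDev_lipschitz : ∃ L > 0, ∀ i, ∀ s ≥ 0, ∀ t ≥ s,
    |G.flowDev lamInf (lam t) i - G.flowDev lamInf (lam s) i| ≤ L * (t - s) := by
  obtain ⟨B, hB, hω⟩ := h.exists_freq_bound hT hp hthr hEq hΦ
  obtain ⟨K, hK, hg⟩ := G.exists_flowDev_bound
  obtain ⟨K', hK', hD⟩ := exists_mulVec_bound G.D
  refine ⟨K * (K' * B), by positivity, fun i s hs t hst => ?_⟩
  rw [mul_assoc]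
  have hts : 0 ≤ t - s := sub_nonneg.2 hst
  refine (hg lamInf).2 _ _ _ (by positivity) (fun j => ?_) i
  have hint : ‖∫ x in s..t, G.D.mulVec (ω x) j‖ ≤ K' * B * |t - s| := by
    refine intervalIntegral.norm_integral_le_of_norm_le_const fun x hx => ?_
    rw [uIoc_of_le hst] at hx
    have := hD (fun i => ω x i - G.ωsync q) B hB.le (hω x (hs.trans hx.1.le)) j
    rwa [PowerNetwork.D_mulVec_sub_const] at this
  rwa [abs_of_nonneg hts, Real.norm_eq_abs,
    ← (h.isPrimitive_angle j).sub_eq hs (hs.trans hst)] at hint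

include hpf

/-- Dissipation makes the squared deviation integrable. Its growth rate is bounded from above
although no bound on `u` is available, because `u` enters only through the nonpositive `(ω - ω^∞)
u`. -/
lemma tendsto_freq (i : Fin n) : Tendsto (fun t => ω t i) atTop (𝓝 (G.ωsync q)) := by
  set w := G.ωsync q
  obtain ⟨B, hB, hω⟩ := h.exists_freq_bound hT hp hthr hEq hΦ
  obtain ⟨L, hL, hLip⟩ := h.exists_flowDev_lipschitz hT hp hthr hEq hΦ
  obtain ⟨K, hK, hg⟩ := G.exists_flowDev_bound
  have hcont : ∀ i, ContinuousOn (fun t => ω t i - w) (Ici 0) := fun i =>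
    (h.continuousOn_freq hT hpf hp i).sub continuousOn_const
  have hE := G.E_pos i
  suffices hy : Tendsto (fun t => (ω t i - w) ^ 2) atTop (𝓝 0) by
    have h1 := hy.sqrt
    simp only [Real.sqrt_sq_eq_abs, Real.sqrt_zero] at h1
    have h2 := ((tendsto_zero_iff_abs_tendsto_zero _).2 h1).add_const w
    simpa using h2
  have hint : ∀ t ≥ 0, ∫ x in (0 : ℝ)..t, (ω x i - w) ^ 2 ≤ r / G.E i := by
    intro t ht
    rw [le_div_iff₀' hE, ← intervalIntegral.integral_const_mul]
    have h1 := h.V_sub_le hT hpf hp hthr hEq le_rfl ht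
    have h2 : G.V q lamInf (lam 0) (ω 0) ≤ r := (hΦ 0 le_rfl).2
    have h3 : 0 ≤ G.V q lamInf (lam t) (ω t) :=
      (PowerNetwork.potential_nonneg hEq.1 (hΦ t ht).1).trans PowerNetwork.potential_le_V
    have h4 : ∀ i, ContinuousOn (fun x => G.E i * (ω x i - w) ^ 2) (uIcc 0 t) := by
      intro i
      rw [uIcc_of_le ht]
      exact continuousOn_const.mul (((hcont i).mono fun x hx => hx.1).pow 2)
    have h5 : ∫ x in (0 : ℝ)..t, G.E i * (ω x i - w) ^ 2 ≤
        ∫ x in (0 : ℝ)..t, ∑ i, G.E i * (ω x i - w) ^ 2 := by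
      refine intervalIntegral.integral_mono_on ht (h4 i).intervalIntegrable
        (intervalIntegrable_sum fun i => (h4 i).intervalIntegrable) fun x _ => ?_
      exact Finset.single_le_sum (f := fun i => G.E i * (ω x i - w) ^ 2)
        (fun i _ => mul_nonneg (G.E_pos i).le (sq_nonneg _)) (Finset.mem_univ i)
    linarith
  rcases (G.M_nonneg i).eq_or_lt with hM | hM
  · refine tendsto_zero_of_integral_le ((hcont i).pow 2) (fun _ _ => sq_nonneg _) hint
      (C := L / G.E i * (2 * B)) fun s hs t hst => ?_
    have h1 := (h.mul_abs_sub_le_flowDev hT hpf hp lamInf hM.symm hs (hs.trans hst)).trans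
      (hLip i s hs t hst)
    rw [← le_div_iff₀' hE] at h1
    have h2 := hω t (hs.trans hst) i
    have h3 := hω s hs i
    have h4 : |(ω t i - w) + (ω s i - w)| ≤ 2 * B :=
      (abs_add_le _ _).trans (by linarith)
    calc (ω t i - w) ^ 2 - (ω s i - w) ^ 2
        = (ω t i - ω s i) * ((ω t i - w) + (ω s i - w)) := by ring
      _ ≤ |ω t i - ω s i| * |(ω t i - w) + (ω s i - w)| := by
        rw [← abs_mul]; exact le_abs_self _
      _ ≤ L * (t - s) / G.E i * (2 * B) :=
        mul_le_mul h1 h4 (abs_nonneg _) ((abs_nonneg _).trans h1)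
      _ = L / G.E i * (2 * B) * (t - s) := by ring
  · refine tendsto_zero_of_integral_le ((hcont i).pow 2) (fun _ _ => sq_nonneg _) hint
      (C := 2 * (G.M i)⁻¹ * (K ^ 2 / (4 * G.E i))) fun s hs t hst => ?_
    have hprim : IsPrimitive (fun t => ω t i - w)
        (fun t => (G.M i)⁻¹ * (G.netPower (sinVec (lam t)) (ω t) (p t) i + u t i)) := by
      intro t ht
      obtain ⟨h1, h2⟩ := h.isPrimitive_freq hM t ht
      refine ⟨h1, ?_⟩
      dsimp only at h2 ⊢
      linarith
    rw [hprim.sq_sub_sq hs hst, mul_comm _ (t - s), ← smul_eq_mul (t - s),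
      ← intervalIntegral.integral_const]
    refine intervalIntegral.integral_mono_on hst ?_ intervalIntegrable_const fun x hx => ?_
    · refine ((hprim.intervalIntegrable hs (hs.trans hst)).continuousOn_mul ?_).const_mul 2
      rw [uIcc_of_le hst]
      exact (hcont i).mono fun x hx => hs.trans hx.1
    · have hx0 := hs.trans hx.1
      have h1 := (h.input x hx0).sub_mul_nonpos hT hthr i
      rw [hp x hx0, PowerNetwork.netPower_eq_of_isSyncEquilibrium hEq]
      set g := G.flowDev lamInf (lam x) i
      have h2 : g ^ 2 ≤ K ^ 2 := sq_le_sq' (abs_le.1 ((hg lamInf).1 (lam x) i)).1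
        (abs_le.1 ((hg lamInf).1 (lam x) i)).2
      have h3 : (ω x i - w) * (-(G.E i * (ω x i - w)) - g + u x i) ≤ K ^ 2 / (4 * G.E i) := by
        rw [le_div_iff₀ (by positivity)]
        -- Completing the square: `-E x^2 - g x ≤ g^2 / (4 E)`.
        nlinarith [sq_nonneg (2 * G.E i * (ω x i - w) + g)]
      have h4 := mul_le_mul_of_nonneg_left h3 (show 0 ≤ 2 * (G.M i)⁻¹ by positivity)
      refine le_trans (le_of_eq ?_) h4
      ring

lemma exists_input_eq_zero : ∃ t₁ ≥ 0, ∀ t ≥ t₁, ∀ i ∈ S.Iu, u t i = 0 := by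
  have hev : ∀ᶠ t in atTop, ∀ i ∈ S.Iu, ω t i ∈ Ioo (S.thrlo i) (S.thrhi i) := by
    rw [eventually_all_finset]
    exact fun i hi => (h.tendsto_freq hT hpf hp hthr hEq hΦ i).eventually
      (Ioo_mem_nhds (hthr i hi).1 (hthr i hi).2)
  obtain ⟨t₁, ht₁⟩ := eventually_atTop.1 hev
  refine ⟨max t₁ 0, le_max_right _ _, fun t ht i hi => ?_⟩
  have h1 := ht₁ t ((le_max_left _ _).trans ht) i hi
  exact ((h.input t ((le_max_right _ _).trans ht)).stability hT hi).2.2 h1.1 h1.2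

/-- Once the input has vanished, the flow deviation is minus the frequency derivative (times
inertia) up to the vanishing damping term. It is Lipschitz in time, so the second Barbalat variant
applies. -/
lemma tendsto_flowDev : Tendsto (fun t => G.flowDev lamInf (lam t)) atTop (𝓝 0) := by
  rw [tendsto_pi_nhds]
  intro i
  have hω : Tendsto (fun t => ω t i - G.ωsync q) atTop (𝓝 0) := by
    simpa using (h.tendsto_freq hT hpf hp hthr hEq hΦ i).sub_const (G.ωsync q)
  obtain ⟨t₁, ht₁, hu⟩ := h.exists_input_eq_zero hT hpf hp hthr hEq hΦ
  have hu0 : ∀ t ≥ t₁, u t i = 0 := by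
    intro t ht
    by_cases hi : i ∈ S.Iu
    · exact hu t ht i hi
    · exact (h.input t (ht₁.trans ht)).eq_zero_of_notMem hT hi
  rcases (G.M_nonneg i).eq_or_lt with hM | hM
  · have h1 : Tendsto (fun t => -(G.E i * (ω t i - G.ωsync q))) atTop (𝓝 0) := by
      simpa using (hω.const_mul (G.E i)).neg
    refine h1.congr' ?_
    filter_upwards [eventually_ge_atTop t₁] with t ht
    have h2 := h.freq_alg t (ht₁.trans ht) i hM.symm
    rw [hp t (ht₁.trans ht), PowerNetwork.netPower_eq_of_isSyncEquilibrium hEq, hu0 t ht] at h2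
    linarith
  · obtain ⟨L, hL, hLip⟩ := h.exists_flowDev_lipschitz hT hp hthr hEq hΦ
    have h1 : Tendsto (fun t => (G.M i)⁻¹ * G.flowDev lamInf (lam t) i) atTop (𝓝 0) := by
      refine (h.isPrimitive_freq hM).tendsto_zero (L := (G.M i)⁻¹ * L)
        (h.tendsto_freq hT hpf hp hthr hEq hΦ i) ?_ fun s hs t hst => ?_
      · have h2 : Tendsto (fun t => (G.M i)⁻¹ * -(G.E i * (ω t i - G.ωsync q))) atTop (𝓝 0) := by
          simpa using ((hω.const_mul (G.E i)).neg).const_mul (G.M i)⁻¹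
        refine h2.congr' ?_
        filter_upwards [eventually_ge_atTop t₁] with t ht
        rw [hp t (ht₁.trans ht), PowerNetwork.netPower_eq_of_isSyncEquilibrium hEq, hu0 t ht]
        ring
      · rw [← mul_sub, abs_mul, abs_of_pos (inv_pos.2 hM), mul_assoc]
        exact mul_le_mul_of_nonneg_left (hLip i s hs t hst) (inv_pos.2 hM).le
    have h2 := h1.const_mul (G.M i)
    simpa [mul_inv_cancel_left₀ hM.ne'] using h2

/-- The path stays in a compact set of angle differences, and every cluster point has zero flow
deviation, which leaves only `lamInf`. -/
lemma tendsto_angle (h0 : lam 0 ∈ G.angleDifferences) : Tendsto lam atTop (𝓝 lamInf) := by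
  have hK : IsCompact (closure (Upsilon m) ∩ G.angleDifferences) :=
    isCompact_closure_Upsilon.inter_right G.isClosed_angleDifferences
  refine hK.tendsto_nhds_of_unique_mapClusterPt ?_ fun x hx hcl => ?_
  · filter_upwards [eventually_ge_atTop 0] with t ht
    exact ⟨(hΦ t ht).1, h.mem_angleDifferences hT hpf hp ht h0⟩
  · refine PowerNetwork.eq_of_flowDev_eq_zero hEq.1 hEq.2.1 hx.1 hx.2 ?_
    have h1 : MapClusterPt (G.flowDev lamInf x) atTop (G.flowDev lamInf ∘ lam) :=
      hcl.continuousAt_comp G.continuous_flowDev.continuousAt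
    have h2 := h.tendsto_flowDev hT hpf hp hthr hEq hΦ
    have h3 : ClusterPt (G.flowDev lamInf x) (𝓝 0) := ClusterPt.mono h1 h2
    exact eq_of_nhds_neBot h3

lemma tendsto_state (h0 : lam 0 ∈ G.angleDifferences) :
    Tendsto (fun t => (lam t, ω t)) atTop (𝓝 (lamInf, fun _ => G.ωsync q)) :=
  (h.tendsto_angle hT hpf hp hthr hEq hΦ h0).prodMk_nhds
    (tendsto_pi_nhds.2 fun i => h.tendsto_freq hT hpf hp hthr hEq hΦ i)

end Phi

end IsClosedLoop

/-! ### Local asymptotic stability and the theorem -/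

section

variable {n m : ℕ} {G : PowerNetwork n m} {S : ControlSpec n} {T : ℝ} {p : ℝ → Fin n → ℝ}
  {pf : ℝ → ℝ → Fin n → ℝ} {q : Fin n → ℝ} {lamInf : Fin m → ℝ}

/-- States near the equilibrium have small energy. -/
lemma PowerNetwork.exists_mem_Phi (hEq : G.IsSyncEquilibrium q lamInf) {r : ℝ} (hr : 0 < r) :
    ∃ δ > 0, ∀ (lam : Fin m → ℝ) (ω : Fin n → ℝ),
      dist (lam, ω) (lamInf, fun _ => G.ωsync q) < δ → (lam, ω) ∈ G.Phi q lamInf r := by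
  have hV := (G.continuous_V (q := q) (lamInf := lamInf)).continuousAt
    (x := (lamInf, fun _ => G.ωsync q))
  have h1 : ∀ᶠ x in 𝓝 (lamInf, fun _ : Fin n => G.ωsync q), G.V q lamInf x.1 x.2 < r := by
    refine hV.eventually (gt_mem_nhds ?_)
    simpa [PowerNetwork.V_equilibrium] using hr
  have h2 : ∀ᶠ x in 𝓝 (lamInf, fun _ : Fin n => G.ωsync q), x.1 ∈ Upsilon m :=
    continuous_fst.continuousAt.eventually (isOpen_Upsilon.mem_nhds hEq.1)
  obtain ⟨δ, hδ, H⟩ := Metric.eventually_nhds_iff.1 (h1.and h2)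
  exact ⟨δ, hδ, fun lam ω hd => ⟨subset_closure (H hd).2, (H hd).1.le⟩⟩

theorem locallyAsymptoticallyStable (hT : 0 < T) (hpf : ∀ t ≥ 0, pf t t = p t)
    (hp : ∀ t ≥ 0, p t = q)
    (hthr : ∀ i ∈ S.Iu, S.thrlo i < G.ωsync q ∧ G.ωsync q < S.thrhi i)
    (hEq : G.IsSyncEquilibrium q lamInf) :
    LocallyAsymptoticallyStable G S T p pf lamInf (G.ωsync q) := by
  obtain ⟨r, hr, hrb⟩ := PowerNetwork.exists_lt_rBar (G := G) hEq.1 q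
  constructor
  · intro ε hε
    -- Frequencies without inertia are bounded through the flow deviation, so the angles must be
    -- close enough to make it smaller than `E i * ε`.
    obtain ⟨ε₁, hε₁, hflow⟩ : ∃ ε₁ > 0, ∀ lam, dist lam lamInf < ε₁ →
        ∀ i, |G.flowDev lamInf lam i| < G.E i * ε := by
      have h1 : ∀ᶠ lam in 𝓝 lamInf, ∀ i, |G.flowDev lamInf lam i| < G.E i * ε := by
        rw [eventually_all]
        intro i
        have hc : Continuous fun lam => |G.flowDev lamInf lam i| :=
          ((continuous_apply i).comp G.continuous_flowDev).abs
        refine hc.continuousAt.eventually (gt_mem_nhds ?_)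
        dsimp only
        rw [PowerNetwork.flowDev_self, Pi.zero_apply, abs_zero]
        exact mul_pos (G.E_pos i) hε
      exact Metric.eventually_nhds_iff.1 h1
    obtain ⟨ρ, hρ, hV⟩ := PowerNetwork.exists_V_lt (G := G) hEq.1 q (lt_min hε hε₁)
    have hr' : 0 < min r (ρ / 2) := lt_min hr (by positivity)
    obtain ⟨δ, hδ, hΦ⟩ := PowerNetwork.exists_mem_Phi hEq hr'
    refine ⟨δ, hδ, fun lam ω u h _ hd t ht => ?_⟩
    have hrb' : ((min r (ρ / 2) : ℝ) : EReal) < G.rBar q lamInf :=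
      (EReal.coe_le_coe_iff.2 (min_le_left _ _)).trans_lt hrb
    have hm := h.mem_Phi hT hpf hp hthr hEq hrb' (hΦ _ _ hd) t ht
    obtain ⟨h1, h2⟩ := hV (lam t) hm.1 (ω t) (lt_of_le_of_lt hm.2
      ((min_le_right _ _).trans_lt (half_lt_self hρ)))
    rw [Prod.dist_eq, max_lt_iff]
    refine ⟨h1.trans_le (min_le_left _ _), (dist_pi_lt_iff hε).2 fun i => ?_⟩
    rw [Real.dist_eq]
    rcases (G.M_nonneg i).eq_or_lt with hM | hM
    · have h3 := (h.mul_abs_sub_ωsync_le hT hp hthr hEq hM.symm ht).trans_lt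
        (hflow (lam t) (h1.trans_le (min_le_right _ _)) i)
      exact lt_of_mul_lt_mul_left h3 (G.E_pos i).le
    · exact (h2 i hM).trans_le (min_le_left _ _)
  · obtain ⟨δ, hδ, hΦ⟩ := PowerNetwork.exists_mem_Phi hEq hr
    refine ⟨δ, hδ, fun lam ω u h h0 hd => ?_⟩
    exact h.tendsto_state hT hpf hp hthr hEq
      (h.mem_Phi hT hpf hp hthr hEq hrb (hΦ _ _ hd)) h0

end

end

theorem mainTheorem1 {n m : ℕ} (G : PowerNetwork n m) (S : ControlSpec n)
    (p : ℝ → Fin n → ℝ) (pf : ℝ → ℝ → Fin n → ℝ) (hpf : ∀ t ≥ 0, pf t t = p t) :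
    -- for small sampling lengths the control law is well defined
    (∀ R : ℝ, ∃ Tbar > 0, ∀ T, 0 < T → T ≤ Tbar → ∀ t ≥ 0,
      (∀ τ ∈ Set.Icc t (t + S.horizon), ∀ i, |pf t τ i| ≤ R) →
      ∀ (lam : Fin m → ℝ) (ω : Fin n → ℝ), (∀ i, |ω i| ≤ R) → Consistent G S (p t) lam ω →
        ∃! u, IsMPCInput G S T t (pf t) lam ω u) ∧
    ∀ T > 0,
      (∀ (lam : ℝ → Fin m → ℝ) (ω u : ℝ → Fin n → ℝ), IsClosedLoop G S T p pf lam ω u →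
        -- the input vanishes inside the threshold band
        (∀ i ∈ S.Iu, ∀ t ≥ 0, ω t i ∈ Set.Ioo (S.thrlo i) (S.thrhi i) → u t i = 0) ∧
        -- forward invariance of the safe interval
        (∀ i ∈ S.Iω, S.soft i = true →
          (∀ s ≥ 0, ω s i ∈ Set.Icc (S.ωlo i) (S.ωhi i) →
            (0 < G.M i → ω s i ∈ Set.Ioo (S.ωlo i) (S.ωhi i)) →
              ∀ t ≥ s, ω t i ∈ Set.Icc (S.ωlo i) (S.ωhi i)) ∧
          (∀ t ≥ 0, ω t i = S.ωhi i →
            G.netPower (sinVec (lam t)) (ω t) (p t) i + u t i ≤ 0) ∧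
          (∀ t ≥ 0, ω t i = S.ωlo i →
            0 ≤ G.netPower (sinVec (lam t)) (ω t) (p t) i + u t i))) ∧
      ∀ q : Fin n → ℝ, (∀ t ≥ 0, p t = q) →
      (∀ i ∈ S.Iu, S.thrlo i < G.ωsync q ∧ G.ωsync q < S.thrhi i) →
      ∀ lamInf : Fin m → ℝ, G.IsSyncEquilibrium q lamInf →
        LocallyAsymptoticallyStable G S T p pf lamInf (G.ωsync q) ∧
        ∀ (r : ℝ) (lam : ℝ → Fin m → ℝ) (ω u : ℝ → Fin n → ℝ),
          0 ≤ r → (r : EReal) < G.rBar q lamInf →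
          IsClosedLoop G S T p pf lam ω u → lam 0 ∈ G.angleDifferences →
          (lam 0, ω 0) ∈ G.Phi q lamInf r →
            (∀ t ≥ 0, (lam t, ω t) ∈ G.Phi q lamInf r) ∧
            Tendsto (fun t => (lam t, ω t)) atTop (𝓝 (lamInf, fun _ => G.ωsync q)) ∧
            (∃ t₁ ≥ 0, ∀ t ≥ t₁, ∀ i ∈ S.Iu, u t i = 0) ∧
            (∀ i ∈ S.Iω, ∃ t₁ ≥ 0, ∀ t ≥ t₁, ω t i ∈ Set.Icc (S.ωlo i) (S.ωhi i)) := by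
  refine ⟨exists_existsUnique_isMPCInput G S hpf, fun T hT => ⟨fun lam ω u h => ⟨?_, ?_⟩, ?_⟩⟩
  · exact fun i hi t ht hω => ((h.input t ht).stability hT hi).2.2 hω.1 hω.2
  · intro i hi hs
    have hlt : S.ωlo i < S.ωhi i := (S.ωlo_lt i hi).trans
      ((ControlSpec.thrlo_lt_thrhi (S.subset hi)).trans (S.lt_ωhi i hi))
    refine ⟨fun s hs0 _ hω t hst => h.mem_Icc_of_mem hT hpf hi hs hs0 hω hst,
      fun t ht hω => ?_, fun t ht hω => ?_⟩
    · have := (h.rhs_mem_Icc hT hpf hi hs ht ⟨by linarith, hω.le⟩).2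
      rwa [hω, sub_self, mul_zero, zero_div] at this
    · have := (h.rhs_mem_Icc hT hpf hi hs ht ⟨hω.ge, by linarith⟩).1
      rwa [hω, sub_self, mul_zero, zero_div] at this
  · intro q hp hthr lamInf hEq
    refine ⟨locallyAsymptoticallyStable hT hpf hp hthr hEq, fun r lam ω u _ hrb h h0 hΦ₀ => ?_⟩
    have hΦ := h.mem_Phi hT hpf hp hthr hEq hrb hΦ₀
    refine ⟨hΦ, h.tendsto_state hT hpf hp hthr hEq hΦ h0,
      h.exists_input_eq_zero hT hpf hp hthr hEq hΦ, fun i hi => ?_⟩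
    obtain ⟨h1, h2⟩ := hthr i (S.subset hi)
    have hev := (h.tendsto_freq hT hpf hp hthr hEq hΦ i).eventually
      (Icc_mem_nhds ((S.ωlo_lt i hi).trans h1) (h2.trans (S.lt_ωhi i hi)))
    obtain ⟨t₁, ht₁⟩ := eventually_atTop.1 hev
    exact ⟨max t₁ 0, le_max_right _ _, fun t ht => ht₁ t ((le_max_left _ _).trans ht)⟩
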